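/- Let $T$ be a once punctured torus, so that $\pi_1(T)$ is free of rank two, and let $\Omega$ be the set of isotopy classes of unoriented essential (nontrivial, not boundary-parallel) simple closed curves in $T$; equivalently, an element of $\Omega$ is the union of the conjugacy classes of $g$ and $g^{-1}$ for some primitive $g\in\pi_1(T)$ (a member of a free basis). The curve complex of $T$ has vertex set $\Omega$; $X$ and $Y$ are joined by an edge iff they have minimal geometric intersection number one, equivalently iff they are represented by the two members of a free basis of $\pi_1(T)$; and its simplices are the finite sets of pairwise joined vertices. It is realized by the Farey triangulation of the hyperbolic plane. Let $\Sigma$ be the trivalent tree dual to the curve complex: its vertices are the 2-simplices $\{X,Y,Z\}$, and two distinct ones are adjacent iff they share a 1-simplex. The elements of $\Omega$ are identified with the complementary regions of $\Sigma$ in the hyperbolic plane, the vertices on the boundary of $X$ being the 2-simplices that contain $X$. A directed edge $\vec e$ of $\Sigma$, with underlying edge $e$, is written $\vec e\leftrightarrow\{X,Y;Z\to W\}$ if its tail is $\{X,Y,Z\}$ and its head is $\{X,Y,W\}$. Put $\Omega^0(e)=\{X,Y\}$, and let $\Omega^-(\vec e)$ be the set of regions whose boundary is contained in the component, containing the tail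 of $\vec e$, of $\Sigma$ with $e$ removed. Let $\rho:\pi_1(T)\to\mathrm{SL}(2,\mathbf C)$ be an irreducible representation, let $\tau=\operatorname{tr}\rho(aba^{-1}b^{-1})$ for a free basis $\{a,b\}$ of $\pi_1(T)$ (its peripheral trace), and let $\mu=\tau+2$. For $X\in\Omega$ write $\phi(X)=\operatorname{tr}\rho(X)$. Suppose that $\rho$ satisfies the Bowditch conditions: (i) $\operatorname{tr}\rho(X)\notin[-2,2]\subset\mathbf R$ for all $X\in\Omega$; (ii) the set $\{X\in\Omega : |\operatorname{tr}\rho(X)|\le 2\}$ is finite. With the square root taken to have nonnegative real part, define $$h_\mu(x)=\frac12\left(1-\frac{x^2-\frac23\mu}{x^2-\mu}\sqrt{1-\frac4{x^2}}\right),\qquad \Psi(x,y;z)=\frac{z}{xy}-\frac13\left(\frac12-\frac{z}{xy}\right)\left(\frac{\mu}{x^2-\mu}+\frac{\mu}{y^2-\mu}\right).$$ **Theorem 2.1.** Under these hypotheses $\phi(X)\ne0$ and $\phi(X)^2\neq\mu$ for all $X\in\Omega$ (so all the expressions below are defined), and for every directed edge $\vec e\leftrightarrow\{X,Y;Z\to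 W\}$ of $\Sigma$, $$\sum_{V\in\Omega^0(e)}h_\mu(\phi(V))+\sum_{V\in\Omega^-(\vec e)}2h_\mu(\phi(V))=\Psi(\phi(X),\phi(Y);\phi(W)),$$ where the infinite sum converges absolutely. -/

import Mathlib

open scoped MatrixGroups

noncomputable section

namespace PuncturedTorus

/-- The fundamental group of the once punctured torus: the free group of rank two. -/
abbrev Pi1 : Type := FreeGroup (Fin 2)

/-- `(a, b)` is a free basis of `π₁(T)`: the endomorphism sending the standard generators to `a`
and `b` is bijective. -/
def IsFreeBasis (a b : Pi1) : Prop :=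
  Function.Bijective (FreeGroup.lift ![a, b] : Pi1 →* Pi1)

/-- A primitive element is a member of some free basis. The primitive elements are exactly the
elements represented by (oriented) essential simple closed curves in the once punctured torus. -/
def IsPrimitive (a : Pi1) : Prop := ∃ b, IsFreeBasis a b

/-- Two primitive elements represent the same unoriented curve iff they are conjugate,
up to inversion. -/
def curveSetoid : Setoid {g : Pi1 // IsPrimitive g} where
  r g h := IsConj g.1 h.1 ∨ IsConj g.1 (h.1)⁻¹
  iseqv := by
    have inv_conj : ∀ {x y : Pi1}, IsConj x y → IsConj x⁻¹ y⁻¹ := by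
      intro x y h
      obtain ⟨c, hc⟩ := isConj_iff.1 h
      exact isConj_iff.2 ⟨c, by rw [← hc]; group⟩
    refine ⟨fun g => Or.inl (IsConj.refl _), ?_, ?_⟩
    · rintro g h (H | H)
      · exact Or.inl H.symm
      · right
        have := inv_conj H.symm
        rwa [inv_inv] at this
    · rintro g h k (H | H) (K | K)
      · exact Or.inl (H.trans K)
      · exact Or.inr (H.trans K)
      · exact Or.inr (H.trans (inv_conj K))
      · left
        have := inv_conj K
        rw [inv_inv] at this
        exact H.trans this

/-- `Ω`: the isotopy classes of unoriented essential simple closed curves in the once punctured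
torus, each given by the union of the conjugacy classes of a primitive element and its inverse. -/
def Omega : Type := Quotient curveSetoid

/-- The element `g` of `π₁(T)` represents the curve `X`, with some orientation. -/
def Represents (g : Pi1) (X : Omega) : Prop :=
  ∃ hg : IsPrimitive g, (Quotient.mk curveSetoid ⟨g, hg⟩ : Omega) = X

/-- The 1-skeleton of the curve complex: `X` and `Y` are joined iff they have minimal geometric
intersection number one, i.e. iff they are represented by the two members of a free basis. -/
def curveGraph : SimpleGraph Omega :=
  SimpleGraph.fromRel fun X Y => ∃ a b, IsFreeBasis a b ∧ Represents a X ∧ Represents b Y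

/-- The vertices of the tree `Σ` are the 2-simplices of the curve complex; the regions around the
vertex `v` are the three elements of `v.1`. -/
abbrev Vertex : Type := {s : Finset Omega // curveGraph.IsNClique 3 s}

/-- The tree `Σ` dual to the curve complex: two distinct 2-simplices are joined iff they share a
1-simplex. Its directed edges are `Tree.Dart`, with tail `e.fst` and head `e.snd`. -/
def Tree : SimpleGraph Vertex where
  Adj v w := v ≠ w ∧ ∃ X Y, X ≠ Y ∧ X ∈ v.1 ∧ Y ∈ v.1 ∧ X ∈ w.1 ∧ Y ∈ w.1
  symm := ⟨by
    rintro v w ⟨h, X, Y, hXY, h1, h2, h3, h4⟩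
    exact ⟨h.symm, X, Y, hXY, h3, h4, h1, h2⟩⟩
  loopless := ⟨fun _ h => h.1 rfl⟩

open Classical in
/-- `Ω⁰(e) = {X, Y}`: the regions that meet along the edge `e`. -/
def OmegaZero (e : Tree.Dart) : Finset Omega := e.fst.1 ∩ e.snd.1

/-- `Ω⁻(e)`: the regions whose boundary lies in the component, containing the tail of `e`, of the
tree with the edge `e` removed. The vertices on the boundary of `X` are those `v` with
`X ∈ v.1`. -/
def OmegaMinus (e : Tree.Dart) : Set Omega :=
  {X | ∀ v : Vertex, X ∈ v.1 → (Tree.deleteEdges {e.edge}).Reachable e.fst v}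

open Classical in
/-- The notation `e ↔ {X, Y; Z → W}`: the three regions around the tail of `e` are `X, Y, Z` and
the three regions around its head are `X, Y, W`. -/
def EdgeLabel (e : Tree.Dart) (X Y Z W : Omega) : Prop :=
  e.fst.1 = {X, Y, Z} ∧ e.snd.1 = {X, Y, W}

/-- The trace `tr ρ(X)` of a curve `X ∈ Ω`. -/
def tr (ρ : Pi1 →* SL(2, ℂ)) : Omega → ℂ :=
  Quotient.lift (fun g => (ρ g.1 : Matrix (Fin 2) (Fin 2) ℂ).trace) (by
    have conj : ∀ x y : Pi1, IsConj x y →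
        (ρ x : Matrix (Fin 2) (Fin 2) ℂ).trace = (ρ y : Matrix (Fin 2) (Fin 2) ℂ).trace := by
      intro x y h
      obtain ⟨c, rfl⟩ := isConj_iff.1 h
      rw [map_mul, map_mul, map_inv, Matrix.SpecialLinearGroup.coe_mul, Matrix.trace_mul_comm,
        ← Matrix.SpecialLinearGroup.coe_mul, inv_mul_cancel_left]
    rintro g h (H | H)
    · exact conj _ _ H
    · refine (conj _ _ H).trans ?_
      simp [Matrix.SpecialLinearGroup.coe_inv, Matrix.adjugate_fin_two, Matrix.trace_fin_two,
        add_comm])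

/-- The peripheral trace `τ = tr ρ(a b a⁻¹ b⁻¹)`. -/
def peripheralTrace (ρ : Pi1 →* SL(2, ℂ)) : ℂ :=
  (ρ (FreeGroup.of 0 * FreeGroup.of 1 * (FreeGroup.of 0)⁻¹ * (FreeGroup.of 1)⁻¹) :
    Matrix (Fin 2) (Fin 2) ℂ).trace

/-- `ρ` as a linear representation on `ℂ²`. -/
def linearRep (ρ : Pi1 →* SL(2, ℂ)) : Representation ℂ Pi1 (Fin 2 → ℂ) :=
  (LinearEquiv.automorphismGroup.toLinearMapMonoidHom.comp
    Matrix.SpecialLinearGroup.toLin').comp ρ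

/-- The Bowditch conditions. -/
structure BowditchConditions (ρ : Pi1 →* SL(2, ℂ)) : Prop where
  notMem_interval : ∀ (X : Omega) (t : ℝ), t ∈ Set.Icc (-2 : ℝ) 2 → tr ρ X ≠ (t : ℂ)
  finite_small : {X : Omega | ‖tr ρ X‖ ≤ 2}.Finite

/-- The function `h_μ` (`Complex.sqrt` is the square root with nonnegative real part). -/
def h (μ x : ℂ) : ℂ :=
  1 / 2 * (1 - (x ^ 2 - 2 / 3 * μ) / (x ^ 2 - μ) * Complex.sqrt (1 - 4 / x ^ 2))

/-- The edge value `Ψ(x, y; z)`. -/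
def Psi (μ x y z : ℂ) : ℂ :=
  z / (x * y) - 1 / 3 * (1 / 2 - z / (x * y)) * (μ / (x ^ 2 - μ) + μ / (y ^ 2 - μ))

end PuncturedTorus

end

open PuncturedTorus

open scoped commutatorElement

noncomputable section

namespace PuncturedTorus

/-! A directed edge comes from a free basis `(a, b)`: its tail is `{a, b, ab}` and its head is `{a,
b, ab⁻¹}`. The regions behind it are the new curves of a binary tree of bases generated by `(a, b) ↦
(a, ab)` and `(a, b) ↦ (ab, b)`; exponent sums show that they are all distinct
(`IsFreeBasis.omegaMinus_eq_range`, `IsFreeBasis.descendCurve_injective`). The statement thus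
becomes one about triples `(x, y, z)` of traces on a binary tree, with moves `(x, z, xz - y)` and
`(z, y, zy - x)`. All of them satisfy `x² + y² + z² = xyz + μ`. That `μ` is the same for every basis
is Nielsen's theorem: the commutator of a generating pair is determined up to conjugation and
inversion (`Generates.curveRel_commutator`), because a pair of least length with a given commutator
class is Nielsen reduced and hence consists of the standard generators up to sign and order.

The identity rests on the additivity of `Psi`: its value on an edge is the sum of its values on the
two edges behind (`Psi_eq_add`). Consequently the difference `defect` of the two sides is additive
as well. Far from the root, an edge that points backwards and borders a long region of trace `y` has
`Psi` within `O(1/|y|²)` of the contribution `h` of its older region (`norm_Psi_sub_h_le`).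
Splitting the defect at depth `n` bounds it by a constant times the tail, from depth `n` on, of the
sum of `1/|trace|²`; convergence of that sum forces the defect to vanish.

Convergence of that sum, together with the fact that almost all edges point backwards, is the
property `Controlled`. If it fails at a triple it fails at one of its children, so it fails along an
infinite path. A path that eventually follows one region of trace `l + l⁻¹`, `|l| > 1`, meets traces
growing like `lⁿ` (`BowditchTree.exists_spine`); this uses `x² ≠ μ`, which holds since otherwise the
traces around that region would decay in one direction and violate (ii). A path that turns
infinitely often eventually borders only long regions. One edge pointing backwards there already
gives convergence, so all edges point forwards and the total length decreases to a limit; a limit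
triple then forces `μ = 4` (`eq_four_of_norm_eq`), that is `τ = 2`, which irreducibility excludes.
-/

theorem exists_maximal_common_prefix {α : Type*} (L M : List α) :
    ∃ P A B, L = P ++ A ∧ M = P ++ B ∧ ∀ x ∈ A.head?, ∀ y ∈ B.head?, x ≠ y := by
  induction L generalizing M with
  | nil => exact ⟨[], [], M, by simp⟩
  | cons x L ih =>
    cases M with
    | nil => exact ⟨[], x :: L, [], by simp⟩
    | cons y M =>
      by_cases hxy : x = y
      · subst hxy
        obtain ⟨P, A, B, rfl, rfl, h⟩ := ih M
        exact ⟨x :: P, A, B, rfl, rfl, h⟩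
      · exact ⟨[], x :: L, y :: M, rfl, rfl, by simpa using hxy⟩

/-! ### Gromov products and cancellation in free groups -/

section Gromov

variable {α : Type*} [DecidableEq α]

/-- Twice the Gromov product of `u` and `v` at `1`, in the Cayley tree of a free group. -/
def gp (u v : FreeGroup α) : ℤ := (u.norm : ℤ) + v.norm - (u⁻¹ * v).norm

theorem isReduced_invRev {L : List (α × Bool)} (h : FreeGroup.IsReduced L) :
    FreeGroup.IsReduced (FreeGroup.invRev L) := by
  apply FreeGroup.IsReduced.of_reduce_eq
  rw [FreeGroup.reduce_invRev, h.reduce_eq]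

theorem gp_eq_of_common_prefix {u v : FreeGroup α} {P A B : List (α × Bool)}
    (hu : u.toWord = P ++ A) (hv : v.toWord = P ++ B)
    (h : ∀ x ∈ A.head?, ∀ y ∈ B.head?, x ≠ y) : gp u v = 2 * P.length := by
  have hmk : u⁻¹ * v = FreeGroup.mk (FreeGroup.invRev A ++ B) := by
    rw [← FreeGroup.mk_toWord (x := u), ← FreeGroup.mk_toWord (x := v), hu, hv,
      ← FreeGroup.mul_mk, ← FreeGroup.mul_mk, ← FreeGroup.mul_mk, ← FreeGroup.inv_mk]
    group
  have hA : FreeGroup.IsReduced A :=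
    (FreeGroup.isReduced_toWord (x := u)).infix ⟨P, [], by simp [hu]⟩
  have hB : FreeGroup.IsReduced B :=
    (FreeGroup.isReduced_toWord (x := v)).infix ⟨P, [], by simp [hv]⟩
  have hred : FreeGroup.IsReduced (FreeGroup.invRev A ++ B) := by
    refine List.IsChain.append (isReduced_invRev hA) hB ?_
    intro x hx y hy hxy
    cases A with
    | nil => simp [FreeGroup.invRev] at hx
    | cons a A =>
      have hx' : (a.1, !a.2) = x := by simpa [FreeGroup.invRev] using hx
      have := h a (by simp) y hy
      subst hx'
      by_contra hne
      apply this
      refine Prod.ext hxy ?_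
      revert hne
      cases a.2 <;> cases y.2 <;> simp
  have hn : (u⁻¹ * v).norm = A.length + B.length := by
    rw [hmk, FreeGroup.norm, FreeGroup.toWord_mk, hred.reduce_eq]
    simp
  rw [gp, hn, FreeGroup.norm, FreeGroup.norm, hu, hv]
  push_cast [List.length_append]
  ring

theorem even_gp (u v : FreeGroup α) : Even (gp u v) := by
  obtain ⟨P, A, B, hu, hv, h⟩ := exists_maximal_common_prefix u.toWord v.toWord
  rw [gp_eq_of_common_prefix hu hv h]
  exact even_two_mul _

theorem le_gp_iff {u v : FreeGroup α} {n : ℕ} :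
    2 * (n : ℤ) ≤ gp u v ↔ ∃ P, P.length = n ∧ P <+: u.toWord ∧ P <+: v.toWord := by
  obtain ⟨P, A, B, hu, hv, h⟩ := exists_maximal_common_prefix u.toWord v.toWord
  rw [gp_eq_of_common_prefix hu hv h]
  constructor
  · intro hn
    refine ⟨P.take n, by simp; omega, ?_, ?_⟩
    · rw [hu]; exact (List.take_prefix _ _).trans (List.prefix_append _ _)
    · rw [hv]; exact (List.take_prefix _ _).trans (List.prefix_append _ _)
  · rintro ⟨Q, rfl, hQu, hQv⟩
    by_contra hlt
    have hlt : P.length < Q.length := by omega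
    rw [hu] at hQu
    rw [hv] at hQv
    have hPQ : P <+: Q := List.prefix_of_prefix_length_le (List.prefix_append _ _) hQu hlt.le
    obtain ⟨R, rfl⟩ := hPQ
    rw [List.prefix_append_right_inj] at hQu hQv
    cases R with
    | nil => simp at hlt
    | cons r R =>
      obtain ⟨A', rfl⟩ := hQu
      obtain ⟨B', rfl⟩ := hQv
      exact h r (by simp) r (by simp) rfl

theorem gp_nonneg (u v : FreeGroup α) : 0 ≤ gp u v := by
  have := (le_gp_iff (u := u) (v := v) (n := 0)).2 ⟨[], rfl, by simp, by simp⟩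
  simpa using this

theorem gp_comm (u v : FreeGroup α) : gp u v = gp v u := by
  have : (u⁻¹ * v).norm = (v⁻¹ * u).norm := by
    rw [← FreeGroup.norm_inv_eq]; simp
  simp only [gp, this]; ring

/-- The Cayley tree is 0-hyperbolic: two words that each share `k` letters with `v` share those `k`
letters with one another. -/
theorem min_gp_le (u v w : FreeGroup α) : min (gp u v) (gp v w) ≤ gp u w := by
  obtain ⟨m, hm⟩ := (even_gp u v).two_dvd
  obtain ⟨n, hn⟩ := (even_gp v w).two_dvd
  have h1 := gp_nonneg u v
  have h2 := gp_nonneg v w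
  obtain ⟨k, hk⟩ : ∃ k : ℕ, (k : ℤ) = min m n := ⟨(min m n).toNat, by omega⟩
  obtain ⟨P, hP, hPu, hPv⟩ := (le_gp_iff (u := u) (v := v) (n := k)).1 (by omega)
  obtain ⟨Q, hQ, hQv, hQw⟩ := (le_gp_iff (u := v) (v := w) (n := k)).1 (by omega)
  have hPQ : P = Q := (List.prefix_of_prefix_length_le hPv hQv (by omega)).eq_of_length (by omega)
  have := (le_gp_iff (u := u) (v := w) (n := k)).2 ⟨P, hP, hPu, hPQ ▸ hQw⟩
  omega

theorem gp_eq_of_lt {u v w : FreeGroup α} (h : gp u v < gp v w) : gp u w = gp u v := by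
  have h1 := min_gp_le u v w
  have h2 := min_gp_le u w v
  rw [gp_comm w v] at h2
  omega

/-- If at least half of `u` cancelled in `u * u`, the word of `u` would be `A⁻¹ C A` with `C` equal
to its own inverse; free groups have no 2-torsion, so `u = 1`. -/
theorem norm_mul_self_gt {u : FreeGroup α} (hu : u ≠ 1) : gp u u⁻¹ < u.norm := by
  by_contra hle
  obtain ⟨m, hm⟩ := (even_gp u u⁻¹).two_dvd
  have h0 := gp_nonneg u u⁻¹
  obtain ⟨k, rfl⟩ : ∃ k : ℕ, m = k := ⟨m.toNat, by omega⟩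
  obtain ⟨P, hP, hPu, hPi⟩ := (le_gp_iff (u := u) (v := u⁻¹) (n := k)).1 (by omega)
  obtain ⟨A, hA⟩ := hPu
  have hlen : u.norm = P.length + A.length := by rw [FreeGroup.norm, ← hA]; simp
  have hpos : u.norm ≠ 0 := fun h => hu (FreeGroup.norm_eq_zero.1 h)
  rw [FreeGroup.toWord_inv, ← hA, FreeGroup.invRev_append] at hPi
  have hAP : FreeGroup.invRev A <+: P := by
    refine List.prefix_of_prefix_length_le (List.prefix_append _ (FreeGroup.invRev P)) hPi ?_
    simp; omega
  obtain ⟨C, hC⟩ := hAP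
  -- the word of `u` is `A⁻¹ C A`, and its inverse begins with `A⁻¹ C` too
  rw [← hC, List.prefix_append_right_inj] at hPi
  have hC2 : C <+: FreeGroup.invRev C := by
    rw [FreeGroup.invRev_append, FreeGroup.invRev_invRev] at hPi
    exact List.prefix_of_prefix_length_le hPi (List.prefix_append _ _) (by simp)
  have hCC : C = FreeGroup.invRev C := hC2.eq_of_length (by simp)
  have hmkC : FreeGroup.mk C = 1 := by
    have h1 : (FreeGroup.mk C : FreeGroup α) = (FreeGroup.mk C)⁻¹ := by
      rw [FreeGroup.inv_mk, ← hCC]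
    have h2 : (FreeGroup.mk C : FreeGroup α) ^ 2 = 1 := by
      rw [pow_two]; nth_rewrite 2 [h1]; exact mul_inv_cancel _
    exact (pow_eq_one_iff_left two_ne_zero).1 h2
  apply hu
  rw [← FreeGroup.mk_toWord (x := u), ← hA, ← hC, ← FreeGroup.mul_mk, ← FreeGroup.mul_mk, hmkC,
    ← FreeGroup.inv_mk, mul_one, inv_mul_cancel]

theorem exists_prefix_of_le {u : FreeGroup α} {m : ℕ} (h : m ≤ u.norm) :
    ∃ p : FreeGroup α, p.norm = m ∧ gp p u = 2 * m := by
  have hred : FreeGroup.IsReduced (u.toWord.take m) :=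
    (FreeGroup.isReduced_toWord (x := u)).infix (List.take_prefix _ _).isInfix
  have hw : (FreeGroup.mk (u.toWord.take m)).toWord = u.toWord.take m := by
    rw [FreeGroup.toWord_mk, hred.reduce_eq]
  have hlen : (u.toWord.take m).length = m := by
    rw [List.length_take]; exact min_eq_left h
  refine ⟨FreeGroup.mk (u.toWord.take m), by rw [FreeGroup.norm, hw, hlen], ?_⟩
  rw [gp_eq_of_common_prefix (P := u.toWord.take m) (A := []) (B := u.toWord.drop m) (by simp [hw])
    (by simp) (by simp), hlen]

end Gromov

/-! ### Nielsen reduced families -/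

section NielsenReduced

variable {ι β : Type*}

/-- The image of a letter under the homomorphism extending `f`. -/
def letterVal (f : ι → FreeGroup β) (p : ι × Bool) : FreeGroup β := cond p.2 (f p.1) (f p.1)⁻¹

/-- The inverse letter. -/
def letterInv (p : ι × Bool) : ι × Bool := (p.1, !p.2)

theorem letterVal_letterInv (f : ι → FreeGroup β) (p : ι × Bool) :
    letterVal f (letterInv p) = (letterVal f p)⁻¹ := by
  rcases p with ⟨i, _ | _⟩ <;> simp [letterVal, letterInv]

theorem letterInv_ne (p : ι × Bool) : letterInv p ≠ p := by
  rcases p with ⟨i, _ | _⟩ <;> simp [letterInv]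

variable [DecidableEq β]

/-- A family is Nielsen reduced if some part of every letter survives in each reduced product. -/
def IsNielsenReduced (f : ι → FreeGroup β) : Prop :=
  ∀ p q r : ι × Bool, q ≠ p → r ≠ letterInv p →
    gp (letterVal f p) (letterVal f q) + gp (letterVal f (letterInv p)) (letterVal f r) <
      2 * (letterVal f p).norm

/-- Cancellation at the two ends of a factor never consumes it. So, seen from any letter other than
the first, the product looks like its first factor, and each letter adds at least one to the norm.
Both facts are needed together for the induction. -/
theorem IsNielsenReduced.length_le_aux {f : ι → FreeGroup β} (hf : IsNielsenReduced f)
    (L : List (ι × Bool)) : ∀ p, FreeGroup.IsReduced (p :: L) → ∀ q ≠ p,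
      gp (letterVal f q) (FreeGroup.lift f (FreeGroup.mk (p :: L))) =
        gp (letterVal f q) (letterVal f p) ∧
      2 * ((p :: L).length : ℤ) + gp (letterVal f q) (letterVal f p) ≤
        2 * (FreeGroup.lift f (FreeGroup.mk (p :: L))).norm := by
  induction L with
  | nil =>
    intro p _ q hq
    have hw : FreeGroup.lift f (FreeGroup.mk [p]) = letterVal f p := by
      simp [FreeGroup.lift_mk, letterVal]
    rw [hw]
    refine ⟨rfl, ?_⟩
    have h1 := hf p q p hq (letterInv_ne p).symm
    have h2 := gp_nonneg (letterVal f (letterInv p)) (letterVal f p)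
    -- Both sides of the strict inequality are even, so it gains a full 2, the share of one letter.
    obtain ⟨m, hm⟩ := (even_gp (letterVal f p) (letterVal f q)).two_dvd
    rw [gp_comm (letterVal f q)]
    simp only [List.length_singleton]
    omega
  | cons p' L ih =>
    intro p hred q hq
    rw [FreeGroup.isReduced_cons_cons] at hred
    have hp' : letterInv p ≠ p' := by
      rintro rfl
      have := hred.1 rfl
      revert this
      rcases p with ⟨i, _ | _⟩ <;> simp [letterInv]
    obtain ⟨h1, h2⟩ := ih p' hred.2 (letterInv p) hp'
    have hw : FreeGroup.lift f (FreeGroup.mk (p :: p' :: L)) =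
        letterVal f p * FreeGroup.lift f (FreeGroup.mk (p' :: L)) := by
      simp [FreeGroup.lift_mk, letterVal]
    rw [hw]
    set w := FreeGroup.lift f (FreeGroup.mk (p' :: L)) with hwdef
    have h3 := hf p q p' hq hp'.symm
    have h4 : gp (letterVal f (letterInv p)) w =
        (letterVal f p).norm + w.norm - (letterVal f p * w).norm := by
      rw [letterVal_letterInv, gp, inv_inv, FreeGroup.norm_inv_eq]
    have h5 : gp (letterVal f p) (letterVal f p * w) =
        (letterVal f p).norm + (letterVal f p * w).norm - w.norm := by
      rw [gp, inv_mul_cancel_left]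
    obtain ⟨m, hm⟩ := (even_gp (letterVal f p) (letterVal f q)).two_dvd
    obtain ⟨n, hn⟩ := (even_gp (letterVal f (letterInv p)) (letterVal f p')).two_dvd
    rw [gp_comm (letterVal f q) (letterVal f p)]
    refine ⟨?_, ?_⟩
    · rw [gp_comm (letterVal f p) (letterVal f q)]
      apply gp_eq_of_lt
      rw [gp_comm (letterVal f q)]
      omega
    · simp only [List.length_cons] at h2 ⊢
      push_cast at h2 ⊢
      omega

theorem IsNielsenReduced.length_le {f : ι → FreeGroup β} (hf : IsNielsenReduced f)
    {L : List (ι × Bool)} (hL : FreeGroup.IsReduced L) :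
    L.length ≤ (FreeGroup.lift f (FreeGroup.mk L)).norm := by
  cases L with
  | nil => simp
  | cons p L =>
    have h := (hf.length_le_aux L p hL (letterInv p) (letterInv_ne p)).2
    have := gp_nonneg (letterVal f (letterInv p)) (letterVal f p)
    omega

/-- A preimage of a generator has length at most one, hence is a single letter. -/
theorem IsNielsenReduced.exists_letterVal_eq [DecidableEq ι] {f : ι → FreeGroup β}
    (hf : IsNielsenReduced f)
    (hs : Function.Surjective (FreeGroup.lift f)) (i : β) :
    ∃ p, letterVal f p = FreeGroup.of i := by
  obtain ⟨w, hw⟩ := hs (FreeGroup.of i)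
  have h := hf.length_le (FreeGroup.isReduced_toWord (x := w))
  rw [FreeGroup.mk_toWord, hw, FreeGroup.norm_of] at h
  match hL : w.toWord with
  | [] =>
    rw [FreeGroup.toWord_eq_nil_iff.1 hL, map_one] at hw
    exact absurd hw (FreeGroup.one_ne_of i)
  | [p] =>
    refine ⟨p, ?_⟩
    rw [← hw, ← FreeGroup.mk_toWord (x := w), hL]
    simp [FreeGroup.lift_mk, letterVal]
  | _ :: _ :: _ => rw [hL] at h; simp at h

end NielsenReduced

/-! ### Commutator classes under Nielsen moves -/

/-- `g` and `h` are conjugate up to inversion. -/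
def CurveRel (g h : Pi1) : Prop := IsConj g h ∨ IsConj g h⁻¹

theorem isConj_inv {x y : Pi1} (h : IsConj x y) : IsConj x⁻¹ y⁻¹ := by
  obtain ⟨c, hc⟩ := isConj_iff.1 h
  exact isConj_iff.2 ⟨c, by rw [← hc]; group⟩

theorem CurveRel.refl (g : Pi1) : CurveRel g g := Or.inl (IsConj.refl g)

theorem CurveRel.trans {g h k : Pi1} : CurveRel g h → CurveRel h k → CurveRel g k := by
  rintro (H | H) (K | K)
  · exact Or.inl (H.trans K)
  · exact Or.inr (H.trans K)
  · exact Or.inr (H.trans (isConj_inv K))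
  · exact Or.inl (H.trans (by simpa using isConj_inv K))

theorem CurveRel.of_conj {g h : Pi1} (c : Pi1) (hc : c * g * c⁻¹ = h) : CurveRel g h :=
  Or.inl (isConj_iff.2 ⟨c, hc⟩)

theorem CurveRel.of_conj_inv {g h : Pi1} (c : Pi1) (hc : c * g * c⁻¹ = h⁻¹) : CurveRel g h :=
  Or.inr (isConj_iff.2 ⟨c, hc⟩)

theorem curveRel_comm_swap (a b : Pi1) : CurveRel ⁅a, b⁆ ⁅b, a⁆ :=
  .of_conj_inv 1 (by simp [commutatorElement_def]; group)

theorem curveRel_comm_inv_left (a b : Pi1) : CurveRel ⁅a, b⁆ ⁅a⁻¹, b⁆ :=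
  .of_conj_inv a⁻¹ (by simp only [commutatorElement_def]; group)

theorem curveRel_comm_inv_right (a b : Pi1) : CurveRel ⁅a, b⁆ ⁅a, b⁻¹⁆ :=
  .of_conj_inv b⁻¹ (by simp only [commutatorElement_def]; group)

theorem curveRel_comm_mul_right (a b : Pi1) : CurveRel ⁅a, b⁆ ⁅a, a * b⁆ :=
  .of_conj a (by simp only [commutatorElement_def]; group)

theorem curveRel_comm_conj (p a b : Pi1) :
    CurveRel ⁅a, b⁆ ⁅p⁻¹ * a * p, p⁻¹ * b * p⁆ :=
  .of_conj p⁻¹ (by simp only [commutatorElement_def]; group)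

/-- `a` and `b` generate `π₁(T)`. -/
def Generates (a b : Pi1) : Prop := Subgroup.closure {a, b} = ⊤

theorem generates_iff {a b : Pi1} :
    Generates a b ↔ Function.Surjective (FreeGroup.lift ![a, b] : Pi1 →* Pi1) := by
  rw [Generates, FreeGroup.lift_surjective_iff_closure_range_eq_top, Matrix.range_cons_cons_empty]

theorem Generates.of_mem {a b c d : Pi1} (h : Generates a b)
    (ha : a ∈ Subgroup.closure {c, d}) (hb : b ∈ Subgroup.closure {c, d}) : Generates c d := by
  rw [Generates, eq_top_iff] at *
  refine h.trans ((Subgroup.closure_le _).2 ?_)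
  rintro x (rfl | rfl) <;> assumption

theorem mem_closure_left (a b : Pi1) : a ∈ Subgroup.closure {a, b} :=
  Subgroup.subset_closure (by simp)

theorem mem_closure_right (a b : Pi1) : b ∈ Subgroup.closure {a, b} :=
  Subgroup.subset_closure (by simp)

theorem Generates.swap {a b : Pi1} (h : Generates a b) : Generates b a :=
  h.of_mem (mem_closure_right _ _) (mem_closure_left _ _)

theorem Generates.inv_left {a b : Pi1} (h : Generates a b) : Generates a⁻¹ b :=
  h.of_mem (by simpa using inv_mem (mem_closure_left a⁻¹ b)) (mem_closure_right _ _)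

theorem Generates.mul_right {a b : Pi1} (h : Generates a b) : Generates a (a * b) :=
  h.of_mem (mem_closure_left _ _) (by
    simpa using mul_mem (inv_mem (mem_closure_left a (a * b))) (mem_closure_right a (a * b)))

theorem Generates.mul_zpow_right {a b : Pi1} (h : Generates a b) (n : ℤ) :
    Generates a (b * a ^ n) :=
  h.of_mem (mem_closure_left _ _) (by
    simpa using mul_mem (mem_closure_right a (b * a ^ n))
      (inv_mem (zpow_mem (mem_closure_left a (b * a ^ n)) n)))

theorem Generates.zpow_mul_right {a b : Pi1} (h : Generates a b) (n : ℤ) :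
    Generates a (a ^ n * b) :=
  h.of_mem (mem_closure_left _ _) (by
    simpa using mul_mem (inv_mem (zpow_mem (mem_closure_left a (a ^ n * b)) n))
      (mem_closure_right a (a ^ n * b)))

theorem lift_comp_pair (θ : Pi1 →* Pi1) (a b : Pi1) :
    FreeGroup.lift ![θ a, θ b] = θ.comp (FreeGroup.lift ![a, b] : Pi1 →* Pi1) := by
  ext i
  fin_cases i <;> simp

theorem Generates.conj {a b : Pi1} (h : Generates a b) (p : Pi1) :
    Generates (p⁻¹ * a * p) (p⁻¹ * b * p) := by
  rw [generates_iff] at *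
  have := lift_comp_pair (MulAut.conj p⁻¹).toMonoidHom a b
  simp only [MulEquiv.toMonoidHom_eq_coe, MonoidHom.coe_coe, MulAut.conj_apply, inv_inv] at this
  rw [this]
  exact (MulAut.conj p⁻¹).surjective.comp h

theorem not_generates_one (a : Pi1) : ¬ Generates a 1 := by
  intro h
  have hs := generates_iff.1 h
  have hcomm : ∀ g k : Pi1, g * k = k * g := by
    have hz : ∀ g : Pi1, g ∈ Subgroup.zpowers a := by
      intro g
      have : g ∈ Subgroup.closure {a, 1} := by rw [h]; trivial
      refine (Subgroup.closure_le _).2 ?_ this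
      rintro x (rfl | rfl)
      exacts [Subgroup.mem_zpowers _, one_mem _]
    intro g k
    obtain ⟨m, rfl⟩ := hz g
    obtain ⟨n, rfl⟩ := hz k
    simp only [← zpow_add, add_comm]
  have := hcomm (FreeGroup.of 0) (FreeGroup.of 1)
  revert this
  decide

/-! ### Pairs of least length and Nielsen's theorem -/

/-- A generating pair of least total length among those with the same commutator up to
conjugation and inversion. -/
structure IsMinimalPair (a b : Pi1) : Prop where
  generates : Generates a b
  le : ∀ a' b', Generates a' b' → CurveRel ⁅a, b⁆ ⁅a', b'⁆ →
    a.norm + b.norm ≤ a'.norm + b'.norm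

namespace IsMinimalPair

variable {a b : Pi1}

theorem swap (h : IsMinimalPair a b) : IsMinimalPair b a :=
  ⟨h.generates.swap, fun a' b' hg hc => by
    rw [add_comm]; exact h.le a' b' hg ((curveRel_comm_swap _ _).trans hc)⟩

theorem inv_left (h : IsMinimalPair a b) : IsMinimalPair a⁻¹ b :=
  ⟨h.generates.inv_left, fun a' b' hg hc => by
    rw [FreeGroup.norm_inv_eq]; exact h.le a' b' hg ((curveRel_comm_inv_left _ _).trans hc)⟩

theorem inv_right (h : IsMinimalPair a b) : IsMinimalPair a b⁻¹ := h.swap.inv_left.swap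

theorem ne_one (h : IsMinimalPair a b) : a ≠ 1 := by
  rintro rfl
  exact not_generates_one b h.generates.swap

/-- The move to `(a⁻¹, a⁻¹b)` keeps the commutator class, so minimality forbids `a⁻¹b` to be shorter
than `b`. -/
theorem gp_le_left (h : IsMinimalPair a b) : gp a b ≤ a.norm := by
  have h1 := h.inv_left
  have := h1.le _ _ h1.generates.mul_right (curveRel_comm_mul_right _ _)
  rw [FreeGroup.norm_inv_eq] at this
  rw [gp]
  omega

theorem gp_le_right (h : IsMinimalPair a b) : gp a b ≤ b.norm := by
  rw [gp_comm]; exact h.swap.gp_le_left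

/-- This is the borderline case that single moves do not exclude. Write `a = p s` with halves of
equal length; then `b` begins with `p` and ends with `s`, say `b = p b' s`. Conjugation by `p` turns
`(a, b a⁻¹)` into `(s p, b')`, with the same commutator class and total length at most `b.norm`. -/
theorem not_gp_eq_left_and_inv_inv (h : IsMinimalPair a b) :
    ¬ (gp a b = a.norm ∧ gp a⁻¹ b⁻¹ = a.norm) := by
  rintro ⟨h1, h2⟩
  obtain ⟨k, hk⟩ := (even_gp a b).two_dvd
  obtain ⟨m, rfl⟩ : ∃ m : ℕ, k = m := ⟨k.toNat, by omega⟩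
  obtain ⟨p, hp, hpa⟩ := exists_prefix_of_le (u := a) (m := m) (by omega)
  have hle := h.gp_le_right
  have e1 : ((p⁻¹ * a).norm : ℤ) = m := by
    have := hpa; rw [gp] at this; omega
  have e2 : ((p⁻¹ * a * p).norm : ℤ) ≤ 2 * m := by
    have := FreeGroup.norm_mul_le (p⁻¹ * a) p; omega
  have e3 : ((a⁻¹ * p).norm : ℤ) = m := by
    rw [← e1, ← FreeGroup.norm_inv_eq]; simp
  have e4 : 2 * (m : ℤ) ≤ gp p b := by
    have := min_gp_le p a b; omega
  have e5 : ((p⁻¹ * b).norm : ℤ) ≤ b.norm - m := by rw [gp] at e4; omega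
  have e6 : (b.norm : ℤ) - m ≤ (p⁻¹ * b).norm := by
    have := FreeGroup.norm_mul_le p (p⁻¹ * b)
    rw [mul_inv_cancel_left] at this; omega
  have e7 : gp (p⁻¹ * b)⁻¹ b⁻¹ = (p⁻¹ * b).norm + b.norm - m := by
    rw [gp, inv_inv, mul_inv_cancel_right, FreeGroup.norm_inv_eq, FreeGroup.norm_inv_eq,
      FreeGroup.norm_inv_eq, hp]
  have e8 : gp a⁻¹ (a⁻¹ * p) = 2 * m := by
    rw [gp, inv_inv, mul_inv_cancel_left, FreeGroup.norm_inv_eq]; omega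
  have e9 : 2 * (m : ℤ) ≤ gp b⁻¹ (a⁻¹ * p) := by
    have := min_gp_le b⁻¹ a⁻¹ (a⁻¹ * p)
    rw [gp_comm b⁻¹ a⁻¹] at this; omega
  have e10 : 2 * (m : ℤ) ≤ gp (p⁻¹ * b)⁻¹ (a⁻¹ * p) := by
    have := min_gp_le (p⁻¹ * b)⁻¹ b⁻¹ (a⁻¹ * p); omega
  have e11 : ((p⁻¹ * (b * a⁻¹) * p).norm : ℤ) ≤ b.norm - 2 * m := by
    rw [gp, inv_inv, FreeGroup.norm_inv_eq] at e10
    have : p⁻¹ * (b * a⁻¹) * p = p⁻¹ * b * (a⁻¹ * p) := by group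
    rw [this]; omega
  have hgen : Generates a (b * a⁻¹) := by simpa using h.generates.mul_zpow_right (-1)
  have hrel : CurveRel ⁅a, b⁆ ⁅a, b * a⁻¹⁆ :=
    .of_conj 1 (by simp only [commutatorElement_def]; group)
  have := h.le _ _ (hgen.conj p) (hrel.trans (curveRel_comm_conj p _ _))
  exact h.ne_one (FreeGroup.norm_eq_zero.1 (by omega))

/-- Otherwise `a` and `a⁻¹` would both share half of their length with `b`, hence with each other,
against `norm_mul_self_gt`. -/
theorem not_gp_eq_left_and_inv (h : IsMinimalPair a b) :
    ¬ (gp a b = a.norm ∧ gp a⁻¹ b = a.norm) := by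
  rintro ⟨h1, h2⟩
  have h3 := min_gp_le a b a⁻¹
  have h4 := norm_mul_self_gt h.ne_one
  rw [gp_comm b] at h3
  omega

theorem gp_add_gp_lt (h : IsMinimalPair a b) (q r : Pi1) (hq : q = a⁻¹ ∨ q = b ∨ q = b⁻¹)
    (hr : r = a ∨ r = b ∨ r = b⁻¹) : gp a q + gp a⁻¹ r < 2 * a.norm := by
  have h1 := h.gp_le_left
  have h2 := h.inv_left.gp_le_left
  have h3 := h.inv_right.gp_le_left
  have h4 := h.inv_left.inv_right.gp_le_left
  have h5 := h.not_gp_eq_left_and_inv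
  have h6 := h.not_gp_eq_left_and_inv_inv
  have h7 := h.inv_right.not_gp_eq_left_and_inv
  have h8 := h.inv_right.not_gp_eq_left_and_inv_inv
  have h9 := norm_mul_self_gt h.ne_one
  rw [inv_inv] at h8
  rw [FreeGroup.norm_inv_eq] at h2 h4
  rcases hq with rfl | rfl | rfl <;> rcases hr with rfl | rfl | rfl <;>
    first | omega | (rw [gp_comm r⁻¹ r] at *; omega)

theorem isNielsenReduced (h : IsMinimalPair a b) : IsNielsenReduced ![a, b] := by
  have key : ∀ p : Fin 2 × Bool, ∃ c, IsMinimalPair (letterVal ![a, b] p) c ∧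
      ∀ q, q ≠ p → letterVal ![a, b] q = (letterVal ![a, b] p)⁻¹ ∨ letterVal ![a, b] q = c ∨
        letterVal ![a, b] q = c⁻¹ := by
    rintro ⟨i, _ | _⟩ <;> fin_cases i
    · refine ⟨b, h.inv_left, ?_⟩
      rintro ⟨j, _ | _⟩ <;> fin_cases j <;> simp [letterVal]
    · refine ⟨a, h.swap.inv_left, ?_⟩
      rintro ⟨j, _ | _⟩ <;> fin_cases j <;> simp [letterVal]
    · refine ⟨b, h, ?_⟩
      rintro ⟨j, _ | _⟩ <;> fin_cases j <;> simp [letterVal]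
    · refine ⟨a, h.swap, ?_⟩
      rintro ⟨j, _ | _⟩ <;> fin_cases j <;> simp [letterVal]
  intro p q r hq hr
  obtain ⟨c, hc, hcq⟩ := key p
  rw [letterVal_letterInv]
  refine hc.gp_add_gp_lt _ _ (hcq q hq) ?_
  have hr' : letterInv r ≠ p := by
    rintro rfl; exact hr (by simp [letterInv])
  have := hcq _ hr'
  rw [letterVal_letterInv, inv_inj, inv_inj, inv_eq_iff_eq_inv] at this
  tauto

end IsMinimalPair

theorem of_zero_ne_of_one :
    (FreeGroup.of 0 : Pi1) ≠ FreeGroup.of 1 ∧ (FreeGroup.of 0 : Pi1)⁻¹ ≠ FreeGroup.of 1 := by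
  decide

/-- The commutator of any generating pair is conjugate to that of the standard pair, up to
inversion. -/
theorem Generates.curveRel_commutator {a b : Pi1} (h : Generates a b) :
    CurveRel ⁅a, b⁆ ⁅(FreeGroup.of 0 : Pi1), (FreeGroup.of 1 : Pi1)⁆ := by
  induction hn : a.norm + b.norm using Nat.strong_induction_on generalizing a b with
  | _ n ih =>
    subst hn
    by_contra hne
    have hmin : IsMinimalPair a b := by
      refine ⟨h, fun a' b' hg hc => ?_⟩
      by_contra hlt
      exact hne (hc.trans (ih _ (not_le.1 hlt) hg rfl))
    -- The minimal pair is Nielsen reduced and generating, so both standard generators are among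
    -- `a`, `b` and their inverses; only signs and order remain.
    have hred := hmin.isNielsenReduced
    obtain ⟨p, hp⟩ := hred.exists_letterVal_eq (generates_iff.1 h) 0
    obtain ⟨q, hq⟩ := hred.exists_letterVal_eq (generates_iff.1 h) 1
    apply hne
    have hdis := of_zero_ne_of_one
    rw [← hp, ← hq] at hdis ⊢
    clear hp hq ih hne hred hmin h
    rcases p with ⟨i, _ | _⟩ <;> rcases q with ⟨j, _ | _⟩ <;> fin_cases i <;> fin_cases j <;>
      simp [letterVal] at hdis ⊢
    · exact (curveRel_comm_inv_left _ _).trans (curveRel_comm_inv_right _ _)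
    · exact (curveRel_comm_swap _ _).trans
        ((curveRel_comm_inv_left _ _).trans (curveRel_comm_inv_right _ _))
    · exact curveRel_comm_inv_left _ _
    · exact (curveRel_comm_swap _ _).trans (curveRel_comm_inv_left _ _)
    · exact curveRel_comm_inv_right _ _
    · exact (curveRel_comm_swap _ _).trans (curveRel_comm_inv_right _ _)
    · exact .refl _
    · exact curveRel_comm_swap _ _

/-- The elements that generate together with the first standard generator. -/
theorem Generates.exists_eq_zpow_mul {c : Pi1} (h : Generates (FreeGroup.of 0) c) :
    ∃ m n : ℤ, c = FreeGroup.of 0 ^ m * FreeGroup.of 1 * FreeGroup.of 0 ^ n ∨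
      c = FreeGroup.of 0 ^ m * (FreeGroup.of 1)⁻¹ * FreeGroup.of 0 ^ n := by
  induction hn : c.norm using Nat.strong_induction_on generalizing c with
  | _ n ih =>
    subst hn
    set x : Pi1 := FreeGroup.of 0 with hx
    set y : Pi1 := FreeGroup.of 1 with hy
    -- Powers of `x` are stripped from either side as long as this shortens `c`. Once neither side
    -- can be shortened, `(x, c)` is Nielsen reduced and `y` must be `c` or its inverse.
    by_cases hl : ∃ k : ℤ, (x ^ k * c).norm < c.norm
    · obtain ⟨k, hk⟩ := hl
      obtain ⟨m, n, H⟩ := ih _ hk (h.zpow_mul_right k) rfl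
      refine ⟨m - k, n, ?_⟩
      rw [← inv_mul_cancel_left (x ^ k) c]
      refine H.imp (fun H => ?_) (fun H => ?_) <;> rw [H] <;> group
    by_cases hr : ∃ k : ℤ, (c * x ^ k).norm < c.norm
    · obtain ⟨k, hk⟩ := hr
      obtain ⟨m, n, H⟩ := ih _ hk (h.mul_zpow_right k) rfl
      refine ⟨m, n - k, ?_⟩
      rw [← mul_inv_cancel_right c (x ^ k)]
      refine H.imp (fun H => ?_) (fun H => ?_) <;> rw [H] <;> group
    push Not at hl hr
    have hxn : x.norm = 1 := FreeGroup.norm_of 0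
    have hc1 : c ≠ 1 := by rintro rfl; exact not_generates_one _ h
    have hx1 : x ≠ 1 := FreeGroup.of_ne_one 0
    have gx := norm_mul_self_gt hx1
    have gc := norm_mul_self_gt hc1
    have g0 := gp_nonneg x x⁻¹
    -- The bound gives `gp u v ≤ 1`, and parity makes it zero.
    have key : ∀ u v : Pi1, u.norm = 1 → v.norm ≤ (u⁻¹ * v).norm → gp u v = 0 := by
      intro u v hu hv
      obtain ⟨k, hk⟩ := (even_gp u v).two_dvd
      have := gp_nonneg u v
      have h2 : gp u v ≤ 1 := by rw [gp]; omega
      omega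
    have k1 : gp x c = 0 := key _ _ hxn (by simpa using hl (-1))
    have k2 : gp x⁻¹ c = 0 :=
      key _ _ (by rw [FreeGroup.norm_inv_eq, hxn]) (by simpa using hl 1)
    have k3 : gp x c⁻¹ = 0 := by
      refine key _ _ hxn ?_
      rw [← mul_inv_rev, FreeGroup.norm_inv_eq, FreeGroup.norm_inv_eq]; simpa using hr 1
    have k4 : gp x⁻¹ c⁻¹ = 0 := by
      refine key _ _ (by rw [FreeGroup.norm_inv_eq, hxn]) ?_
      rw [← mul_inv_rev, FreeGroup.norm_inv_eq, FreeGroup.norm_inv_eq]; simpa using hr (-1)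
    have hcpos : c.norm ≠ 0 := fun h0 => hc1 (FreeGroup.norm_eq_zero.1 h0)
    have hred : IsNielsenReduced ![x, c] := by
      have s1 := gp_comm c x
      have s2 := gp_comm c x⁻¹
      have s3 := gp_comm c⁻¹ x
      have s4 := gp_comm c⁻¹ x⁻¹
      have s5 := gp_comm c⁻¹ c
      have s6 := gp_comm x⁻¹ x
      rintro ⟨i, _ | _⟩ ⟨j, _ | _⟩ ⟨k, _ | _⟩ hq hr <;>
        fin_cases i <;> fin_cases j <;> fin_cases k <;>
        simp [letterVal, letterInv] at hq hr ⊢ <;> omega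
    obtain ⟨⟨i, ε⟩, hp⟩ := hred.exists_letterVal_eq (generates_iff.1 h) 1
    have hdis := of_zero_ne_of_one
    rw [← hx, ← hy] at hdis
    rw [← hy] at hp
    refine ⟨0, 0, ?_⟩
    rcases ε with _ | _ <;> fin_cases i <;> simp [letterVal] at hp
    · exact absurd hp hdis.2
    · right; simp [← hp]
    · exact absurd hp hdis.1
    · left; simp [← hp]

/-! ### Free bases -/

theorem isFreeBasis_iff {a b : Pi1} :
    IsFreeBasis a b ↔ ∃ θ : Pi1 ≃* Pi1, θ (FreeGroup.of 0) = a ∧ θ (FreeGroup.of 1) = b := by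
  constructor
  · intro h
    exact ⟨MulEquiv.ofBijective _ (show Function.Bijective (FreeGroup.lift ![a, b]) from h),
      by simp, by simp⟩
  · rintro ⟨θ, rfl, rfl⟩
    have : (FreeGroup.lift ![θ (FreeGroup.of 0), θ (FreeGroup.of 1)] : Pi1 →* Pi1) =
        θ.toMonoidHom := by
      ext i; fin_cases i <;> simp
    rw [IsFreeBasis, this]
    exact θ.bijective

theorem isFreeBasis_of : IsFreeBasis (FreeGroup.of 0) (FreeGroup.of 1) :=
  isFreeBasis_iff.2 ⟨MulEquiv.refl _, rfl, rfl⟩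

namespace IsFreeBasis

variable {a b : Pi1}

theorem generates (h : IsFreeBasis a b) : Generates a b := generates_iff.2 h.2

theorem map (h : IsFreeBasis a b) (θ : Pi1 ≃* Pi1) : IsFreeBasis (θ a) (θ b) := by
  obtain ⟨η, rfl, rfl⟩ := isFreeBasis_iff.1 h
  exact isFreeBasis_iff.2 ⟨η.trans θ, rfl, rfl⟩

/-- Substituting a free basis into a pair of words that is itself a free basis. -/
theorem lift (h : IsFreeBasis a b) {u v : Pi1} (huv : IsFreeBasis u v) :
    IsFreeBasis (FreeGroup.lift ![a, b] u) (FreeGroup.lift ![a, b] v) :=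
  huv.map (MulEquiv.ofBijective _ h)

/-- Here `u'` and `v'` are the words of the inverse substitution; exhibiting them proves bijectivity
without Nielsen theory. -/
theorem of_inverse {u v u' v' : Pi1} (h1 : FreeGroup.lift ![u, v] u' = FreeGroup.of 0)
    (h2 : FreeGroup.lift ![u, v] v' = FreeGroup.of 1)
    (h3 : FreeGroup.lift ![u', v'] u = FreeGroup.of 0)
    (h4 : FreeGroup.lift ![u', v'] v = FreeGroup.of 1) : IsFreeBasis u v := by
  refine isFreeBasis_iff.2 ⟨MonoidHom.toMulEquiv (FreeGroup.lift ![u, v])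
    (FreeGroup.lift ![u', v']) ?_ ?_, ?_, ?_⟩
  rotate_left 2
  · simp [MonoidHom.toMulEquiv]
  · simp [MonoidHom.toMulEquiv]
  all_goals ext i; fin_cases i <;> simpa

theorem swap (h : IsFreeBasis a b) : IsFreeBasis b a := by
  have : IsFreeBasis (FreeGroup.of 1) (FreeGroup.of 0) :=
    of_inverse (u' := .of 1) (v' := .of 0) (by simp) (by simp) (by simp) (by simp)
  simpa using h.lift this

theorem inv_left (h : IsFreeBasis a b) : IsFreeBasis a⁻¹ b := by
  have : IsFreeBasis (FreeGroup.of 0)⁻¹ (FreeGroup.of 1) :=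
    of_inverse (u' := (.of 0)⁻¹) (v' := .of 1) (by simp) (by simp) (by simp) (by simp)
  simpa using h.lift this

theorem inv_right (h : IsFreeBasis a b) : IsFreeBasis a b⁻¹ := h.swap.inv_left.swap

theorem zpow_mul_right (h : IsFreeBasis a b) (n : ℤ) : IsFreeBasis a (a ^ n * b) := by
  have : IsFreeBasis (FreeGroup.of 0) (FreeGroup.of 0 ^ n * FreeGroup.of 1) :=
    of_inverse (u' := .of 0) (v' := .of 0 ^ (-n) * .of 1) (by simp) (by simp) (by simp) (by simp)
  simpa using h.lift this

theorem mul_zpow_right (h : IsFreeBasis a b) (n : ℤ) : IsFreeBasis a (b * a ^ n) := by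
  have : IsFreeBasis (FreeGroup.of 0) (FreeGroup.of 1 * FreeGroup.of 0 ^ n) :=
    of_inverse (u' := .of 0) (v' := .of 1 * .of 0 ^ (-n)) (by simp) (by simp) (by simp) (by simp)
  simpa using h.lift this

theorem mul_right (h : IsFreeBasis a b) : IsFreeBasis a (a * b) := by
  simpa using h.zpow_mul_right 1

theorem mul_left (h : IsFreeBasis a b) : IsFreeBasis (a * b) b := by
  simpa using (h.swap.mul_zpow_right 1).swap

theorem isPrimitive_left (h : IsFreeBasis a b) : IsPrimitive a := ⟨b, h⟩

theorem isPrimitive_right (h : IsFreeBasis a b) : IsPrimitive b := ⟨a, h.swap⟩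

theorem isPrimitive_mul (h : IsFreeBasis a b) : IsPrimitive (a * b) := h.mul_left.isPrimitive_left

/-- The elements that form a free basis together with `a`. -/
theorem exists_eq_zpow_mul (h : IsFreeBasis a b) {c : Pi1} (hc : IsFreeBasis a c) :
    ∃ m n : ℤ, c = a ^ m * b * a ^ n ∨ c = a ^ m * b⁻¹ * a ^ n := by
  obtain ⟨θ, rfl, rfl⟩ := isFreeBasis_iff.1 h
  have h1 := (hc.map θ.symm).generates
  rw [MulEquiv.symm_apply_apply] at h1
  obtain ⟨m, n, H⟩ := h1.exists_eq_zpow_mul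
  refine ⟨m, n, H.imp (fun H => ?_) (fun H => ?_)⟩ <;>
    simpa [MulEquiv.symm_apply_eq] using H

end IsFreeBasis

/-! ### Exponent sums -/

/-- `p` is a homomorphism to the integers. -/
def IsExponent (p : Pi1 → ℤ) : Prop := ∀ g h, p (g * h) = p g + p h

namespace IsExponent

variable {p q : Pi1 → ℤ}

theorem one (hp : IsExponent p) : p 1 = 0 := by have := hp 1 1; simp at this; exact this

theorem inv (hp : IsExponent p) (g : Pi1) : p g⁻¹ = -p g := by
  have := hp g g⁻¹
  rw [mul_inv_cancel, hp.one] at this; omega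

theorem conj (hp : IsExponent p) {g h : Pi1} (hc : IsConj g h) : p g = p h := by
  obtain ⟨c, rfl⟩ := isConj_iff.1 hc
  rw [hp, hp, hp.inv]; ring

theorem curveRel (hp : IsExponent p) (hq : IsExponent q) {g h : Pi1} (hc : CurveRel g h) :
    (p g = p h ∧ q g = q h) ∨ (p g = -p h ∧ q g = -q h) := by
  rcases hc with hc | hc
  · exact Or.inl ⟨hp.conj hc, hq.conj hc⟩
  · right
    rw [← hp.inv, ← hq.inv]
    exact ⟨hp.conj hc, hq.conj hc⟩

theorem zpow (hp : IsExponent p) (g : Pi1) (n : ℤ) : p (g ^ n) = n * p g := by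
  let f : Pi1 →* Multiplicative ℤ :=
    { toFun := fun g => Multiplicative.ofAdd (p g)
      map_one' := by rw [hp.one]; rfl
      map_mul' := fun g h => by rw [hp]; rfl }
  have := congrArg Multiplicative.toAdd (map_zpow f g n)
  simpa [f] using this

end IsExponent

/-- `p` and `q` are the coordinates of the abelianization in the basis `a`, `b`. -/
structure IsDual (p q : Pi1 → ℤ) (a b : Pi1) : Prop where
  left : IsExponent p
  right : IsExponent q
  left_fst : p a = 1
  right_fst : q a = 0
  left_snd : p b = 0
  right_snd : q b = 1

theorem IsFreeBasis.exists_isDual {a b : Pi1} (h : IsFreeBasis a b) : ∃ p q, IsDual p q a b := by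
  obtain ⟨θ, rfl, rfl⟩ := isFreeBasis_iff.1 h
  let f : Pi1 →* Multiplicative ℤ := FreeGroup.lift ![Multiplicative.ofAdd 1, 1]
  let g : Pi1 →* Multiplicative ℤ := FreeGroup.lift ![1, Multiplicative.ofAdd 1]
  refine ⟨fun x => Multiplicative.toAdd (f (θ.symm x)),
    fun x => Multiplicative.toAdd (g (θ.symm x)), ?_, ?_, ?_, ?_, ?_, ?_⟩ <;>
    simp [IsExponent, f, g]

theorem IsDual.apply_eq {r s : Pi1 → ℤ} {c d : Pi1} (hd : IsDual r s c d) (h : IsFreeBasis c d)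
    {p : Pi1 → ℤ} (hp : IsExponent p) (g : Pi1) : p g = r g * p c + s g * p d := by
  have hg : g ∈ Subgroup.closure {c, d} := by rw [h.generates]; trivial
  induction hg using Subgroup.closure_induction with
  | mem x hx =>
    rcases hx with rfl | rfl
    · simp [hd.left_fst, hd.right_fst]
    · simp [hd.left_snd, hd.right_snd]
  | one => simp [hp.one, hd.left.one, hd.right.one]
  | mul x y _ _ hx hy => rw [hp, hd.left, hd.right, hx, hy]; ring
  | inv x _ hx => rw [hp.inv, hd.left.inv, hd.right.inv, hx]; ring

/-- The change of basis in the abelianization has an inverse, so the two determinants multiply to 1.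
-/
theorem IsDual.isUnit_det {p q : Pi1 → ℤ} {a b c d : Pi1} (hd : IsDual p q a b)
    (h : IsFreeBasis c d) : IsUnit (p c * q d - p d * q c) := by
  obtain ⟨r, s, hrs⟩ := h.exists_isDual
  have h1 := hrs.apply_eq h hd.left a
  have h2 := hrs.apply_eq h hd.left b
  have h3 := hrs.apply_eq h hd.right a
  have h4 := hrs.apply_eq h hd.right b
  rw [hd.left_fst] at h1
  rw [hd.left_snd] at h2
  rw [hd.right_fst] at h3
  rw [hd.right_snd] at h4
  refine IsUnit.of_mul_eq_one (r a * s b - r b * s a) ?_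
  calc (p c * q d - p d * q c) * (r a * s b - r b * s a)
      = (r a * p c + s a * p d) * (r b * q c + s b * q d) -
        (r b * p c + s b * p d) * (r a * q c + s a * q d) := by ring
    _ = 1 := by rw [← h1, ← h2, ← h3, ← h4]; ring

/-! ### Curves -/

open Classical in
/-- The curve represented by a primitive element. -/
def curve (g : Pi1) : Omega :=
  if hg : IsPrimitive g then Quotient.mk curveSetoid ⟨g, hg⟩
  -- Arbitrary default: an element that is not primitive represents no curve.
  else Quotient.mk curveSetoid ⟨FreeGroup.of 0, isFreeBasis_of.isPrimitive_left⟩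

theorem curve_of_isPrimitive {g : Pi1} (hg : IsPrimitive g) :
    curve g = Quotient.mk curveSetoid ⟨g, hg⟩ := dif_pos hg

theorem curve_eq_iff {g h : Pi1} (hg : IsPrimitive g) (hh : IsPrimitive h) :
    curve g = curve h ↔ CurveRel g h := by
  rw [curve_of_isPrimitive hg, curve_of_isPrimitive hh]
  exact Quotient.eq (r := curveSetoid)

theorem represents_iff {g : Pi1} {X : Omega} : Represents g X ↔ IsPrimitive g ∧ curve g = X := by
  constructor
  · rintro ⟨hg, rfl⟩
    exact ⟨hg, curve_of_isPrimitive hg⟩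
  · rintro ⟨hg, rfl⟩
    exact ⟨hg, (curve_of_isPrimitive hg).symm⟩

theorem exists_curve_eq (X : Omega) : ∃ a b, IsFreeBasis a b ∧ curve a = X := by
  obtain ⟨⟨g, b, hb⟩, rfl⟩ := Quotient.exists_rep X
  exact ⟨g, b, hb, curve_of_isPrimitive _⟩

theorem tr_curve (ρ : Pi1 →* SL(2, ℂ)) {g : Pi1} (hg : IsPrimitive g) :
    tr ρ (curve g) = (ρ g : Matrix (Fin 2) (Fin 2) ℂ).trace := by
  rw [curve_of_isPrimitive hg]; rfl

theorem CurveRel.isPrimitive {g h : Pi1} (hg : IsPrimitive g) (hr : CurveRel g h) :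
    IsPrimitive h := by
  obtain ⟨b, hb⟩ := hg
  rcases hr with hr | hr <;> obtain ⟨c, hc⟩ := isConj_iff.1 hr
  · have := hb.map (MulAut.conj c)
    rw [MulAut.conj_apply, hc] at this
    exact ⟨_, this⟩
  · have := (hb.map (MulAut.conj c)).inv_left
    rw [MulAut.conj_apply, hc, inv_inv] at this
    exact ⟨_, this⟩

theorem curve_eq_of_curveRel {g h : Pi1} (hg : IsPrimitive g) (hr : CurveRel g h) :
    curve g = curve h := (curve_eq_iff hg (hr.isPrimitive hg)).2 hr

/-- The products `p q` and `p²` are unchanged under conjugation and inversion, hence are invariants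
of unoriented curves. -/
theorem IsDual.curve_ne {p q : Pi1 → ℤ} {a b g h : Pi1} (hd : IsDual p q a b)
    (hg : IsPrimitive g) (hh : IsPrimitive h) (hne : p g * q g ≠ p h * q h ∨ p g ^ 2 ≠ p h ^ 2) :
    curve g ≠ curve h := by
  rw [Ne, curve_eq_iff hg hh]
  intro hr
  rcases hd.left.curveRel hd.right hr with ⟨h1, h2⟩ | ⟨h1, h2⟩ <;> simp [h1, h2] at hne

/-! ### Adjacent curves -/

theorem curveGraph_adj_iff {X Y : Omega} :
    curveGraph.Adj X Y ↔ ∃ a b, IsFreeBasis a b ∧ curve a = X ∧ curve b = Y := by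
  have aux : ∀ X Y : Omega, (∃ a b, IsFreeBasis a b ∧ Represents a X ∧ Represents b Y) ↔
      ∃ a b, IsFreeBasis a b ∧ curve a = X ∧ curve b = Y := by
    intro X Y
    refine exists_congr fun a => exists_congr fun b => and_congr_right fun h => ?_
    simp [represents_iff, h.isPrimitive_left, h.isPrimitive_right]
  rw [curveGraph, SimpleGraph.fromRel_adj, aux, aux]
  constructor
  · rintro ⟨-, H | ⟨a, b, h, ha, hb⟩⟩
    · exact H
    · exact ⟨b, a, h.swap, hb, ha⟩
  · rintro ⟨a, b, h, rfl, rfl⟩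
    refine ⟨?_, Or.inl ⟨a, b, h, rfl, rfl⟩⟩
    obtain ⟨p, q, hd⟩ := h.exists_isDual
    refine hd.curve_ne h.isPrimitive_left h.isPrimitive_right (Or.inr ?_)
    simp [hd.left_fst, hd.left_snd]

theorem IsFreeBasis.adj {a b : Pi1} (h : IsFreeBasis a b) : curveGraph.Adj (curve a) (curve b) :=
  curveGraph_adj_iff.2 ⟨a, b, h, rfl, rfl⟩

/-- The neighbours of `a` in the curve graph are the curves `b aᵏ`. -/
theorem IsFreeBasis.exists_eq_curve_of_adj {a b : Pi1} (h : IsFreeBasis a b) {Y : Omega}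
    (hY : curveGraph.Adj (curve a) Y) : ∃ k : ℤ, Y = curve (b * a ^ k) := by
  obtain ⟨u, v, huv, hu, rfl⟩ := curveGraph_adj_iff.1 hY
  -- Conjugating the pair, and inverting its first member if needed, makes that member equal to `a`.
  obtain ⟨v', hv', hrel⟩ : ∃ v', IsFreeBasis a v' ∧ CurveRel v v' := by
    rcases (curve_eq_iff huv.isPrimitive_left h.isPrimitive_left).1 hu with hr | hr <;>
      obtain ⟨c, hc⟩ := isConj_iff.1 hr
    · have := huv.map (MulAut.conj c)
      rw [MulAut.conj_apply, hc] at this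
      exact ⟨_, this, .of_conj c rfl⟩
    · have := (huv.map (MulAut.conj c)).inv_left
      rw [MulAut.conj_apply, hc, inv_inv] at this
      exact ⟨_, this, .of_conj c rfl⟩
  -- Conjugation by a power of `a` merges the two exponents into one.
  obtain ⟨m, n, rfl | rfl⟩ := h.exists_eq_zpow_mul hv'
  · exact ⟨n + m, curve_eq_of_curveRel huv.isPrimitive_right
      (hrel.trans (.of_conj (a ^ (-m)) (by group)))⟩
  · exact ⟨-m - n, curve_eq_of_curveRel huv.isPrimitive_right
      (hrel.trans (.of_conj_inv (a ^ n) (by group)))⟩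

theorem IsFreeBasis.curve_mul_comm {a b : Pi1} (h : IsFreeBasis a b) :
    curve (a * b) = curve (b * a) :=
  curve_eq_of_curveRel h.isPrimitive_mul (.of_conj a⁻¹ (by group))

/-- The common neighbours of two adjacent curves. -/
theorem IsFreeBasis.eq_curve_of_adj_adj {a b : Pi1} (h : IsFreeBasis a b) {Z : Omega}
    (ha : curveGraph.Adj (curve a) Z) (hb : curveGraph.Adj (curve b) Z) :
    Z = curve (a * b) ∨ Z = curve (a * b⁻¹) := by
  obtain ⟨k, rfl⟩ := h.exists_eq_curve_of_adj ha
  obtain ⟨u, v, huv, hu, hv⟩ := curveGraph_adj_iff.1 hb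
  obtain ⟨p, q, hd⟩ := h.exists_isDual
  have hk := h.mul_zpow_right k
  have h1 := hd.left.curveRel hd.right
    ((curve_eq_iff huv.isPrimitive_left h.isPrimitive_right).1 hu)
  have h2 := hd.left.curveRel hd.right
    ((curve_eq_iff huv.isPrimitive_right hk.isPrimitive_right).1 hv)
  have h3 := hd.isUnit_det huv
  rw [hd.left, hd.right, hd.left.zpow, hd.right.zpow, hd.left_fst, hd.left_snd, hd.right_fst,
    hd.right_snd] at h2
  rw [hd.left_snd, hd.right_snd] at h1
  -- In the coordinates dual to `(a, b)`, the pair `(b, b aᵏ)` has determinant `±k`.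
  have hk1 : k = 1 ∨ k = -1 := by
    rw [Int.isUnit_iff] at h3
    rcases h1 with ⟨h1, h1'⟩ | ⟨h1, h1'⟩ <;> rcases h2 with ⟨h2, h2'⟩ | ⟨h2, h2'⟩ <;>
      rw [h1, h1', h2, h2'] at h3 <;> omega
  rcases hk1 with rfl | rfl
  · left; rw [zpow_one, h.curve_mul_comm]
  · right
    exact curve_eq_of_curveRel hk.isPrimitive_right (.of_conj_inv 1 (by group))

/-! ### Triangles -/

open Classical in
/-- The triangle spanned by the curves `a`, `b` and `a b`. -/
def triangle (a b : Pi1) : Finset Omega := {curve a, curve b, curve (a * b)}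

theorem mem_triangle {a b : Pi1} {X : Omega} :
    X ∈ triangle a b ↔ X = curve a ∨ X = curve b ∨ X = curve (a * b) := by
  simp [triangle]

theorem IsFreeBasis.isNClique {a b : Pi1} (h : IsFreeBasis a b) :
    curveGraph.IsNClique 3 (triangle a b) := by
  classical
  rw [triangle, SimpleGraph.is3Clique_triple_iff]
  exact ⟨h.adj, h.mul_right.adj, h.mul_left.adj.symm⟩

theorem vertex_eq_of_mem {v : Vertex} {X Y : Omega} (hX : X ∈ v.1) (hY : Y ∈ v.1) (hXY : X ≠ Y) :
    ∃ Z, (∀ V, V ∈ v.1 ↔ V = X ∨ V = Y ∨ V = Z) ∧ curveGraph.Adj X Y ∧ curveGraph.Adj X Z ∧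
      curveGraph.Adj Y Z := by
  classical
  obtain ⟨A, B, C, hAB, hAC, hBC, hv⟩ := SimpleGraph.is3Clique_iff.1 v.2
  simp only [hv, Finset.mem_insert, Finset.mem_singleton] at hX hY ⊢
  rcases hX with rfl | rfl | rfl <;> rcases hY with rfl | rfl | rfl
  · exact absurd rfl hXY
  · exact ⟨C, fun V => by tauto, hAB, hAC, hBC⟩
  · exact ⟨B, fun V => by tauto, hAC, hAB, hBC.symm⟩
  · exact ⟨C, fun V => by tauto, hAB.symm, hBC, hAC⟩
  · exact absurd rfl hXY
  · exact ⟨A, fun V => by tauto, hBC, hAB.symm, hAC.symm⟩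
  · exact ⟨B, fun V => by tauto, hAC.symm, hBC.symm, hAB⟩
  · exact ⟨A, fun V => by tauto, hBC.symm, hAC.symm, hAB.symm⟩
  · exact absurd rfl hXY

theorem IsFreeBasis.mem_triangle_inv {a b : Pi1} (h : IsFreeBasis a b) {X : Omega} :
    X ∈ triangle a b⁻¹ ↔ X = curve a ∨ X = curve b ∨ X = curve (a * b⁻¹) := by
  rw [mem_triangle, curve_eq_of_curveRel h.inv_right.isPrimitive_right
    (.of_conj_inv 1 (by group) : CurveRel b⁻¹ b)]

theorem IsFreeBasis.vertex_eq {a b : Pi1} (h : IsFreeBasis a b) {v : Vertex}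
    (ha : curve a ∈ v.1) (hb : curve b ∈ v.1) : v.1 = triangle a b ∨ v.1 = triangle a b⁻¹ := by
  obtain ⟨Z, hZ, -, h1, h2⟩ := vertex_eq_of_mem ha hb h.adj.ne
  rcases h.eq_curve_of_adj_adj h1 h2 with rfl | rfl
  · left; ext V; rw [hZ, mem_triangle]
  · right; ext V; rw [hZ, h.mem_triangle_inv]

/-- Inverting the second member of a basis crosses the edge that its two curves span; across the
edge of `a` and `ab` this leads from the child triangle back to its parent. -/
theorem IsFreeBasis.triangle_mul_right_inv {a b : Pi1} (h : IsFreeBasis a b) :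
    triangle a (a * b)⁻¹ = triangle a b := by
  ext V
  rw [h.mul_right.mem_triangle_inv, mem_triangle, curve_eq_of_curveRel
    h.mul_right.inv_right.isPrimitive_mul (.of_conj_inv a⁻¹ (by group) : CurveRel (a * (a * b)⁻¹) b)]
  tauto

theorem IsFreeBasis.triangle_mul_left_inv {a b : Pi1} (h : IsFreeBasis a b) :
    triangle (a * b) b⁻¹ = triangle a b := by
  ext V
  rw [h.mul_left.mem_triangle_inv, mem_triangle, mul_inv_cancel_right]
  tauto

/-- The triangles adjacent to a given triangle. -/
theorem IsFreeBasis.triangle_adj {a b : Pi1} (h : IsFreeBasis a b) {v w : Vertex}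
    (hv : v.1 = triangle a b) (hvw : Tree.Adj v w) :
    w.1 = triangle a b⁻¹ ∨ w.1 = triangle a (a * b) ∨ w.1 = triangle (a * b) b := by
  obtain ⟨hne, X, Y, hXY, hXv, hYv, hXw, hYw⟩ := hvw
  rw [hv, mem_triangle] at hXv hYv
  have hw : w.1 ≠ triangle a b := fun hw => hne (Subtype.ext (hv.trans hw.symm))
  have k1 : curve a ∈ w.1 → curve b ∈ w.1 → w.1 = triangle a b⁻¹ := fun h1 h2 =>
    (h.vertex_eq h1 h2).resolve_left hw
  have k2 : curve a ∈ w.1 → curve (a * b) ∈ w.1 → w.1 = triangle a (a * b) := fun h1 h2 =>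
    (h.mul_right.vertex_eq h1 h2).resolve_right (by rwa [h.triangle_mul_right_inv])
  have k3 : curve b ∈ w.1 → curve (a * b) ∈ w.1 → w.1 = triangle (a * b) b := fun h1 h2 =>
    (h.mul_left.vertex_eq h2 h1).resolve_right (by rwa [h.triangle_mul_left_inv])
  rcases hXv with rfl | rfl | rfl <;> rcases hYv with rfl | rfl | rfl <;> tauto

/-- The triangles that contain a given curve. -/
theorem IsFreeBasis.exists_vertex_eq {a b : Pi1} (h : IsFreeBasis a b) {v : Vertex}
    (ha : curve a ∈ v.1) : ∃ k : ℤ, ∀ V, V ∈ v.1 ↔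
      V = curve a ∨ V = curve (b * a ^ k) ∨ V = curve (b * a ^ (k + 1)) := by
  obtain ⟨Y, hY, hne⟩ : ∃ Y ∈ v.1, Y ≠ curve a := by
    apply Finset.exists_mem_ne
    rw [v.2.card_eq]; norm_num
  obtain ⟨Z, -, hadj, -, -⟩ := vertex_eq_of_mem ha hY hne.symm
  obtain ⟨k, rfl⟩ := h.exists_eq_curve_of_adj hadj
  have hk := h.mul_zpow_right k
  rcases hk.vertex_eq ha hY with hv | hv
  · refine ⟨k, fun V => ?_⟩
    rw [hv, mem_triangle, hk.curve_mul_comm, mul_assoc, ← zpow_add_one]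
  · refine ⟨k - 1, fun V => ?_⟩
    rw [hv, hk.mem_triangle_inv, curve_eq_of_curveRel hk.inv_right.isPrimitive_mul
      (.of_conj_inv 1 (by group) : CurveRel (a * (b * a ^ k)⁻¹) (b * a ^ (k - 1))), sub_add_cancel]
    tauto

/-! ### The binary tree of bases behind an edge -/

/-- The basis reached from `p` by a sequence of moves `(a, b) ↦ (a, ab)` (`true`) and
`(a, b) ↦ (ab, b)` (`false`). -/
def descend (p : Pi1 × Pi1) : List Bool → Pi1 × Pi1
  | [] => p
  | true :: s => descend (p.1, p.1 * p.2) s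
  | false :: s => descend (p.1 * p.2, p.2) s

theorem descend_append (p : Pi1 × Pi1) (s t : List Bool) :
    descend p (s ++ t) = descend (descend p s) t := by
  induction s generalizing p with
  | nil => rfl
  | cons x s ih => cases x <;> exact ih _

theorem descend_replicate_true (a b : Pi1) (k : ℕ) :
    descend (a, b) (List.replicate k true) = (a, a ^ k * b) := by
  induction k generalizing b with
  | zero => simp [descend]
  | succ k ih => rw [List.replicate_succ, descend, ih, ← mul_assoc, ← pow_succ]

theorem descend_replicate_false (a b : Pi1) (k : ℕ) :
    descend (a, b) (List.replicate k false) = (a * b ^ k, b) := by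
  induction k generalizing a with
  | zero => simp [descend]
  | succ k ih => rw [List.replicate_succ, descend, ih, mul_assoc, ← pow_succ']

theorem IsFreeBasis.descend {p : Pi1 × Pi1} (h : IsFreeBasis p.1 p.2) (s : List Bool) :
    IsFreeBasis (descend p s).1 (descend p s).2 := by
  induction s generalizing p with
  | nil => exact h
  | cons x s ih =>
    cases x
    · exact ih (p := (p.1 * p.2, p.2)) h.mul_left
    · exact ih (p := (p.1, p.1 * p.2)) h.mul_right

/-- The new curve of the triangle reached by a sequence of moves. -/
def descendCurve (p : Pi1 × Pi1) (s : List Bool) : Omega :=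
  curve ((descend p s).1 * (descend p s).2)

/-- The coordinates of the new curve. -/
def slope : List Bool → ℕ × ℕ
  | [] => (1, 1)
  | true :: s => ((slope s).1 + (slope s).2, (slope s).2)
  | false :: s => ((slope s).1, (slope s).1 + (slope s).2)

theorem slope_pos (s : List Bool) : 0 < (slope s).1 ∧ 0 < (slope s).2 := by
  induction s with
  | nil => simp [slope]
  | cons x s ih => cases x <;> simp [slope] <;> omega

/-- The subtractive Euclidean algorithm recovers the path: the larger coordinate tells the first
move, and `(1, 1)` ends it. -/
theorem slope_injective : Function.Injective slope := by
  intro s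
  induction s with
  | nil =>
    rintro (_ | ⟨_ | _, t⟩) h
    · rfl
    all_goals
      have := slope_pos t
      simp only [slope, Prod.mk.injEq] at h
      omega
  | cons x s ih =>
    have hs := slope_pos s
    rintro (_ | ⟨y, t⟩) h
    · cases x <;> simp only [slope, Prod.mk.injEq] at h <;> omega
    · have ht := slope_pos t
      cases x <;> cases y <;> simp only [slope, Prod.mk.injEq] at h
      · rw [ih (Prod.ext h.1 (by omega))]
      · omega
      · omega
      · rw [ih (Prod.ext (by omega) h.2)]

theorem IsExponent.descend {p : Pi1 → ℤ} (hp : IsExponent p) (x : Pi1 × Pi1) (s : List Bool) :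
    p ((descend x s).1 * (descend x s).2) = (slope s).1 * p x.1 + (slope s).2 * p x.2 := by
  induction s generalizing x with
  | nil => simp [PuncturedTorus.descend, slope, hp _ _]
  | cons y s ih => cases y <;> rw [PuncturedTorus.descend, ih, slope, hp] <;> push_cast <;> ring

theorem IsExponent.descend_nonneg {p : Pi1 → ℤ} (hp : IsExponent p) {x : Pi1 × Pi1}
    (h1 : 0 ≤ p x.1) (h2 : 0 ≤ p x.2) (s : List Bool) :
    0 ≤ p (PuncturedTorus.descend x s).1 ∧ 0 ≤ p (PuncturedTorus.descend x s).2 := by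
  induction s generalizing x with
  | nil => exact ⟨h1, h2⟩
  | cons y s ih =>
    have : 0 ≤ p (x.1 * x.2) := by rw [hp]; omega
    cases y
    · exact ih (x := (x.1 * x.2, x.2)) this h2
    · exact ih (x := (x.1, x.1 * x.2)) h1 this

theorem IsFreeBasis.descendCurve_injective {a b : Pi1} (h : IsFreeBasis a b) :
    Function.Injective (descendCurve (a, b)) := by
  intro s t hst
  obtain ⟨p, q, hd⟩ := h.exists_isDual
  have hs := IsFreeBasis.descend (p := (a, b)) h s
  have ht := IsFreeBasis.descend (p := (a, b)) h t
  have hr := hd.left.curveRel hd.right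
    ((curve_eq_iff hs.isPrimitive_mul ht.isPrimitive_mul).1 hst)
  simp only [hd.left.descend, hd.right.descend, hd.left_fst, hd.left_snd, hd.right_fst,
    hd.right_snd] at hr
  have := slope_pos s
  have := slope_pos t
  exact slope_injective (Prod.ext (by omega) (by omega))

/-- The triangle of a free basis, as a vertex of the tree. -/
def IsFreeBasis.vertex {a b : Pi1} (h : IsFreeBasis a b) : Vertex := ⟨triangle a b, h.isNClique⟩

theorem IsFreeBasis.curve_mul_notMem_inv {a b : Pi1} (h : IsFreeBasis a b) :
    curve (a * b) ∉ triangle a b⁻¹ := by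
  rw [h.mem_triangle_inv]
  rintro (H | H | H)
  · exact h.mul_right.adj.ne H.symm
  · exact h.mul_left.adj.ne H
  · obtain ⟨p, q, hd⟩ := h.exists_isDual
    refine hd.curve_ne h.isPrimitive_mul h.inv_right.isPrimitive_mul (Or.inl ?_) H
    simp [hd.left _ _, hd.right _ _, hd.left.inv, hd.right.inv, hd.left_fst, hd.left_snd,
      hd.right_fst, hd.right_snd]

/-- All bases below `(a, b)` have nonnegative coordinates, so the product of coordinates is
nonnegative on their curves, while it is `-1` on `a b⁻¹`. -/
theorem IsFreeBasis.inv_notMem_triangle_descend {a b : Pi1} (h : IsFreeBasis a b)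
    (s : List Bool) :
    curve (a * b⁻¹) ∉ triangle (PuncturedTorus.descend (a, b) s).1
      (PuncturedTorus.descend (a, b) s).2 := by
  obtain ⟨p, q, hd⟩ := h.exists_isDual
  have hs := IsFreeBasis.descend (p := (a, b)) h s
  obtain ⟨p1, p2⟩ := hd.left.descend_nonneg (x := (a, b)) (by simp [hd.left_fst])
    (by simp [hd.left_snd]) s
  obtain ⟨q1, q2⟩ := hd.right.descend_nonneg (x := (a, b)) (by simp [hd.right_fst])
    (by simp [hd.right_snd]) s
  have hpq : p (a * b⁻¹) * q (a * b⁻¹) = -1 := by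
    simp [hd.left _ _, hd.right _ _, hd.left.inv, hd.right.inv, hd.left_fst, hd.left_snd,
      hd.right_fst, hd.right_snd]
  rw [mem_triangle]
  rintro (H | H | H) <;> revert H
  · refine hd.curve_ne h.inv_right.isPrimitive_mul hs.isPrimitive_left (Or.inl ?_)
    have := mul_nonneg p1 q1; have := mul_nonneg p2 q2; rw [hpq]; omega
  · refine hd.curve_ne h.inv_right.isPrimitive_mul hs.isPrimitive_right (Or.inl ?_)
    have := mul_nonneg p1 q1; have := mul_nonneg p2 q2; rw [hpq]; omega
  · refine hd.curve_ne h.inv_right.isPrimitive_mul hs.isPrimitive_mul (Or.inl ?_)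
    have := mul_nonneg (add_nonneg p1 p2) (add_nonneg q1 q2)
    rw [hpq, hd.left, hd.right]; omega

section Edge

variable {a b : Pi1} {e : Tree.Dart}

/-- The vertices behind the edge are the triangles of the binary tree. -/
theorem IsFreeBasis.exists_of_reachable (h : IsFreeBasis a b) (hfst : e.fst.1 = triangle a b)
    (hsnd : e.snd.1 = triangle a b⁻¹) {v : Vertex}
    (hv : (Tree.deleteEdges {e.edge}).Reachable e.fst v) :
    ∃ s, v.1 = triangle (PuncturedTorus.descend (a, b) s).1
      (PuncturedTorus.descend (a, b) s).2 := by
  rw [SimpleGraph.reachable_iff_reflTransGen] at hv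
  induction hv with
  | refl => exact ⟨[], hfst⟩
  | @tail v w _ hvw ih =>
    obtain ⟨s, hs⟩ := ih
    rw [SimpleGraph.deleteEdges_adj] at hvw
    have hb := IsFreeBasis.descend (p := (a, b)) h s
    rcases hb.triangle_adj hs hvw.1 with H | H | H
    · rcases List.eq_nil_or_concat s with rfl | ⟨t, x, rfl⟩
      · exfalso
        apply hvw.2
        have h1 : v = e.fst := Subtype.ext (hs.trans hfst.symm)
        have h2 : w = e.snd := Subtype.ext (H.trans hsnd.symm)
        rw [h1, h2]; rfl
      · have ht := IsFreeBasis.descend (p := (a, b)) h t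
        refine ⟨t, ?_⟩
        rw [H, List.concat_eq_append, descend_append]
        cases x
        · exact ht.triangle_mul_left_inv
        · exact ht.triangle_mul_right_inv
    · exact ⟨s ++ [true], by rw [H, descend_append]; rfl⟩
    · exact ⟨s ++ [false], by rw [H, descend_append]; rfl⟩

theorem IsFreeBasis.not_reachable_snd (h : IsFreeBasis a b) (hfst : e.fst.1 = triangle a b)
    (hsnd : e.snd.1 = triangle a b⁻¹) : ¬ (Tree.deleteEdges {e.edge}).Reachable e.fst e.snd := by
  intro hr
  obtain ⟨s, hs⟩ := h.exists_of_reachable hfst hsnd hr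
  apply h.inv_notMem_triangle_descend s
  rw [← hs, hsnd, h.mem_triangle_inv]
  simp

theorem IsFreeBasis.triangle_descend_ne_snd (h : IsFreeBasis a b)
    (hsnd : e.snd.1 = triangle a b⁻¹) (s : List Bool) :
    triangle (PuncturedTorus.descend (a, b) s).1 (PuncturedTorus.descend (a, b) s).2 ≠
      e.snd.1 := by
  intro hs
  apply h.inv_notMem_triangle_descend s
  rw [hs, hsnd, h.mem_triangle_inv]
  simp

/-- Every move is an edge of `Tree`, and it is not `e` because no triangle below `(a, b)` is the
head of `e`. -/
theorem IsFreeBasis.reachable_descend (h : IsFreeBasis a b) (hfst : e.fst.1 = triangle a b)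
    (hsnd : e.snd.1 = triangle a b⁻¹) (s : List Bool) :
    (Tree.deleteEdges {e.edge}).Reachable e.fst
      (IsFreeBasis.descend (p := (a, b)) h s).vertex := by
  induction s using List.reverseRecOn with
  | nil =>
    have : (IsFreeBasis.descend (p := (a, b)) h []).vertex = e.fst := Subtype.ext hfst.symm
    rw [this]
  | append_singleton s x ih =>
    refine ih.trans (SimpleGraph.Adj.reachable ?_)
    have hs := IsFreeBasis.descend (p := (a, b)) h s
    have hsx := IsFreeBasis.descend (p := (a, b)) h (s ++ [x])
    rw [SimpleGraph.deleteEdges_adj]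
    have hx : (hsx.vertex.1 : Finset Omega) = triangle (PuncturedTorus.descend (a, b) s).1
          ((PuncturedTorus.descend (a, b) s).1 * (PuncturedTorus.descend (a, b) s).2) ∨
        hsx.vertex.1 = triangle ((PuncturedTorus.descend (a, b) s).1 *
          (PuncturedTorus.descend (a, b) s).2) (PuncturedTorus.descend (a, b) s).2 := by
      simp only [IsFreeBasis.vertex, descend_append]
      cases x
      · right; rfl
      · left; rfl
    refine ⟨⟨?_, ?_⟩, ?_⟩
    · intro heq
      rcases hx with hx | hx
      · apply hs.mul_right.curve_mul_notMem_inv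
        rw [hs.triangle_mul_right_inv, show triangle _ _ = hs.vertex.1 from rfl, heq, hx,
          mem_triangle]
        simp
      · apply hs.mul_left.curve_mul_notMem_inv
        rw [hs.triangle_mul_left_inv, show triangle _ _ = hs.vertex.1 from rfl, heq, hx,
          mem_triangle]
        simp
    · rcases hx with hx | hx
      · exact ⟨_, _, hs.mul_right.adj.ne, by simp [IsFreeBasis.vertex, mem_triangle],
          by simp [IsFreeBasis.vertex, mem_triangle], by rw [hx]; simp [mem_triangle],
          by rw [hx]; simp [mem_triangle]⟩
      · exact ⟨_, _, hs.mul_left.adj.ne, by simp [IsFreeBasis.vertex, mem_triangle],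
          by simp [IsFreeBasis.vertex, mem_triangle], by rw [hx]; simp [mem_triangle],
          by rw [hx]; simp [mem_triangle]⟩
    · intro hedge
      have : e.snd ∈ s(hs.vertex, hsx.vertex) := by
        rw [Set.mem_singleton_iff] at hedge
        rw [hedge]
        exact Sym2.mem_mk_right _ _
      rw [Sym2.mem_iff] at this
      rcases this with H | H
      · exact h.triangle_descend_ne_snd hsnd s (congrArg Subtype.val H).symm
      · exact h.triangle_descend_ne_snd hsnd _ (congrArg Subtype.val H).symm

/-- The triangles around the new curve `c = u w` form a fan indexed by `k`. The one with `k = -1` is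
where `c` is created; on either side the fan starts at one of the two children and then keeps
turning around `c`, so all of it stays below the root. -/
theorem IsFreeBasis.descendCurve_mem_omegaMinus (h : IsFreeBasis a b)
    (hfst : e.fst.1 = triangle a b) (hsnd : e.snd.1 = triangle a b⁻¹) (s : List Bool) :
    descendCurve (a, b) s ∈ OmegaMinus e := by
  intro v hv
  have hs := IsFreeBasis.descend (p := (a, b)) h s
  rw [descendCurve] at hv
  obtain ⟨k, hk⟩ := hs.mul_left.exists_vertex_eq hv
  have key : ∀ t, (∀ V, V ∈ triangle (PuncturedTorus.descend (a, b) t).1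
      (PuncturedTorus.descend (a, b) t).2 ↔ V ∈ v.1) →
      (Tree.deleteEdges {e.edge}).Reachable e.fst v := by
    intro t ht
    have := h.reachable_descend hfst hsnd t
    rwa [show (IsFreeBasis.descend (p := (a, b)) h t).vertex = v from
      Subtype.ext (Finset.ext ht)] at this
  set u := (PuncturedTorus.descend (a, b) s).1 with hu
  set w := (PuncturedTorus.descend (a, b) s).2 with hw
  have hds : PuncturedTorus.descend (a, b) s = (u, w) := rfl
  rcases lt_trichotomy k (-1) with hlt | rfl | hgt
  · obtain ⟨j, rfl⟩ : ∃ j : ℕ, k = -(j : ℤ) - 2 := ⟨(-k - 2).toNat, by omega⟩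
    refine key (s ++ true :: List.replicate j false) fun V => ?_
    have aux : ∀ c x y : Pi1, x * y = c → ∀ j : ℕ, c ^ (-(j : ℤ)) *
        (y * c ^ (-(j : ℤ) - 2 + 1)) * (c ^ (-(j : ℤ)))⁻¹ = (x * c ^ j)⁻¹ := by
      intro c x y hc j
      rw [eq_mul_inv_of_mul_eq hc]; group
    have aux' : ∀ c x y : Pi1, x * y = c → ∀ j : ℕ, c ^ (-(j : ℤ) - 1) *
        (y * c ^ (-(j : ℤ) - 2)) * (c ^ (-(j : ℤ) - 1))⁻¹ = (x * c ^ j * c)⁻¹ := by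
      intro c x y hc j
      rw [eq_mul_inv_of_mul_eq hc]; group
    have e1 : curve (u * (u * w) ^ j) = curve (w * (u * w) ^ (-(j : ℤ) - 2 + 1)) := by
      refine (curve_eq_of_curveRel (hs.mul_left.mul_zpow_right _).isPrimitive_right
        (.of_conj_inv ((u * w) ^ (-(j : ℤ))) (aux (u * w) u w rfl j))).symm
    have e2 : curve (u * (u * w) ^ j * (u * w)) = curve (w * (u * w) ^ (-(j : ℤ) - 2)) := by
      refine (curve_eq_of_curveRel (hs.mul_left.mul_zpow_right _).isPrimitive_right
        (.of_conj_inv ((u * w) ^ (-(j : ℤ) - 1)) (aux' (u * w) u w rfl j))).symm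
    rw [hk, descend_append, hds, PuncturedTorus.descend, descend_replicate_false, mem_triangle,
      e1, e2]
    tauto
  · refine key s fun V => ?_
    have e1 : curve (w * (u * w) ^ (-1 : ℤ)) = curve u :=
      curve_eq_of_curveRel (hs.mul_left.mul_zpow_right _).isPrimitive_right
        (.of_conj_inv 1 (by group))
    rw [hk, hds, mem_triangle, e1, neg_add_cancel, zpow_zero, mul_one]
    tauto
  · obtain ⟨j, rfl⟩ : ∃ j : ℕ, k = j := ⟨k.toNat, by omega⟩
    refine key (s ++ false :: List.replicate j true) fun V => ?_
    have e1 : curve ((u * w) ^ j * w) = curve (w * (u * w) ^ (j : ℤ)) :=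
      (curve_eq_of_curveRel (hs.mul_left.mul_zpow_right _).isPrimitive_right
        (.of_conj ((u * w) ^ j) (by group)))
        |>.symm
    have e2 : curve ((u * w) * ((u * w) ^ j * w)) = curve (w * (u * w) ^ ((j : ℤ) + 1)) :=
      (curve_eq_of_curveRel (hs.mul_left.mul_zpow_right _).isPrimitive_right
        (.of_conj ((u * w) ^ (j + 1)) (by group)))
        |>.symm
    rw [hk, descend_append, hds, PuncturedTorus.descend, descend_replicate_true, mem_triangle,
      e1, e2]

/-- `Ω⁻(e)` is enumerated by the binary tree. -/
theorem IsFreeBasis.omegaMinus_eq_range (h : IsFreeBasis a b) (hfst : e.fst.1 = triangle a b)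
    (hsnd : e.snd.1 = triangle a b⁻¹) : OmegaMinus e = Set.range (descendCurve (a, b)) := by
  refine Set.Subset.antisymm (fun V hV => ?_) ?_
  · obtain ⟨c, d, hcd, rfl⟩ := exists_curve_eq V
    have hmem : curve c ∈ hcd.vertex.1 := by simp [IsFreeBasis.vertex, mem_triangle]
    obtain ⟨s, hs⟩ := h.exists_of_reachable hfst hsnd (hV _ hmem)
    rw [hs] at hmem
    clear hs
    -- This rules out the curves of `a` and `b`, which also bound the unreachable head. Going up
    -- from the triangle `s` then leads to the one where the curve was created.
    have hsnd' : curve c ∉ e.snd.1 := fun hc => h.not_reachable_snd hfst hsnd (hV _ hc)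
    rw [hsnd, h.mem_triangle_inv] at hsnd'
    push Not at hsnd'
    induction s using List.reverseRecOn with
    | nil =>
      rw [mem_triangle] at hmem
      rcases hmem with H | H | H
      · exact absurd H hsnd'.1
      · exact absurd H hsnd'.2.1
      · exact ⟨[], H.symm⟩
    | append_singleton s x ih =>
      rw [mem_triangle] at hmem
      have hs : ∀ W, (W = curve (PuncturedTorus.descend (a, b) (s ++ [x])).1 ∨
          W = curve (PuncturedTorus.descend (a, b) (s ++ [x])).2) →
          W ∈ triangle (PuncturedTorus.descend (a, b) s).1
            (PuncturedTorus.descend (a, b) s).2 := by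
        intro W
        rw [descend_append, mem_triangle]
        cases x <;> simp only [PuncturedTorus.descend] <;> tauto
      rcases hmem with H | H | H
      · exact ih (hs _ (Or.inl H))
      · exact ih (hs _ (Or.inr H))
      · exact ⟨s ++ [x], H.symm⟩
  · rintro _ ⟨s, rfl⟩
    exact h.descendCurve_mem_omegaMinus hfst hsnd s

end Edge

/-- Every directed edge is the edge of a free basis. -/
theorem exists_isFreeBasis_of_dart (e : Tree.Dart) :
    ∃ a b, IsFreeBasis a b ∧ e.fst.1 = triangle a b ∧ e.snd.1 = triangle a b⁻¹ := by
  obtain ⟨hne, X, Y, hXY, hXv, hYv, hXw, hYw⟩ := e.adj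
  obtain ⟨-, -, hadj, -, -⟩ := vertex_eq_of_mem hXv hYv hXY
  obtain ⟨a, b, h, rfl, rfl⟩ := curveGraph_adj_iff.1 hadj
  have hne' : e.fst.1 ≠ e.snd.1 := fun H => hne (Subtype.ext H)
  rcases h.vertex_eq hXv hYv with h1 | h1 <;> rcases h.vertex_eq hXw hYw with h2 | h2
  · exact absurd (h1.trans h2.symm) hne'
  · exact ⟨a, b, h, h1, h2⟩
  · exact ⟨a, b⁻¹, h.inv_right, h1, by rw [inv_inv, h2]⟩
  · exact absurd (h1.trans h2.symm) hne'

theorem IsFreeBasis.omegaZero_eq {a b : Pi1} (h : IsFreeBasis a b) {e : Tree.Dart}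
    (hfst : e.fst.1 = triangle a b) (hsnd : e.snd.1 = triangle a b⁻¹) {V : Omega} :
    V ∈ OmegaZero e ↔ V = curve a ∨ V = curve b := by
  classical
  have : OmegaZero e = triangle a b ∩ triangle a b⁻¹ := by
    rw [← hfst, ← hsnd, OmegaZero]
  rw [this, Finset.mem_inter, h.mem_triangle_inv, mem_triangle]
  constructor
  · rintro ⟨H | H | H, H'⟩
    · exact Or.inl H
    · exact Or.inr H
    · exact absurd (by rw [← H, h.mem_triangle_inv]; exact H') h.curve_mul_notMem_inv
  · tauto

theorem IsFreeBasis.edgeLabel {a b : Pi1} (h : IsFreeBasis a b) {e : Tree.Dart}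
    (hfst : e.fst.1 = triangle a b) (hsnd : e.snd.1 = triangle a b⁻¹) {X Y Z W : Omega}
    (hl : EdgeLabel e X Y Z W) :
    (X = curve a ∧ Y = curve b ∨ X = curve b ∧ Y = curve a) ∧ W = curve (a * b⁻¹) := by
  have hX : X ∈ OmegaZero e := by simp [OmegaZero, hl.1, hl.2]
  have hY : Y ∈ OmegaZero e := by simp [OmegaZero, hl.1, hl.2]
  rw [h.omegaZero_eq hfst hsnd] at hX hY
  have hXY : X ≠ Y := by
    rintro rfl
    have := e.fst.2.card_eq
    rw [hl.1] at this
    classical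
    have h2 := Finset.card_le_two (a := X) (b := Z)
    simp at this
    omega
  refine ⟨by rcases hX with rfl | rfl <;> rcases hY with rfl | rfl <;> tauto, ?_⟩
  have hW : curve (a * b⁻¹) ∈ e.snd.1 := by rw [hsnd, h.mem_triangle_inv]; simp
  rw [hl.2] at hW
  have h1 : curve (a * b⁻¹) ≠ curve a := h.inv_right.mul_right.adj.ne.symm
  have h2 : curve (a * b⁻¹) ≠ curve b := by
    rw [← curve_eq_of_curveRel h.inv_right.isPrimitive_right
      (.of_conj_inv 1 (by group) : CurveRel b⁻¹ b)]
    exact h.inv_right.mul_left.adj.ne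
  simp only [Finset.mem_insert, Finset.mem_singleton] at hW
  rcases hX with rfl | rfl <;> rcases hY with rfl | rfl <;> rcases hW with hW | hW | hW <;> tauto

/-! ### Traces in `SL(2, ℂ)` -/

section Trace

open Matrix

/-- The adjugate in place of the inverse makes these polynomial identities, valid without the
assumption of determinant one. -/
theorem trace_mul_adjugate (A B : Matrix (Fin 2) (Fin 2) ℂ) :
    (A * B.adjugate).trace = A.trace * B.trace - (A * B).trace := by
  simp [adjugate_fin_two, trace_fin_two, mul_apply, Fin.sum_univ_two]; ring

theorem trace_mul_mul_self (A B : Matrix (Fin 2) (Fin 2) ℂ) :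
    (A * (A * B)).trace = A.trace * (A * B).trace - A.det * B.trace := by
  simp [trace_fin_two, mul_apply, Fin.sum_univ_two, det_fin_two]; ring

theorem trace_commutator_adjugate (A B : Matrix (Fin 2) (Fin 2) ℂ) :
    (A * B * A.adjugate * B.adjugate).trace = A.trace ^ 2 * B.det + B.trace ^ 2 * A.det +
      (A * B).trace ^ 2 - A.trace * B.trace * (A * B).trace - 2 * A.det * B.det := by
  simp [adjugate_fin_two, trace_fin_two, mul_apply, Fin.sum_univ_two, det_fin_two]; ring

theorem det_mul_sub_mul (A B : Matrix (Fin 2) (Fin 2) ℂ) :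
    (A * B - B * A).det = 2 * A.det * B.det - (A * B * A.adjugate * B.adjugate).trace := by
  simp [adjugate_fin_two, trace_fin_two, mul_apply, Fin.sum_univ_two, det_fin_two]; ring

theorem eq_smul_of_mulVec_eq_zero {M : Matrix (Fin 2) (Fin 2) ℂ} (hM : M ≠ 0) {v w : Fin 2 → ℂ}
    (hv : v ≠ 0) (h1 : M *ᵥ v = 0) (h2 : M *ᵥ w = 0) : ∃ c : ℂ, w = c • v := by
  have hc : v 0 * w 1 = v 1 * w 0 := by
    obtain ⟨i, j, hij⟩ : ∃ i j, M i j ≠ 0 := by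
      by_contra! H; exact hM (by ext i j; exact H i j)
    have e1 := congrFun h1 i
    have e2 := congrFun h2 i
    simp only [mulVec, dotProduct, Fin.sum_univ_two, Pi.zero_apply] at e1 e2
    fin_cases j <;> apply mul_left_cancel₀ hij <;> simp only [Fin.zero_eta, Fin.mk_one]
    · linear_combination w 1 * e1 - v 1 * e2
    · linear_combination v 0 * e2 - w 0 * e1
  by_cases h0 : v 0 = 0
  · have h1 : v 1 ≠ 0 := fun h1 => hv (by ext i; fin_cases i <;> simp [h0, h1])
    refine ⟨w 1 / v 1, ?_⟩
    have : w 0 = 0 := by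
      rw [h0, zero_mul] at hc
      simpa [h1] using hc.symm
    ext i; fin_cases i <;> simp [h0, this, h1]
  · refine ⟨w 0 / v 0, ?_⟩
    ext i; fin_cases i
    · simp [h0]
    · simp; field_simp; linear_combination hc

theorem exists_eigenvector (A : Matrix (Fin 2) (Fin 2) ℂ) :
    ∃ (v : Fin 2 → ℂ) (c : ℂ), v ≠ 0 ∧ A *ᵥ v = c • v := by
  obtain ⟨c, hc⟩ := Module.End.exists_eigenvalue (toLin' A)
  obtain ⟨v, hv⟩ := hc.exists_hasEigenvector
  exact ⟨v, c, hv.2, by simpa using hv.apply_eq_smul⟩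

/-- If `A` and `B` commute, `B` preserves the eigenlines of `A`, the scalar case being trivial.
Otherwise the kernel of `N = AB - BA` is a line, and `N A = (tr A - A) N`, with its analogue for
`B`, shows that both matrices preserve it. -/
theorem exists_common_eigenvector {A B : Matrix (Fin 2) (Fin 2) ℂ}
    (h : (A * B - B * A).det = 0) :
    ∃ (v : Fin 2 → ℂ) (c d : ℂ), v ≠ 0 ∧ A *ᵥ v = c • v ∧ B *ᵥ v = d • v := by
  by_cases hN : A * B - B * A = 0
  · rw [sub_eq_zero] at hN
    obtain ⟨v, c, hv, hvc⟩ := exists_eigenvector A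
    by_cases hs : A - c • (1 : Matrix (Fin 2) (Fin 2) ℂ) = 0
    · obtain ⟨w, d, hw, hwd⟩ := exists_eigenvector B
      refine ⟨w, c, d, hw, ?_, hwd⟩
      rw [sub_eq_zero.1 hs, smul_mulVec, one_mulVec]
    · have h1 : (A - c • (1 : Matrix (Fin 2) (Fin 2) ℂ)) *ᵥ v = 0 := by
        rw [sub_mulVec, smul_mulVec, one_mulVec, hvc, sub_self]
      obtain ⟨d, hd⟩ := eq_smul_of_mulVec_eq_zero hs hv h1 (w := B *ᵥ v) (by
        rw [sub_mulVec, smul_mulVec, one_mulVec, mulVec_mulVec, hN, ← mulVec_mulVec, hvc,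
          mulVec_smul, sub_self])
      exact ⟨v, c, d, hv, hvc, hd⟩
  · obtain ⟨v, hv, hNv⟩ := exists_mulVec_eq_zero_iff.2 h
    have hA : (A * B - B * A) * A = (A.trace • 1 - A) * (A * B - B * A) := by
      ext i j
      fin_cases i <;> fin_cases j <;>
        simp [trace_fin_two, mul_apply, Fin.sum_univ_two, Matrix.sub_apply] <;> ring
    have hB : (A * B - B * A) * B = (B.trace • 1 - B) * (A * B - B * A) := by
      ext i j
      fin_cases i <;> fin_cases j <;>
        simp [trace_fin_two, mul_apply, Fin.sum_univ_two, Matrix.sub_apply] <;> ring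
    obtain ⟨c, hc⟩ := eq_smul_of_mulVec_eq_zero hN hv hNv (w := A *ᵥ v) (by
      rw [mulVec_mulVec, hA, ← mulVec_mulVec, hNv, mulVec_zero])
    obtain ⟨d, hd⟩ := eq_smul_of_mulVec_eq_zero hN hv hNv (w := B *ᵥ v) (by
      rw [mulVec_mulVec, hB, ← mulVec_mulVec, hNv, mulVec_zero])
    exact ⟨v, c, d, hv, hc, hd⟩

end Trace

variable (ρ : Pi1 →* SL(2, ℂ))

/-- The trace of `ρ` on an element of `π₁(T)`. -/
def elemTr (g : Pi1) : ℂ := (ρ g : Matrix (Fin 2) (Fin 2) ℂ).trace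

theorem elemTr_mul_inv (a b : Pi1) :
    elemTr ρ (a * b⁻¹) = elemTr ρ a * elemTr ρ b - elemTr ρ (a * b) := by
  simp only [elemTr, map_mul, map_inv, Matrix.SpecialLinearGroup.coe_mul,
    Matrix.SpecialLinearGroup.coe_inv]
  exact trace_mul_adjugate _ _

theorem elemTr_mul_comm (a b : Pi1) : elemTr ρ (a * b) = elemTr ρ (b * a) := by
  simp only [elemTr, map_mul, Matrix.SpecialLinearGroup.coe_mul]
  exact Matrix.trace_mul_comm _ _

theorem elemTr_mul_mul_self (a b : Pi1) :
    elemTr ρ (a * (a * b)) = elemTr ρ a * elemTr ρ (a * b) - elemTr ρ b := by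
  simp only [elemTr, map_mul, Matrix.SpecialLinearGroup.coe_mul]
  rw [trace_mul_mul_self, Matrix.SpecialLinearGroup.det_coe, one_mul]

theorem elemTr_inv (g : Pi1) : elemTr ρ g⁻¹ = elemTr ρ g := by
  simp [elemTr, Matrix.SpecialLinearGroup.coe_inv, Matrix.adjugate_fin_two, Matrix.trace_fin_two,
    add_comm]

theorem elemTr_mul_self_mul (a b : Pi1) :
    elemTr ρ (a * b * b) = elemTr ρ (a * b) * elemTr ρ b - elemTr ρ a := by
  have h : a * b * b = a * b * b⁻¹⁻¹ := by group
  rw [h, elemTr_mul_inv, elemTr_inv, mul_inv_cancel_right]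

theorem elemTr_commutator (a b : Pi1) : elemTr ρ ⁅a, b⁆ = elemTr ρ a ^ 2 + elemTr ρ b ^ 2 +
    elemTr ρ (a * b) ^ 2 - elemTr ρ a * elemTr ρ b * elemTr ρ (a * b) - 2 := by
  simp only [elemTr, commutatorElement_def, map_mul, map_inv, Matrix.SpecialLinearGroup.coe_mul,
    Matrix.SpecialLinearGroup.coe_inv]
  rw [trace_commutator_adjugate, Matrix.SpecialLinearGroup.det_coe,
    Matrix.SpecialLinearGroup.det_coe]
  ring

theorem CurveRel.elemTr_eq {g h : Pi1} (hr : CurveRel g h) : elemTr ρ g = elemTr ρ h := by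
  have conj : ∀ x y : Pi1, IsConj x y → elemTr ρ x = elemTr ρ y := by
    intro x y hc
    obtain ⟨c, rfl⟩ := isConj_iff.1 hc
    rw [elemTr_mul_comm, inv_mul_cancel_left]
  rcases hr with hr | hr
  · exact conj _ _ hr
  · rw [conj _ _ hr, elemTr_inv]

/-- The trace identity of a free basis. -/
theorem IsFreeBasis.trace_eq {a b : Pi1} (h : IsFreeBasis a b) :
    elemTr ρ a ^ 2 + elemTr ρ b ^ 2 + elemTr ρ (a * b) ^ 2 =
      elemTr ρ a * elemTr ρ b * elemTr ρ (a * b) + (peripheralTrace ρ + 2) := by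
  have h1 := h.generates.curveRel_commutator.elemTr_eq ρ
  have h2 : peripheralTrace ρ = elemTr ρ ⁅(FreeGroup.of 0 : Pi1), (FreeGroup.of 1 : Pi1)⁆ := rfl
  rw [h2, ← h1, elemTr_commutator]
  ring

theorem tr_curve_eq {g : Pi1} (hg : IsPrimitive g) : tr ρ (curve g) = elemTr ρ g := tr_curve ρ hg

variable {ρ}

/-- The peripheral trace of an irreducible representation is not `2`. -/
theorem peripheralTrace_ne_two (hirr : (linearRep ρ).IsIrreducible) : peripheralTrace ρ ≠ 2 := by
  intro h2
  -- For `A`, `B` of determinant one, `det (AB - BA) = 2 - τ`.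
  have hdet : ((ρ (FreeGroup.of 0) : Matrix (Fin 2) (Fin 2) ℂ) * ρ (FreeGroup.of 1) -
      ρ (FreeGroup.of 1) * ρ (FreeGroup.of 0)).det = 0 := by
    rw [det_mul_sub_mul, Matrix.SpecialLinearGroup.det_coe, Matrix.SpecialLinearGroup.det_coe]
    simp only [peripheralTrace, map_mul, map_inv, Matrix.SpecialLinearGroup.coe_mul,
      Matrix.SpecialLinearGroup.coe_inv] at h2
    rw [h2]; norm_num
  obtain ⟨v, c, d, hv, hc, hd⟩ := exists_common_eigenvector hdet
  have hinv : ∀ g : Pi1, ∃ k : ℂ, linearRep ρ g v = k • v := by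
    intro g
    induction g using FreeGroup.induction_on with
    | C1 => exact ⟨1, by simp⟩
    | of i => fin_cases i; exacts [⟨c, hc⟩, ⟨d, hd⟩]
    | inv_of i hi =>
      obtain ⟨k, hk⟩ := hi
      have h1 : linearRep ρ (FreeGroup.of i)⁻¹ (linearRep ρ (FreeGroup.of i) v) = v := by
        rw [← Module.End.mul_apply, ← map_mul, inv_mul_cancel, map_one, Module.End.one_apply]
      rw [hk, map_smul] at h1
      have hk0 : k ≠ 0 := by rintro rfl; exact hv (by rw [← h1, zero_smul])
      exact ⟨k⁻¹, by rw [eq_inv_smul_iff₀ hk0, h1]⟩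
    | mul x y hx hy =>
      obtain ⟨k, hk⟩ := hx
      obtain ⟨l, hl⟩ := hy
      exact ⟨l * k, by rw [map_mul, Module.End.mul_apply, hl, map_smul, hk, smul_smul]⟩
  let S : Subrepresentation (linearRep ρ) := ⟨Submodule.span ℂ {v}, by
    intro g w hw
    obtain ⟨t, rfl⟩ := Submodule.mem_span_singleton.1 hw
    obtain ⟨k, hk⟩ := hinv g
    rw [map_smul, hk]
    exact Submodule.smul_mem _ _ (Submodule.smul_mem _ _ (Submodule.mem_span_singleton_self v))⟩
  rcases hirr.eq_bot_or_eq_top S with hS | hS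
  · have : v ∈ (⊥ : Subrepresentation (linearRep ρ)) := by
      rw [← hS]; exact Submodule.mem_span_singleton_self v
    exact hv this
  · have htop : Submodule.span ℂ {v} = ⊤ := congrArg Subrepresentation.toSubmodule hS
    have h1 := finrank_span_singleton (K := ℂ) hv
    rw [htop, finrank_top] at h1
    simp at h1

open Filter Topology

/-! ### Sums over the binary tree -/

/-- The sequences of length less than `n`. -/
def shortLists : ℕ → Finset (List Bool)
  | 0 => ∅
  | n + 1 => insert [] ((shortLists n).map ⟨List.cons true, List.cons_injective⟩ ∪
      (shortLists n).map ⟨List.cons false, List.cons_injective⟩)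

theorem mem_shortLists {n : ℕ} {s : List Bool} : s ∈ shortLists n ↔ s.length < n := by
  induction n generalizing s with
  | zero => simp [shortLists]
  | succ n ih => rcases s with _ | ⟨_ | _, s⟩ <;> simp [shortLists, ih]

theorem sum_shortLists_succ {M : Type*} [AddCommMonoid M] (f : List Bool → M) (n : ℕ) :
    ∑ s ∈ shortLists (n + 1), f s = f [] + (∑ s ∈ shortLists n, f (true :: s) +
      ∑ s ∈ shortLists n, f (false :: s)) := by
  rw [shortLists, Finset.sum_insert (by simp), Finset.sum_union, Finset.sum_map, Finset.sum_map]
  · rfl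
  · rw [Finset.disjoint_left]
    simp

theorem tendsto_shortLists : Tendsto shortLists atTop atTop :=
  tendsto_atTop_finset_of_monotone
    (fun m n hmn s => by simp only [mem_shortLists]; omega)
    (fun s => ⟨s.length + 1, by simp [mem_shortLists]⟩)

theorem tendsto_sum_shortLists {M : Type*} [AddCommMonoid M] [TopologicalSpace M]
    {f : List Bool → M} (hf : Summable f) :
    Tendsto (fun n => ∑ s ∈ shortLists n, f s) atTop (𝓝 (∑' s, f s)) :=
  (show Tendsto (fun u : Finset (List Bool) => ∑ s ∈ u, f s) atTop (𝓝 (∑' s, f s)) by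
    simpa [HasSum] using hf.hasSum).comp tendsto_shortLists

theorem summable_of_sum_shortLists_le {f : List Bool → ℝ} (hf : ∀ s, 0 ≤ f s) {c : ℝ}
    (h : ∀ n, ∑ s ∈ shortLists n, f s ≤ c) : Summable f := by
  refine summable_of_sum_le hf (c := c) fun u => ?_
  obtain ⟨n, hn⟩ : ∃ n, u ⊆ shortLists n := by
    obtain ⟨n, hn⟩ := (tendsto_shortLists.eventually (eventually_ge_atTop u)).exists
    exact ⟨n, hn⟩
  exact (Finset.sum_le_sum_of_subset_of_nonneg hn fun s _ _ => hf s).trans (h n)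

theorem tsum_list_bool {f : List Bool → ℂ} (hf : Summable f) :
    ∑' s, f s = f [] + (∑' s, f (true :: s) + ∑' s, f (false :: s)) := by
  refine tendsto_nhds_unique ((tendsto_add_atTop_iff_nat 1).2 (tendsto_sum_shortLists hf)) ?_
  simp only [sum_shortLists_succ]
  exact ((tendsto_sum_shortLists (hf.comp_injective List.cons_injective)).add
    (tendsto_sum_shortLists (hf.comp_injective List.cons_injective))).const_add _

theorem tsum_list_bool_real {f : List Bool → ℝ} (hf : Summable f) :
    ∑' s, f s = f [] + (∑' s, f (true :: s) + ∑' s, f (false :: s)) := by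
  refine tendsto_nhds_unique ((tendsto_add_atTop_iff_nat 1).2 (tendsto_sum_shortLists hf)) ?_
  simp only [sum_shortLists_succ]
  exact ((tendsto_sum_shortLists (hf.comp_injective List.cons_injective)).add
    (tendsto_sum_shortLists (hf.comp_injective List.cons_injective))).const_add _

theorem summable_list_bool {f : List Bool → ℝ} (hf : ∀ s, 0 ≤ f s)
    (h1 : Summable fun s => f (true :: s)) (h2 : Summable fun s => f (false :: s)) :
    Summable f := by
  refine summable_of_sum_shortLists_le hf
    (c := f [] + (∑' s, f (true :: s) + ∑' s, f (false :: s))) fun n => ?_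
  have h3 := h1.sum_le_tsum (shortLists n) fun s _ => hf _
  have h4 := h2.sum_le_tsum (shortLists n) fun s _ => hf _
  calc ∑ s ∈ shortLists n, f s ≤ ∑ s ∈ shortLists (n + 1), f s :=
        Finset.sum_le_sum_of_subset_of_nonneg
          (fun s => by simp only [mem_shortLists]; omega) fun s _ _ => hf s
    _ ≤ _ := by rw [sum_shortLists_succ]; linarith

/-! ### The tree of traces -/

/-- The traces of `a`, `b`, `ab`, along the moves `(a, b) ↦ (a, ab)` (`true`) and
`(a, b) ↦ (ab, b)` (`false`). -/
def child : Bool → ℂ × ℂ × ℂ → ℂ × ℂ × ℂ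
  | true, t => (t.1, t.2.2, t.1 * t.2.2 - t.2.1)
  | false, t => (t.2.2, t.2.1, t.2.2 * t.2.1 - t.1)

/-- Iterated moves. -/
def run (t : ℂ × ℂ × ℂ) : List Bool → ℂ × ℂ × ℂ
  | [] => t
  | x :: s => run (child x t) s

theorem run_append (t : ℂ × ℂ × ℂ) (s u : List Bool) : run t (s ++ u) = run (run t s) u := by
  induction s generalizing t with
  | nil => rfl
  | cons x s ih => exact ih _

/-- The exchange of the first two entries. -/
def mirror (t : ℂ × ℂ × ℂ) : ℂ × ℂ × ℂ := (t.2.1, t.1, t.2.2)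

theorem child_mirror (x : Bool) (t : ℂ × ℂ × ℂ) : child x (mirror t) = mirror (child (!x) t) := by
  cases x <;> simp [child, mirror, mul_comm]

theorem run_mirror (t : ℂ × ℂ × ℂ) (s : List Bool) :
    run (mirror t) s = mirror (run t (s.map not)) := by
  induction s generalizing t with
  | nil => rfl
  | cons x s ih => rw [run, child_mirror, ih]; rfl

/-- The outgoing edges of the triangle point back towards it. -/
def Ascending (t : ℂ × ℂ × ℂ) : Prop :=
  ‖t.2.1‖ ≤ ‖t.1 * t.2.2 - t.2.1‖ ∧ ‖t.1‖ ≤ ‖t.2.2 * t.2.1 - t.1‖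

/-- The inverse square of the newest trace. -/
def weight (t : ℂ × ℂ × ℂ) : ℝ := (‖t.2.2‖ ^ 2)⁻¹

theorem weight_nonneg (t : ℂ × ℂ × ℂ) : 0 ≤ weight t := by unfold weight; positivity

/-- Summability of the weights below `t`, where almost all edges point towards `t`. -/
structure Controlled (t : ℂ × ℂ × ℂ) : Prop where
  summable : Summable fun s => weight (run t s)
  finite : {s | ¬ Ascending (run t s)}.Finite

theorem Controlled.of_child {t : ℂ × ℂ × ℂ} (h : ∀ x, Controlled (child x t)) : Controlled t := by
  refine ⟨summable_list_bool (fun s => weight_nonneg _) (h true).summable (h false).summable, ?_⟩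
  refine (((Set.finite_singleton []).union ((h true).finite.image (List.cons true))).union
    ((h false).finite.image (List.cons false))).subset ?_
  rintro (_ | ⟨_ | _, s⟩) hs
  · simp
  · right; exact ⟨s, hs, rfl⟩
  · left; right; exact ⟨s, hs, rfl⟩

theorem Controlled.child {t : ℂ × ℂ × ℂ} (h : Controlled t) (x : Bool) :
    Controlled (child x t) :=
  ⟨h.summable.comp_injective (i := List.cons x) List.cons_injective,
    h.finite.preimage (f := List.cons x) List.cons_injective.injOn⟩

theorem Controlled.of_mirror {t : ℂ × ℂ × ℂ} (h : Controlled (mirror t)) : Controlled t := by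
  have hinv : Function.Involutive (List.map not) := fun s => by
    simp [Function.comp_def]
  have hrun : ∀ s, run t s = mirror (run (mirror t) (s.map not)) := fun s => by
    rw [run_mirror, hinv]; rfl
  refine ⟨?_, ?_⟩
  · simp only [hrun]
    exact h.summable.comp_injective hinv.injective
  · refine (h.finite.preimage (f := List.map not) hinv.injective.injOn).subset fun s hs => ?_
    simp only [Set.mem_ofPred_eq, Set.mem_preimage, hrun s] at hs ⊢
    intro ha
    apply hs
    refine ⟨?_, ?_⟩ <;> simp only [mirror]
    · rw [mul_comm]; exact ha.2
    · rw [mul_comm]; exact ha.1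

/-! ### Growth away from short curves -/

/-- A triangle of long curves, the newest of which is the longest. -/
structure Growing (t : ℂ × ℂ × ℂ) : Prop where
  fst : 2 < ‖t.1‖
  snd : 2 < ‖t.2.1‖
  mul_le : (‖t.1‖ - 1) * (‖t.2.1‖ - 1) ≤ ‖t.2.2‖ - 1

/-- The shift by one makes the bound multiplicative: `|x||y| - |z| - 1 ≥ (|x| - 1)(|y| - 1)` as soon
as `|z| + 2 ≤ |x| + |y|`. -/
theorem Growing.of_mul_sub {x y z : ℂ} (hx : 2 < ‖x‖) (hy : 2 < ‖y‖)
    (h : ‖z‖ + 2 ≤ ‖x‖ + ‖y‖) : Growing (x, y, x * y - z) := by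
  refine ⟨hx, hy, ?_⟩
  have := norm_sub_norm_le (x * y) z
  rw [norm_mul] at this
  simp only
  nlinarith

namespace Growing

variable {t : ℂ × ℂ × ℂ}

theorem fst_le (h : Growing t) : ‖t.1‖ ≤ ‖t.2.2‖ := by
  have := h.mul_le; nlinarith [h.fst, h.snd]

theorem snd_le (h : Growing t) : ‖t.2.1‖ ≤ ‖t.2.2‖ := by
  have := h.mul_le; nlinarith [h.fst, h.snd]

theorem child (h : Growing t) (x : Bool) : Growing (child x t) := by
  have h1 := h.fst
  have h2 := h.snd
  have h3 := h.fst_le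
  have h4 := h.snd_le
  cases x
  · exact .of_mul_sub (by linarith) h2 (by linarith)
  · exact .of_mul_sub h1 (by linarith) (by linarith)

theorem ascending (h : Growing t) : Ascending t := by
  have h1 := (h.child true).snd_le
  have h2 := (h.child false).fst_le
  exact ⟨h.snd_le.trans h1, h.fst_le.trans h2⟩

theorem run (h : Growing t) (s : List Bool) : Growing (run t s) := by
  induction s generalizing t with
  | nil => exact h
  | cons x s ih => exact ih (h.child x)

/-- With `U = (‖t.1‖ - 1)²` and `V = (‖t.2.1‖ - 1)²`, the bound `F(U, V) = 1/((U - 1)(V - 1))`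
solves `F(U, V) = 1/(UV - 1) + F(U, UV) + F(UV, V)`. So it passes through the recursion with no
loss. -/
theorem sum_le (h : Growing t) (n : ℕ) : ∑ s ∈ shortLists n, weight (PuncturedTorus.run t s) ≤
    1 / (((‖t.1‖ - 1) ^ 2 - 1) * ((‖t.2.1‖ - 1) ^ 2 - 1)) := by
  induction n generalizing t with
  | zero =>
    have h1 := h.fst
    have h2 := h.snd
    have : 0 < (‖t.1‖ - 1) ^ 2 - 1 := by nlinarith
    have : 0 < (‖t.2.1‖ - 1) ^ 2 - 1 := by nlinarith
    simp only [shortLists, Finset.sum_empty]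
    positivity
  | succ n ih =>
    have h1 := ih (h.child true)
    have h2 := ih (h.child false)
    rw [sum_shortLists_succ]
    simp only [PuncturedTorus.run] at h1 h2 ⊢
    refine (add_le_add le_rfl (add_le_add h1 h2)).trans ?_
    simp only [PuncturedTorus.child, weight]
    have ha := h.fst
    have hb := h.snd
    have hc := h.mul_le
    set a := ‖t.1‖
    set b := ‖t.2.1‖
    set c := ‖t.2.2‖
    have hU : 0 < (a - 1) ^ 2 - 1 := by nlinarith
    have hV : 0 < (b - 1) ^ 2 - 1 := by nlinarith
    have hUV : 0 < (a - 1) ^ 2 * (b - 1) ^ 2 - 1 := by nlinarith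
    have hab : 0 < (a - 1) * (b - 1) := mul_pos (by linarith) (by linarith)
    have hW : (a - 1) ^ 2 * (b - 1) ^ 2 ≤ (c - 1) ^ 2 := by
      rw [← mul_pow]; exact pow_le_pow_left₀ hab.le hc 2
    have e1 : (c ^ 2)⁻¹ ≤ 1 / ((a - 1) ^ 2 * (b - 1) ^ 2 - 1) := by
      rw [← one_div]
      apply one_div_le_one_div_of_le hUV
      nlinarith
    have e2 : 1 / (((a - 1) ^ 2 - 1) * ((c - 1) ^ 2 - 1)) ≤
        1 / (((a - 1) ^ 2 - 1) * ((a - 1) ^ 2 * (b - 1) ^ 2 - 1)) := by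
      apply one_div_le_one_div_of_le (by positivity)
      gcongr
    have e3 : 1 / (((c - 1) ^ 2 - 1) * ((b - 1) ^ 2 - 1)) ≤
        1 / (((a - 1) ^ 2 * (b - 1) ^ 2 - 1) * ((b - 1) ^ 2 - 1)) := by
      apply one_div_le_one_div_of_le (by positivity)
      gcongr
    refine (add_le_add e1 (add_le_add e2 e3)).trans (le_of_eq ?_)
    field_simp
    ring

theorem controlled (h : Growing t) : Controlled t := by
  refine ⟨summable_of_sum_shortLists_le (fun s => weight_nonneg _) h.sum_le, ?_⟩
  convert Set.finite_empty
  ext s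
  simp [(h.run s).ascending]

end Growing

/-! ### Growth along the boundary of a region -/

/-- The consecutive curves around a region of trace `l + l⁻¹` grow nearly at the rate `l`. -/
structure Spine (l : ℂ) (t : ℂ × ℂ × ℂ) : Prop where
  fst : t.1 = l + l⁻¹
  le_snd : ‖t.1‖ + 3 ≤ ‖t.2.1‖
  norm_sub_le : ‖t.2.2 - l * t.2.1‖ ≤ (‖l‖ - 1) / 2 * ‖t.2.1‖

namespace Spine

variable {l : ℂ} {t : ℂ × ℂ × ℂ}

theorem mul_norm_le (h : Spine l t) : (‖l‖ + 1) / 2 * ‖t.2.1‖ ≤ ‖t.2.2‖ := by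
  have h1 := h.norm_sub_le
  have h2 : ‖l * t.2.1‖ - ‖t.2.2‖ ≤ ‖t.2.2 - l * t.2.1‖ := by
    rw [norm_sub_rev]; exact norm_sub_norm_le _ _
  rw [norm_mul] at h2
  linarith

theorem norm_le (hl : 1 < ‖l‖) (h : Spine l t) : ‖t.2.1‖ ≤ ‖t.2.2‖ := by
  have := h.mul_norm_le
  nlinarith [norm_nonneg t.2.1]

theorem child_true (hl : 1 < ‖l‖) (h : Spine l t) : Spine l (child true t) := by
  have hl0 : l ≠ 0 := by rintro rfl; simp at hl; linarith
  refine ⟨h.fst, h.le_snd.trans (h.norm_le hl), ?_⟩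
  have h1 : t.1 * t.2.2 - t.2.1 - l * t.2.2 = l⁻¹ * (t.2.2 - l * t.2.1) := by
    rw [h.fst]; field_simp; ring
  simp only [child, h1, norm_mul, norm_inv]
  have h2 : ‖l‖⁻¹ ≤ 1 := inv_le_one_of_one_le₀ hl.le
  calc ‖l‖⁻¹ * ‖t.2.2 - l * t.2.1‖ ≤ 1 * ((‖l‖ - 1) / 2 * ‖t.2.1‖) := by
        gcongr; exact h.norm_sub_le
    _ ≤ (‖l‖ - 1) / 2 * ‖t.2.2‖ := by
        rw [one_mul]
        exact mul_le_mul_of_nonneg_left (h.norm_le hl) (by linarith)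

theorem child_false (hl : 1 < ‖l‖) (h : Spine l t) : Growing (child false t) := by
  have h1 := h.le_snd
  have h2 := h.norm_le hl
  have h3 := norm_nonneg t.1
  exact .of_mul_sub (by linarith) (by linarith) (by linarith)

theorem ascending (hl : 1 < ‖l‖) (h : Spine l t) : Ascending t :=
  ⟨(h.norm_le hl).trans ((h.child_true hl).norm_le hl),
    by
      have h1 := (h.child_false hl).fst_le
      have h2 := h.le_snd
      have h3 := h.norm_le hl
      simp only [child] at h1
      linarith⟩

theorem ascending_run (hl : 1 < ‖l‖) (h : Spine l t) (s : List Bool) : Ascending (run t s) := by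
  induction s generalizing t with
  | nil => exact h.ascending hl
  | cons x s ih =>
    cases x
    · exact ((h.child_false hl).run s).ascending
    · exact ih (h.child_true hl)

/-- Along the spine the weights decrease by the factor `k⁻²`, `k = (‖l‖ + 1)/2`, and the growing
branch that leaves it costs at most one more weight. The constant is the fixed point of `K = (2 +
K)/k²`. -/
theorem sum_le (hl : 1 < ‖l‖) (h : Spine l t) (n : ℕ) :
    ∑ s ∈ shortLists n, weight (run t s) ≤
      2 / (((‖l‖ + 1) / 2) ^ 2 - 1) * (‖t.2.1‖ ^ 2)⁻¹ := by
  have hk : 0 < ((‖l‖ + 1) / 2) ^ 2 - 1 := by nlinarith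
  induction n generalizing t with
  | zero =>
    simp only [shortLists, Finset.sum_empty]
    positivity
  | succ n ih =>
    have h1 := ih (h.child_true hl)
    have h2 := (h.child_false hl).sum_le n
    rw [sum_shortLists_succ]
    simp only [run] at h1 h2 ⊢
    refine (add_le_add le_rfl (add_le_add h1 h2)).trans ?_
    simp only [child, weight]
    have hb : 3 ≤ ‖t.2.1‖ := by linarith [h.le_snd, norm_nonneg t.1]
    have hc := h.norm_le hl
    have hbc := h.mul_norm_le
    set b := ‖t.2.1‖
    set c := ‖t.2.2‖
    set k := (‖l‖ + 1) / 2
    -- This is where `b ≥ 3`, hence the 3 in `le_snd`, is needed.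
    have e1 : 1 / (((c - 1) ^ 2 - 1) * ((b - 1) ^ 2 - 1)) ≤ (c ^ 2)⁻¹ := by
      rw [← one_div]
      apply one_div_le_one_div_of_le (by nlinarith)
      nlinarith [mul_nonneg (show 0 ≤ (c - 1) ^ 2 - 1 by nlinarith)
        (show 0 ≤ (b - 1) ^ 2 - 1 - 3 by nlinarith)]
    have e2 : (c ^ 2)⁻¹ ≤ (k ^ 2)⁻¹ * (b ^ 2)⁻¹ := by
      rw [← mul_inv, ← mul_pow]
      gcongr
    calc (c ^ 2)⁻¹ + (2 / (k ^ 2 - 1) * (c ^ 2)⁻¹ + 1 / (((c - 1) ^ 2 - 1) * ((b - 1) ^ 2 - 1)))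
        ≤ (2 + 2 / (k ^ 2 - 1)) * (c ^ 2)⁻¹ := by linarith
      _ ≤ (2 + 2 / (k ^ 2 - 1)) * ((k ^ 2)⁻¹ * (b ^ 2)⁻¹) := by gcongr
      _ = 2 / (k ^ 2 - 1) * (b ^ 2)⁻¹ := by
        have : k ≠ 0 := by positivity
        field_simp
        ring

theorem controlled (hl : 1 < ‖l‖) (h : Spine l t) : Controlled t := by
  refine ⟨summable_of_sum_shortLists_le (fun s => weight_nonneg _) (h.sum_le hl), ?_⟩
  convert Set.finite_empty
  ext s
  simp [h.ascending_run hl s]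

end Spine

/-- A number off the interval `[-2, 2]` is `l + l⁻¹` with `l` outside the unit circle. -/
theorem exists_eq_add_inv {x : ℂ} (hx : ∀ r ∈ Set.Icc (-2 : ℝ) 2, x ≠ r) :
    ∃ l : ℂ, 1 < ‖l‖ ∧ x = l + l⁻¹ := by
  obtain ⟨z, hz⟩ := IsAlgClosed.exists_pow_nat_eq (x ^ 2 - 4) (n := 2) (by norm_num)
  have hprod : (x + z) / 2 * ((x - z) / 2) = 1 := by linear_combination -hz / 4
  set l := (x + z) / 2 with hl
  have hinv : (x - z) / 2 = l⁻¹ := (inv_eq_of_mul_eq_one_right hprod).symm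
  have hsum : x = l + l⁻¹ := by rw [← hinv, hl]; ring
  have hl0 : l ≠ 0 := left_ne_zero_of_mul_eq_one hprod
  rcases lt_trichotomy ‖l‖ 1 with h | h | h
  · refine ⟨l⁻¹, ?_, by rw [inv_inv, add_comm]; exact hsum⟩
    rw [norm_inv]
    exact (one_lt_inv₀ (norm_pos_iff.2 hl0)).2 h
  · exfalso
    have hre : l + l⁻¹ = ((2 * l.re : ℝ) : ℂ) := by
      rw [Complex.inv_eq_conj h, Complex.add_conj]
    refine hx (2 * l.re) ?_ (hsum.trans hre)
    have := Complex.abs_re_le_norm l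
    rw [h, abs_le] at this
    constructor <;> linarith
  · exact ⟨l, h, hsum⟩

/-! ### Trees of traces under the Bowditch conditions -/

/-- The values that a trace takes under the Bowditch conditions. -/
structure Admissible (μ x : ℂ) : Prop where
  notMem : ∀ r ∈ Set.Icc (-2 : ℝ) 2, x ≠ r
  sq_ne : x ^ 2 ≠ μ

theorem Admissible.ne_zero {μ x : ℂ} (h : Admissible μ x) : x ≠ 0 := by
  simpa using h.notMem 0 (by simp)

/-- The Bowditch conditions on a tree of traces. -/
structure BowditchTree (μ : ℂ) (t : ℂ × ℂ × ℂ) : Prop where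
  rel : t.1 ^ 2 + t.2.1 ^ 2 + t.2.2 ^ 2 = t.1 * t.2.1 * t.2.2 + μ
  admissible : ∀ s, Admissible μ (run t s).1 ∧ Admissible μ (run t s).2.1 ∧
    Admissible μ (run t s).2.2
  finite : {s | ‖(run t s).2.2‖ ≤ 2}.Finite

namespace BowditchTree

variable {μ : ℂ} {t : ℂ × ℂ × ℂ}

theorem child (h : BowditchTree μ t) (x : Bool) : BowditchTree μ (child x t) := by
  refine ⟨?_, fun s => h.admissible (x :: s),
    h.finite.preimage (f := List.cons x) List.cons_injective.injOn⟩
  have := h.rel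
  cases x <;> simp only [PuncturedTorus.child] <;> linear_combination this

theorem run (h : BowditchTree μ t) (s : List Bool) : BowditchTree μ (run t s) := by
  induction s generalizing t with
  | nil => exact h
  | cons x s ih => exact ih (h.child x)

theorem mirror (h : BowditchTree μ t) : BowditchTree μ (mirror t) := by
  have hinv : Function.Involutive (List.map not) := fun s => by simp [Function.comp_def]
  refine ⟨?_, fun s => ?_, ?_⟩
  · have := h.rel
    simp only [PuncturedTorus.mirror]; linear_combination this
  · rw [run_mirror]
    have := h.admissible (s.map not)
    exact ⟨this.2.1, this.1, this.2.2⟩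
  · simp only [run_mirror]
    exact h.finite.preimage (f := List.map not) hinv.injective.injOn

/-- The curves around a region eventually grow. -/
theorem exists_spine (h : BowditchTree μ t) :
    ∃ l : ℂ, 1 < ‖l‖ ∧ ∃ n, Spine l (PuncturedTorus.run t (List.replicate n true)) := by
  obtain ⟨hadm, -, -⟩ := h.admissible []
  obtain ⟨l, hl, ha⟩ := exists_eq_add_inv hadm.notMem
  simp only [PuncturedTorus.run] at ha
  have hl0 : l ≠ 0 := by rintro rfl; simp at hl; linarith
  refine ⟨l, hl, ?_⟩
  let T := fun n => PuncturedTorus.run t (List.replicate n true)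
  have hT : ∀ n, T (n + 1) = PuncturedTorus.child true (T n) := by
    intro n
    simp only [T, List.replicate_succ', run_append]; rfl
  have h1 : ∀ n, (T n).1 = l + l⁻¹ := by
    intro n
    induction n with
    | zero => exact ha
    | succ n ih => rw [hT]; exact ih
  -- The recursion `z ↦ x z - y` is linear with eigenvalues `l⁻¹` and `l`; the combinations `z - l
  -- y` and `z - l⁻¹ y` are its eigencoordinates.
  have hu : ∀ n, ‖(T n).2.2 - l * (T n).2.1‖ ≤ ‖t.2.2 - l * t.2.1‖ := by
    intro n
    induction n with
    | zero => exact le_rfl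
    | succ n ih =>
      have e : (T (n + 1)).2.2 - l * (T (n + 1)).2.1 = l⁻¹ * ((T n).2.2 - l * (T n).2.1) := by
        rw [hT]; simp only [PuncturedTorus.child]; rw [h1]; field_simp; ring
      rw [e, norm_mul, norm_inv]
      refine le_trans ?_ ih
      exact mul_le_of_le_one_left (norm_nonneg _) (inv_le_one_of_one_le₀ hl.le)
  have hv : ∀ n, (T n).2.2 - l⁻¹ * (T n).2.1 = l ^ n * (t.2.2 - l⁻¹ * t.2.1) := by
    intro n
    induction n with
    | zero => simp [T, PuncturedTorus.run]
    | succ n ih =>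
      rw [pow_succ', mul_assoc, ← ih, hT]
      simp only [PuncturedTorus.child]; rw [h1]; field_simp; ring
  -- Otherwise `y = l z`, and the trace relation collapses to `x² = μ`.
  have hv0 : t.2.2 - l⁻¹ * t.2.1 ≠ 0 := by
    intro h0
    apply hadm.sq_ne
    simp only [PuncturedTorus.run]
    have hb : t.2.1 = l * t.2.2 := by
      rw [sub_eq_zero] at h0
      rw [h0]; field_simp
    have := h.rel
    rw [hb, ha] at this
    rw [ha]
    have hz : l * l⁻¹ = 1 := mul_inv_cancel₀ hl0
    linear_combination this + t.2.2 ^ 2 * hz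
  have hll : l - l⁻¹ ≠ 0 := by
    intro h0
    rw [sub_eq_zero] at h0
    have := congrArg norm h0
    rw [norm_inv] at this
    have h3 : ‖l‖⁻¹ < 1 := inv_lt_one_of_one_lt₀ hl
    linarith
  set u := ‖t.2.2 - l * t.2.1‖ with hudef
  -- The two entries are the lower bounds on the second trace that yield `le_snd` and `norm_sub_le`.
  set M := max (‖t.1‖ + 3) (u / ((‖l‖ - 1) / 2)) with hM
  obtain ⟨n, hn⟩ := pow_unbounded_of_one_lt
    ((u + ‖l - l⁻¹‖ * M) / ‖t.2.2 - l⁻¹ * t.2.1‖) hl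
  rw [div_lt_iff₀ (norm_pos_iff.2 hv0), ← norm_pow, ← norm_mul, ← hv] at hn
  have hMn : M ≤ ‖(T n).2.1‖ := by
    have e : (l - l⁻¹) * (T n).2.1 =
        ((T n).2.2 - l⁻¹ * (T n).2.1) - ((T n).2.2 - l * (T n).2.1) := by ring
    have e2 := norm_sub_norm_le ((T n).2.2 - l⁻¹ * (T n).2.1) ((T n).2.2 - l * (T n).2.1)
    rw [← e, norm_mul] at e2
    have e3 := hu n
    have : ‖l - l⁻¹‖ * M ≤ ‖l - l⁻¹‖ * ‖(T n).2.1‖ := by linarith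
    exact le_of_mul_le_mul_left this (norm_pos_iff.2 hll)
  refine ⟨n, h1 n, ?_, ?_⟩
  · have : (T n).1 = t.1 := by rw [h1, ha]
    change ‖(T n).1‖ + 3 ≤ _
    rw [this]
    exact (le_max_left _ _).trans hMn
  · refine (hu n).trans ?_
    have h5 := (le_max_right _ _).trans hMn
    rw [div_le_iff₀ (by linarith)] at h5
    change _ ≤ _ * ‖(T n).2.1‖
    linarith

end BowditchTree

/-! ### Infinite paths and the proof of convergence -/

/-- The decrease of the total length across the edge entering a triangle. -/
def drop (t : ℂ × ℂ × ℂ) : ℝ := ‖t.1 * t.2.1 - t.2.2‖ - ‖t.2.2‖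

/-- The total length of a triangle. -/
def size (t : ℂ × ℂ × ℂ) : ℝ := ‖t.1‖ + ‖t.2.1‖ + ‖t.2.2‖

theorem size_child (x : Bool) (t : ℂ × ℂ × ℂ) : size (child x t) = size t - drop (child x t) := by
  cases x <;> simp only [size, drop, child, sub_sub_cancel] <;> ring

/-- An edge between long curves that points back towards its tail starts a growing tree. -/
theorem controlled_of_drop_nonpos {t : ℂ × ℂ × ℂ} (h1 : 2 < ‖t.1‖) (h2 : 2 < ‖t.2.1‖)
    (h : drop t ≤ 0) : Controlled t := by
  have h3 : ‖t.1‖ * ‖t.2.1‖ ≤ 2 * ‖t.2.2‖ := by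
    have := norm_add_le (t.1 * t.2.1 - t.2.2) t.2.2
    rw [sub_add_cancel, norm_mul] at this
    rw [drop] at h
    linarith
  have h4 : ‖t.1‖ ≤ ‖t.2.2‖ := by nlinarith
  have h5 : ‖t.2.1‖ ≤ ‖t.2.2‖ := by nlinarith
  -- `t` itself need not be growing, but its newest region is the longest, which makes both children
  -- growing.
  refine .of_child fun x => Growing.controlled ?_
  cases x
  · exact .of_mul_sub (by linarith) h2 (by linarith)
  · exact .of_mul_sub h1 (by linarith) (by linarith)

/-- Two consecutive edges that keep the lengths of long curves force `μ = 4`. -/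
theorem eq_four_of_norm_eq {x y z μ : ℂ} (hrel : x ^ 2 + y ^ 2 + z ^ 2 = x * y * z + μ)
    (hx : 2 ≤ ‖x‖) (hy : 2 ≤ ‖y‖) (hz : ‖x * y - z‖ = ‖z‖) (hy' : ‖x * z - y‖ = ‖y‖) : μ = 4 := by
  have e1 : ‖x‖ * ‖y‖ ≤ 2 * ‖z‖ := by
    have := norm_add_le (x * y - z) z
    rw [sub_add_cancel, norm_mul] at this; linarith
  have e2 : ‖x‖ * ‖z‖ ≤ 2 * ‖y‖ := by
    have := norm_add_le (x * z - y) y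
    rw [sub_add_cancel, norm_mul] at this; linarith
  have e3 : ‖y‖ ≤ ‖z‖ := by nlinarith
  have e4 : ‖z‖ ≤ ‖y‖ := by nlinarith
  have e5 : ‖z‖ = ‖y‖ := le_antisymm e4 e3
  have e6 : ‖x‖ = 2 := by
    refine le_antisymm ?_ hx
    rw [e5] at e2
    exact le_of_mul_le_mul_right e2 (by linarith)
  -- The triangle inequality for `xy = (xy - z) + z` is an equality between vectors of equal length,
  -- so they coincide. Likewise `xz = 2y`, whence `x² = 4` and `y² = z²`.
  have k1 : x * y - z = z := by
    refine eq_of_norm_eq_of_norm_add_eq hz ?_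
    rw [sub_add_cancel, norm_mul, hz, e6, e5]; ring
  have k2 : x * z - y = y := by
    refine eq_of_norm_eq_of_norm_add_eq hy' ?_
    rw [sub_add_cancel, norm_mul, hy', e6, e5]; ring
  have hy0 : y ≠ 0 := by rintro rfl; simp at hy; linarith
  have hx2 : x ^ 2 = 4 := by
    apply mul_right_cancel₀ hy0
    linear_combination x * k1 + 2 * k2
  have hyz : y ^ 2 = z ^ 2 := by
    linear_combination (1 / 2 : ℂ) * z * k1 - (1 / 2 : ℂ) * y * k2
  linear_combination hx2 - hrel + hyz - z * k1

/-- An infinite path of moves. -/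
structure IsRay (T : ℕ → ℂ × ℂ × ℂ) (d : ℕ → Bool) : Prop where
  succ : ∀ n, T (n + 1) = child (d n) (T n)

namespace IsRay

variable {T : ℕ → ℂ × ℂ × ℂ} {d : ℕ → Bool} {μ : ℂ}

theorem run_eq (h : IsRay T d) (n k : ℕ) :
    T (n + k) = run (T n) ((List.range k).map fun i => d (n + i)) := by
  induction k with
  | zero => rfl
  | succ k ih => rw [List.range_succ, List.map_append, run_append, ← ih, ← add_assoc, h.succ]; rfl

theorem bowditchTree (h : IsRay T d) (h0 : BowditchTree μ (T 0)) (n : ℕ) :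
    BowditchTree μ (T n) := by
  rw [← zero_add n, h.run_eq]; exact h0.run _

theorem eventually_two_lt (h : IsRay T d) (h0 : BowditchTree μ (T 0)) :
    ∀ᶠ n in atTop, 2 < ‖(T n).2.2‖ := by
  -- Distinct initial segments of the path are distinct words, so only finitely many carry a short
  -- trace.
  have hinj : Function.Injective fun n => (List.range n).map fun i => d (0 + i) := fun m n hmn => by
    simpa using congrArg List.length hmn
  have hfin := h0.finite.preimage hinj.injOn
  rw [← Nat.cofinite_eq_atTop]
  refine hfin.subset fun n hn => ?_
  rw [Set.mem_compl_iff, Set.mem_ofPred_eq, not_lt] at hn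
  rwa [Set.mem_preimage, Set.mem_ofPred_eq, ← h.run_eq, zero_add]

/-- A ray that eventually follows a region on its left meets a controlled tree. -/
theorem exists_controlled_of_eventually_true (h : IsRay T d) (h0 : BowditchTree μ (T 0)) {N : ℕ}
    (hN : ∀ n, N ≤ n → d n = true) : ∃ n, Controlled (T n) := by
  obtain ⟨l, hl, n, hs⟩ := (h.bowditchTree h0 N).exists_spine
  refine ⟨N + n, ?_⟩
  rw [h.run_eq]
  convert hs.controlled hl using 2
  rw [List.eq_replicate_iff]
  simp [hN]

theorem exists_controlled_of_eventually_false (h : IsRay T d) (h0 : BowditchTree μ (T 0)) {N : ℕ}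
    (hN : ∀ n, N ≤ n → d n = false) : ∃ n, Controlled (T n) := by
  have h' : IsRay (fun n => mirror (T n)) (fun n => !(d n)) :=
    ⟨fun n => by rw [child_mirror, h.succ, Bool.not_not]⟩
  obtain ⟨n, hn⟩ := h'.exists_controlled_of_eventually_true (μ := μ) h0.mirror (N := N)
    (fun n hn => by simp [hN n hn])
  exact ⟨n, hn.of_mirror⟩

/-- A ray that turns infinitely often meets a controlled tree. -/
theorem exists_controlled_of_frequently (hμ : μ ≠ 4) (h : IsRay T d) (h0 : BowditchTree μ (T 0))
    (ht : ∀ N, ∃ n, N ≤ n ∧ d n = true) (hf : ∀ N, ∃ n, N ≤ n ∧ d n = false) :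
    ∃ n, Controlled (T n) := by
  by_contra! hc
  obtain ⟨N₀, hN₀⟩ := eventually_atTop.1 (h.eventually_two_lt h0)
  obtain ⟨n₁, hn₁, hd₁⟩ := ht N₀
  obtain ⟨n₂, hn₂, hd₂⟩ := hf N₀
  -- A `true` move puts the newest region, already long, into the second slot; later moves keep it
  -- or replace it by another long one.
  have hsnd : ∀ n, n₁ < n → 2 < ‖(T n).2.1‖ := by
    intro n hn
    induction n, hn using Nat.le_induction with
    | base => rw [h.succ, hd₁]; exact hN₀ _ hn₁
    | succ n hn ih =>
      rw [h.succ]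
      cases d n
      · exact ih
      · exact hN₀ _ (by omega)
  have hfst : ∀ n, n₂ < n → 2 < ‖(T n).1‖ := by
    intro n hn
    induction n, hn using Nat.le_induction with
    | base => rw [h.succ, hd₂]; exact hN₀ _ hn₂
    | succ n hn ih =>
      rw [h.succ]
      cases d n
      · exact hN₀ _ (by omega)
      · exact ih
  set N := n₁ + n₂ + 1 with hN
  have hdrop : ∀ n, N ≤ n → 0 < drop (T n) := by
    intro n hn
    by_contra hle
    exact hc n (controlled_of_drop_nonpos (hfst n (by omega)) (hsnd n (by omega)) (not_lt.1 hle))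
  have hsize : ∀ n, size (T (n + 1)) = size (T n) - drop (T (n + 1)) := fun n => by
    rw [h.succ, size_child]
  have hanti : Antitone fun n => size (T (N + n)) := by
    refine antitone_nat_of_succ_le fun n => ?_
    have := hdrop (N + n + 1) (by omega)
    have := hsize (N + n)
    simp only [← add_assoc]
    linarith
  have hnn : ∀ t, 0 ≤ size t := fun t => by unfold size; positivity
  obtain ⟨σ, hσ⟩ : ∃ σ, Tendsto (fun n => size (T n)) atTop (𝓝 σ) := by
    have h1 : Tendsto (fun n => size (T (N + n))) atTop (𝓝 (⨅ n, size (T (N + n)))) :=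
      tendsto_atTop_ciInf hanti ⟨0, by rintro _ ⟨n, rfl⟩; exact hnn _⟩
    refine ⟨⨅ n, size (T (N + n)), (tendsto_add_atTop_iff_nat (f := fun n => size (T n)) N).1 ?_⟩
    simpa only [add_comm _ N] using h1
  have hdrop1 : Tendsto (fun n => drop (T (n + 1))) atTop (𝓝 0) := by
    have e : (fun n => drop (T (n + 1))) = fun n => size (T n) - size (T (n + 1)) := by
      ext n; rw [hsize]; ring
    rw [e, ← sub_self σ]
    exact hσ.sub ((tendsto_add_atTop_iff_nat (f := fun n => size (T n)) 1).2 hσ)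
  have hdrop0 : Tendsto (fun n => drop (T n)) atTop (𝓝 0) :=
    (tendsto_add_atTop_iff_nat (f := fun n => drop (T n)) 1).1 hdrop1
  -- Only times followed by a `true` move are kept, so that the next triple is `child true` of the
  -- present one and two vanishing drops pass to the same limit.
  obtain ⟨φ, hφ, hdφ⟩ := extraction_of_frequently_atTop (P := fun n => N ≤ n ∧ d n = true)
    (frequently_atTop.2 fun M => by
      obtain ⟨n, hn, hdn⟩ := ht (max M N)
      exact ⟨n, (le_max_left _ _).trans hn, (le_max_right _ _).trans hn, hdn⟩)
  -- Decreasing total length keeps the triples in a compact ball.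
  obtain ⟨L, -, ψ, hψ, hL⟩ := tendsto_subseq_of_bounded (s := Metric.closedBall 0 (size (T N)))
    Metric.isBounded_closedBall (x := fun n => T (φ n)) (fun n => by
      obtain ⟨k, hk⟩ := Nat.exists_eq_add_of_le (hdφ n).1
      have h1 : size (T (φ n)) ≤ size (T N) := by rw [hk]; exact hanti (Nat.zero_le k)
      rw [mem_closedBall_zero_iff, Prod.norm_def, Prod.norm_def]
      unfold size at h1 ⊢
      have h2 := norm_nonneg (T (φ n)).1
      have h3 := norm_nonneg (T (φ n)).2.1
      have h4 := norm_nonneg (T (φ n)).2.2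
      exact max_le (by linarith) (max_le (by linarith) (by linarith)))
  have hθ : Tendsto (fun n => φ (ψ n)) atTop atTop := hφ.tendsto_atTop.comp hψ.tendsto_atTop
  have hdropc : Continuous drop := by unfold drop; fun_prop
  have hchildc : Continuous (child true) := by unfold child; fun_prop
  have k1 : drop L = 0 :=
    tendsto_nhds_unique ((hdropc.tendsto L).comp hL) (hdrop0.comp hθ)
  have k2 : drop (child true L) = 0 := by
    refine tendsto_nhds_unique (((hdropc.comp hchildc).tendsto L).comp hL) ?_
    refine (hdrop1.comp hθ).congr fun n => ?_
    simp only [Function.comp_apply]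
    rw [h.succ, (hdφ (ψ n)).2]
  have k3 : 2 ≤ ‖L.1‖ :=
    ge_of_tendsto' (((continuous_fst.norm).tendsto L).comp hL) fun n =>
      (hfst _ (by have := (hdφ (ψ n)).1; omega)).le
  have k4 : 2 ≤ ‖L.2.1‖ :=
    ge_of_tendsto' (((continuous_fst.comp continuous_snd).norm.tendsto L).comp hL) fun n =>
      (hsnd _ (by have := (hdφ (ψ n)).1; omega)).le
  have k5 : L.1 ^ 2 + L.2.1 ^ 2 + L.2.2 ^ 2 = L.1 * L.2.1 * L.2.2 + μ := by
    have hc1 : Continuous fun t : ℂ × ℂ × ℂ => t.1 ^ 2 + t.2.1 ^ 2 + t.2.2 ^ 2 := by fun_prop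
    have hc2 : Continuous fun t : ℂ × ℂ × ℂ => t.1 * t.2.1 * t.2.2 + μ := by fun_prop
    refine tendsto_nhds_unique ((hc1.tendsto L).comp hL)
      (((hc2.tendsto L).comp hL).congr fun n => ?_)
    exact (h.bowditchTree h0 _).rel.symm
  refine hμ (eq_four_of_norm_eq k5 k3 k4 (by rw [drop] at k1; linarith) ?_)
  simp only [drop, child, sub_sub_cancel] at k2
  linarith

/-- Every ray meets a controlled tree. -/
theorem exists_controlled (hμ : μ ≠ 4) (h : IsRay T d) (h0 : BowditchTree μ (T 0)) :
    ∃ n, Controlled (T n) := by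
  by_cases ht : ∀ N, ∃ n, N ≤ n ∧ d n = true
  · by_cases hf : ∀ N, ∃ n, N ≤ n ∧ d n = false
    · exact h.exists_controlled_of_frequently hμ h0 ht hf
    · push Not at hf
      obtain ⟨N, hN⟩ := hf
      exact h.exists_controlled_of_eventually_true h0 (N := N) fun n hn => by simpa using hN n hn
  · push Not at ht
    obtain ⟨N, hN⟩ := ht
    exact h.exists_controlled_of_eventually_false h0 (N := N) fun n hn => by simpa using hN n hn

end IsRay

/-- Failure at a triple passes to a child by `Controlled.of_child`, hence would persist along an
infinite path. -/
theorem BowditchTree.controlled {μ : ℂ} (hμ : μ ≠ 4) {t : ℂ × ℂ × ℂ} (h : BowditchTree μ t) :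
    Controlled t := by
  by_contra hc
  have step : ∀ t, ¬ Controlled t → ∃ x, ¬ Controlled (PuncturedTorus.child x t) := fun t ht => by
    by_contra! H
    exact ht (.of_child H)
  choose! f hf using step
  let T : ℕ → ℂ × ℂ × ℂ := fun n =>
    Nat.rec t (fun _ t => PuncturedTorus.child (f t) t) n
  have hT : ∀ n, ¬ Controlled (T n) := by
    intro n
    induction n with
    | zero => exact hc
    | succ n ih => exact hf _ ih
  obtain ⟨n, hn⟩ := IsRay.exists_controlled (T := T) (d := fun n => f (T n)) hμ
    ⟨fun n => rfl⟩ h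
  exact hT n hn

/-! ### Edge values -/

/-- The square root that occurs in `h`. -/
def root (x : ℂ) : ℂ := Complex.sqrt (1 - 4 / x ^ 2)

theorem root_sq (x : ℂ) : root x ^ 2 = 1 - 4 / x ^ 2 := by
  rw [root, Complex.sqrt]
  have := Complex.cpow_nat_inv_pow (1 - 4 / x ^ 2) two_ne_zero
  rwa [Nat.cast_ofNat] at this

theorem root_re_nonneg (x : ℂ) : 0 ≤ (root x).re := by
  rw [root, Complex.sqrt, Complex.cpow_inv_two_re]
  exact Real.sqrt_nonneg _

theorem h_eq (μ x : ℂ) : h μ x = 1 / 2 * (1 - (x ^ 2 - 2 / 3 * μ) / (x ^ 2 - μ) * root x) := rfl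

/-- A root `i r` with `r` real would give `x² = 4/(1 + r²)`, which lies in `(0, 4]`, so `x` would be
in `[-2, 2]`. -/
theorem Admissible.root_re_pos {μ x : ℂ} (hx : Admissible μ x) : 0 < (root x).re := by
  refine lt_of_le_of_ne (root_re_nonneg x) fun h0 => ?_
  have hx0 := hx.ne_zero
  set r := (root x).im with hr
  have h1 : root x = r * Complex.I := by
    apply Complex.ext <;> simp [← h0, hr]
  have h2 : x ^ 2 = ((4 / (1 + r ^ 2) : ℝ) : ℂ) := by
    have h3 := root_sq x
    rw [h1, mul_pow, Complex.I_sq] at h3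
    have h4 : (1 + (r : ℂ) ^ 2) * x ^ 2 = 4 := by
      have : (4 / x ^ 2) * x ^ 2 = 4 := by field_simp
      linear_combination (-x ^ 2) * h3 + this
    have h5 : (1 + (r : ℂ) ^ 2) ≠ 0 := by
      have : (1 + r ^ 2 : ℝ) ≠ 0 := by positivity
      exact_mod_cast this
    push_cast
    rw [eq_div_iff h5]
    linear_combination h4
  set q := Real.sqrt (4 / (1 + r ^ 2)) with hq
  have hqq : (q : ℂ) ^ 2 = x ^ 2 := by
    rw [h2, ← Complex.ofReal_pow, Real.sq_sqrt (by positivity)]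
  have hq2 : q ≤ 2 := by
    rw [hq]
    apply Real.sqrt_le_iff.2
    refine ⟨by norm_num, ?_⟩
    rw [div_le_iff₀ (by positivity)]
    nlinarith [sq_nonneg r]
  have hq0 : 0 ≤ q := Real.sqrt_nonneg _
  rcases sq_eq_sq_iff_eq_or_eq_neg.1 hqq with H | H
  · exact hx.notMem q ⟨by linarith, hq2⟩ H.symm
  · refine hx.notMem (-q) ⟨by linarith, by linarith⟩ ?_
    rw [Complex.ofReal_neg, H, neg_neg]

theorem half_le_root_re {x : ℂ} (hx : 3 ≤ ‖x‖) : 1 / 2 ≤ (root x).re := by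
  have h0 := root_re_nonneg x
  have h1 := congrArg Complex.re (root_sq x)
  have h2 : |(4 / x ^ 2 : ℂ).re| ≤ 4 / 9 := by
    refine (Complex.abs_re_le_norm _).trans ?_
    rw [norm_div, norm_pow]
    norm_num
    apply div_le_div_of_nonneg_left <;> nlinarith
  rw [abs_le] at h2
  rw [pow_two, Complex.mul_re, Complex.sub_re, Complex.one_re] at h1
  nlinarith [sq_nonneg (root x).im]

theorem norm_root_le {x : ℂ} (hx : 2 ≤ ‖x‖) : ‖root x‖ ≤ 2 := by
  have h1 : ‖root x‖ ^ 2 ≤ 1 + 1 := by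
    rw [← norm_pow, root_sq]
    refine (norm_sub_le _ _).trans ?_
    rw [norm_one, norm_div, norm_pow]
    gcongr
    norm_num
    rw [div_le_one (by positivity)]
    nlinarith
  nlinarith [norm_nonneg (root x)]

theorem norm_one_sub_root_le (x : ℂ) : ‖1 - root x‖ ≤ 4 / ‖x‖ ^ 2 := by
  have h1 : (1 - root x) * (1 + root x) = 4 / x ^ 2 := by
    linear_combination -(root_sq x)
  have h2 : 1 ≤ ‖1 + root x‖ := by
    refine le_trans ?_ (Complex.re_le_norm _)
    simpa using root_re_nonneg x
  have h3 := congrArg norm h1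
  rw [norm_mul, norm_div, norm_pow] at h3
  norm_num at h3
  rw [← h3]
  exact le_mul_of_one_le_right (norm_nonneg _) h2

theorem norm_div_sq_sub_le {μ y : ℂ} (hy : y ≠ 0) (h : 2 * ‖μ‖ ≤ ‖y‖ ^ 2) :
    ‖μ / (y ^ 2 - μ)‖ ≤ 2 * ‖μ‖ * (‖y‖ ^ 2)⁻¹ := by
  have hy' : 0 < ‖y‖ ^ 2 := by positivity
  have h1 : ‖y‖ ^ 2 / 2 ≤ ‖y ^ 2 - μ‖ := by
    have := norm_sub_norm_le (y ^ 2) μ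
    rw [norm_pow] at this
    linarith
  rw [norm_div]
  calc ‖μ‖ / ‖y ^ 2 - μ‖ ≤ ‖μ‖ / (‖y‖ ^ 2 / 2) := by gcongr
    _ = 2 * ‖μ‖ * (‖y‖ ^ 2)⁻¹ := by field_simp

/-- The contribution of a long curve. -/
theorem norm_h_le {μ x : ℂ} (h2 : 2 ≤ ‖x‖) (h : 2 * ‖μ‖ ≤ ‖x‖ ^ 2) (hne : x ^ 2 ≠ μ) :
    ‖PuncturedTorus.h μ x‖ ≤ (2 + ‖μ‖) * (‖x‖ ^ 2)⁻¹ := by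
  have hx : x ≠ 0 := by rintro rfl; simp at h2; linarith
  have hd : x ^ 2 - μ ≠ 0 := sub_ne_zero.2 hne
  have e : PuncturedTorus.h μ x =
      1 / 2 * (1 - root x) - 1 / 6 * (μ / (x ^ 2 - μ) * root x) := by
    rw [h_eq]; field_simp; ring
  have h3 := norm_one_sub_root_le x
  have h4 := norm_div_sq_sub_le hx h
  have h5 := norm_root_le h2
  rw [e]
  refine (norm_sub_le _ _).trans ?_
  rw [norm_mul, norm_mul, norm_mul]
  have h6 : ‖μ / (x ^ 2 - μ)‖ * ‖root x‖ ≤ 2 * ‖μ‖ * (‖x‖ ^ 2)⁻¹ * 2 := by gcongr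
  rw [div_eq_mul_inv] at h3
  have h7 : 0 ≤ ‖μ‖ * (‖x‖ ^ 2)⁻¹ := by positivity
  have e1 : ‖(1 / 2 : ℂ)‖ = 1 / 2 := by norm_num
  have e2 : ‖(1 / 6 : ℂ)‖ = 1 / 6 := by norm_num
  rw [e1, e2]
  linarith

/-- An edge that points towards the older triangle, with a long newer region, has a value close to
the contribution of its older region. -/
theorem norm_Psi_sub_h_le {μ x y z w : ℂ} {ε : ℝ} (hε : 0 < ε) (hxε : ε ≤ ‖x‖)
    (hrε : ε ≤ (root x).re) (hne : x ^ 2 ≠ μ) (hy1 : 1 ≤ ‖y‖) (hy2 : 2 * ‖μ‖ ≤ ‖y‖ ^ 2)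
    (hsum : z + w = x * y) (hprod : z * w = x ^ 2 + y ^ 2 - μ) (hzw : ‖w‖ ≤ ‖z‖) :
    ‖Psi μ x y w - PuncturedTorus.h μ x‖ ≤
      (2 * (1 + 2 / 3 * (‖μ‖ / ε ^ 2)) / ε +
        1 / 6 * (2 + (5 + 4 / ε ^ 2 + 4 * ‖μ‖ / ε ^ 2)) * (2 * ‖μ‖)) * (‖y‖ ^ 2)⁻¹ := by
  have hx0 : x ≠ 0 := norm_pos_iff.1 (hε.trans_le hxε)
  have hy0 : y ≠ 0 := norm_pos_iff.1 (by linarith)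
  have hd : x ^ 2 - μ ≠ 0 := sub_ne_zero.2 hne
  -- `σ = (z - w)/(z + w)` is the analogue of `root x` with `y` still finite: it has nonnegative
  -- real part because `|w| ≤ |z|`, and its square tends to `1 - 4/x²` as `y` grows.
  obtain ⟨σ, hσ⟩ : ∃ σ, σ = 1 - 2 * (w / (x * y)) := ⟨_, rfl⟩
  have hσ' : σ = (z - w) / (x * y) := by
    rw [hσ]; field_simp; linear_combination -hsum
  have hσre : 0 ≤ σ.re := by
    rw [hσ', ← hsum]
    rw [Complex.div_re, ← add_div]
    apply div_nonneg _ (Complex.normSq_nonneg _)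
    have h1 : Complex.normSq w ≤ Complex.normSq z := by
      rw [Complex.normSq_eq_norm_sq, Complex.normSq_eq_norm_sq]
      gcongr
    rw [Complex.normSq_apply, Complex.normSq_apply] at h1
    simp only [Complex.sub_re, Complex.sub_im, Complex.add_re, Complex.add_im]
    nlinarith
  have hσsq : σ ^ 2 = 1 - 4 / x ^ 2 - 4 / y ^ 2 + 4 * μ / (x ^ 2 * y ^ 2) := by
    rw [hσ', div_pow]
    have : (z - w) ^ 2 = (x * y) ^ 2 - 4 * (x ^ 2 + y ^ 2 - μ) := by
      rw [← hsum, ← hprod]; ring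
    rw [this]; field_simp; ring
  -- Both real parts are nonnegative and the first is at least `ε`. This selects the same branch of
  -- the square root, so the difference of squares controls `root x - σ`.
  have hs : ε ≤ ‖root x + σ‖ := by
    refine le_trans ?_ (Complex.re_le_norm _)
    rw [Complex.add_re]; linarith
  have hs0 : root x + σ ≠ 0 := norm_pos_iff.1 (hε.trans_le hs)
  have hdiff : root x - σ = 4 * (x ^ 2 - μ) / (x ^ 2 * y ^ 2 * (root x + σ)) := by
    rw [eq_div_iff (by positivity)]
    have : (root x - σ) * (root x + σ) = 4 / y ^ 2 - 4 * μ / (x ^ 2 * y ^ 2) := by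
      linear_combination root_sq x - hσsq
    calc (root x - σ) * (x ^ 2 * y ^ 2 * (root x + σ))
        = x ^ 2 * y ^ 2 * ((root x - σ) * (root x + σ)) := by ring
      _ = 4 * (x ^ 2 - μ) := by rw [this]; field_simp
  -- The factor `x² - μ` of `root x - σ` cancels the denominator, so the bound requires no lower
  -- bound on `|x² - μ|`.
  have key : Psi μ x y w - PuncturedTorus.h μ x =
      2 * (1 - 2 / 3 * (μ / x ^ 2)) / (root x + σ) * (y ^ 2)⁻¹ -
        1 / 6 * σ * (μ / (y ^ 2 - μ)) := by
    have e1 : w / (x * y) = (1 - σ) / 2 := by rw [hσ]; ring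
    have e2 : Psi μ x y w - PuncturedTorus.h μ x =
        1 / 2 * ((x ^ 2 - 2 / 3 * μ) / (x ^ 2 - μ)) * (root x - σ) -
          1 / 6 * σ * (μ / (y ^ 2 - μ)) := by
      have e3 : μ / (x ^ 2 - μ) = 3 * ((x ^ 2 - 2 / 3 * μ) / (x ^ 2 - μ)) - 3 := by
        field_simp; ring
      rw [Psi, h_eq, e1, e3]; ring
    rw [e2, hdiff]
    congr 1
    field_simp
    ring
  have b1 : ‖2 * (1 - 2 / 3 * (μ / x ^ 2)) / (root x + σ) * (y ^ 2)⁻¹‖ ≤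
      2 * (1 + 2 / 3 * (‖μ‖ / ε ^ 2)) / ε * (‖y‖ ^ 2)⁻¹ := by
    rw [norm_mul, norm_div, norm_mul, norm_inv, norm_pow]
    have : ‖1 - 2 / 3 * (μ / x ^ 2)‖ ≤ 1 + 2 / 3 * (‖μ‖ / ε ^ 2) := by
      refine (norm_sub_le _ _).trans ?_
      rw [norm_mul, norm_div μ, norm_pow, norm_one]
      norm_num
      gcongr
    rw [Complex.norm_ofNat]
    gcongr
  have b2 : ‖σ‖ ≤ 2 + (5 + 4 / ε ^ 2 + 4 * ‖μ‖ / ε ^ 2) := by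
    have h1 : ‖σ‖ ^ 2 ≤ 5 + 4 / ε ^ 2 + 4 * ‖μ‖ / ε ^ 2 := by
      rw [← norm_pow, hσsq]
      have n1 : ‖(4 : ℂ) / x ^ 2‖ ≤ 4 / ε ^ 2 := by
        rw [norm_div, norm_pow, Complex.norm_ofNat]; gcongr
      have n2 : ‖(4 : ℂ) / y ^ 2‖ ≤ 4 := by
        rw [norm_div, norm_pow, Complex.norm_ofNat]
        apply div_le_self (by norm_num)
        exact one_le_pow₀ hy1
      have n3 : ‖4 * μ / (x ^ 2 * y ^ 2)‖ ≤ 4 * ‖μ‖ / ε ^ 2 := by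
        rw [norm_div, norm_mul, norm_mul, norm_pow, norm_pow, Complex.norm_ofNat]
        apply div_le_div_of_nonneg_left (by positivity) (by positivity)
        calc ε ^ 2 ≤ ‖x‖ ^ 2 := by gcongr
          _ ≤ ‖x‖ ^ 2 * ‖y‖ ^ 2 := le_mul_of_one_le_right (by positivity) (one_le_pow₀ hy1)
      calc ‖1 - 4 / x ^ 2 - 4 / y ^ 2 + 4 * μ / (x ^ 2 * y ^ 2)‖
          ≤ ‖(1 : ℂ)‖ + ‖(4 : ℂ) / x ^ 2‖ + ‖(4 : ℂ) / y ^ 2‖ + ‖4 * μ / (x ^ 2 * y ^ 2)‖ := by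
            refine (norm_add_le _ _).trans ?_
            gcongr
            refine (norm_sub_le _ _).trans ?_
            gcongr
            exact norm_sub_le _ _
        _ ≤ _ := by rw [norm_one]; linarith
    nlinarith [norm_nonneg σ, sq_nonneg (‖σ‖ - 1)]
  have b3 := norm_div_sq_sub_le hy0 hy2
  have b4 : ‖1 / 6 * σ * (μ / (y ^ 2 - μ))‖ ≤
      1 / 6 * (2 + (5 + 4 / ε ^ 2 + 4 * ‖μ‖ / ε ^ 2)) * (2 * ‖μ‖ * (‖y‖ ^ 2)⁻¹) := by
    rw [norm_mul, norm_mul]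
    norm_num at b2 b3 ⊢
    gcongr
  rw [key]
  refine (norm_sub_le _ _).trans ((add_le_add b1 b4).trans (le_of_eq ?_))
  ring

/-- The value of an edge is the sum of the values of the two edges behind it. -/
theorem Psi_eq_add {μ a b c : ℂ} (ha : Admissible μ a) (hb : Admissible μ b)
    (hc : Admissible μ c) (hrel : a ^ 2 + b ^ 2 + c ^ 2 = a * b * c + μ) :
    Psi μ a b (a * b - c) = Psi μ a c b + Psi μ c b a := by
  have ha0 := ha.ne_zero
  have hb0 := hb.ne_zero
  have hc0 := hc.ne_zero
  -- By the trace relation the bracket is `(x² - μ)/(xyz)`, which cancels the denominator. Each of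
  -- the three regions contributes the same `μ/(xyz)`; hence the coefficient `1/3` in `Psi`.
  have key : ∀ x y z : ℂ, x ≠ 0 → y ≠ 0 → z ≠ 0 → x ^ 2 ≠ μ →
      x ^ 2 + y ^ 2 + z ^ 2 = x * y * z + μ →
      μ / (x ^ 2 - μ) * (1 - z / (x * y) - y / (x * z)) = μ / (x * y * z) := by
    intro x y z hx hy hz hne h
    have hd : x ^ 2 - μ ≠ 0 := sub_ne_zero.2 hne
    have : 1 - z / (x * y) - y / (x * z) = (x ^ 2 - μ) / (x * y * z) := by
      field_simp
      linear_combination -h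
    rw [this]; field_simp
  have kA := key a b c ha0 hb0 hc0 ha.sq_ne hrel
  have kB := key b a c hb0 ha0 hc0 hb.sq_ne (by linear_combination hrel)
  have kC := key c a b hc0 ha0 hb0 hc.sq_ne (by linear_combination hrel)
  have hsum : c / (a * b) + b / (a * c) + a / (b * c) = 1 + μ / (a * b * c) := by
    field_simp; linear_combination hrel
  have e1 : (a * b - c) / (a * b) = 1 - c / (a * b) := by field_simp
  rw [mul_comm b a] at kB
  rw [show c * a * b = a * b * c by ring, mul_comm c a, mul_comm c b] at kC
  simp only [Psi, e1, mul_comm c b]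
  linear_combination -hsum + (1 / 3 : ℂ) * kA + (1 / 3 : ℂ) * kB + (1 / 3 : ℂ) * kC

/-! ### The identity on a tree of traces -/

theorem Psi_comm (μ x y z : ℂ) : Psi μ x y z = Psi μ y x z := by
  rw [Psi, Psi, mul_comm x y]; ring

/-- The total weight below a triangle. -/
def totalWeight (t : ℂ × ℂ × ℂ) : ℝ := ∑' s, weight (run t s)

/-- The difference of the two sides of the identity. -/
def defect (μ : ℂ) (t : ℂ × ℂ × ℂ) : ℂ :=
  Psi μ t.1 t.2.1 (t.1 * t.2.1 - t.2.2) - h μ t.1 - h μ t.2.1 - 2 * ∑' s, h μ (run t s).2.2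

theorem totalWeight_nonneg (t : ℂ × ℂ × ℂ) : 0 ≤ totalWeight t :=
  tsum_nonneg fun _ => weight_nonneg _

theorem Controlled.totalWeight_eq {t : ℂ × ℂ × ℂ} (h : Controlled t) :
    totalWeight t = weight t + (totalWeight (PuncturedTorus.child true t) +
      totalWeight (PuncturedTorus.child false t)) :=
  tsum_list_bool_real h.summable

/-- `Psi` is additive, and the newest region, counted twice in the sum for `t`, is counted once as a
boundary region of each child. -/
theorem defect_eq_add {μ : ℂ} {t : ℂ × ℂ × ℂ} (ht : BowditchTree μ t)
    (hs : Summable fun s => h μ (run t s).2.2) :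
    defect μ t = defect μ (child true t) + defect μ (child false t) := by
  obtain ⟨ha, hb, hc⟩ := ht.admissible []
  have h1 := Psi_eq_add ha hb hc ht.rel
  have h2 := tsum_list_bool hs
  simp only [run] at h1 h2
  simp only [defect, h1, h2]
  simp only [child, sub_sub_cancel]
  ring

theorem Controlled.finite_norm_le {μ : ℂ} {t : ℂ × ℂ × ℂ} (h : Controlled t)
    (ht : BowditchTree μ t) {M : ℝ} (hM : 0 < M) : {s | ‖(run t s).2.2‖ ≤ M}.Finite := by
  have h1 := h.summable.tendsto_cofinite_zero.eventually
    (gt_mem_nhds (show (0 : ℝ) < (M ^ 2)⁻¹ by positivity))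
  refine (show {s | ¬ weight (run t s) < (M ^ 2)⁻¹}.Finite from h1).subset fun s hs => ?_
  simp only [Set.mem_ofPred_eq, not_lt] at hs ⊢
  have h2 : 0 < ‖(run t s).2.2‖ := norm_pos_iff.2 (ht.admissible s).2.2.ne_zero
  unfold weight
  gcongr

theorem Controlled.summable_norm_h {μ : ℂ} {t : ℂ × ℂ × ℂ} (hc : Controlled t)
    (ht : BowditchTree μ t) : Summable fun s => ‖h μ (run t s).2.2‖ := by
  refine Summable.of_norm_bounded_eventually (hc.summable.mul_left (2 + ‖μ‖)) ?_
  -- Above this threshold both size conditions of `norm_h_le` hold.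
  refine (hc.finite_norm_le ht (M := 2 + 2 * ‖μ‖) (by positivity)).subset fun s hs => ?_
  by_contra hlt
  rw [Set.mem_ofPred_eq, not_le] at hlt
  apply hs
  rw [Set.mem_ofPred_eq, norm_norm]
  have := norm_nonneg μ
  exact norm_h_le (by linarith) (by nlinarith) (ht.admissible s).2.2.sq_ne

/-- A positive lower bound for the quantities attached to a trace. -/
theorem exists_pos_le {f : List Bool → ℝ} (hpos : ∀ s, 0 < f s)
    (hfin : {s | f s < 1 / 2}.Finite) : ∃ ε, 0 < ε ∧ ∀ s, ε ≤ f s := by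
  obtain ⟨ε, hε, hmin⟩ := Set.exists_min_image (insert (1 / 2) (f '' {s | f s < 1 / 2})) id
    ((hfin.image f).insert _) ⟨_, Set.mem_insert _ _⟩
  refine ⟨ε, ?_, fun s => ?_⟩
  · rcases hε with rfl | ⟨s, -, rfl⟩
    · norm_num
    · exact hpos s
  · by_cases hs : f s < 1 / 2
    · exact hmin _ (Or.inr ⟨s, hs, rfl⟩)
    · exact (hmin _ (Or.inl rfl)).trans (not_lt.1 hs)

/-- `x` has modulus at least `ε` and so has the real part of its root. -/
def Bounded (ε : ℝ) (x : ℂ) : Prop := ε ≤ ‖x‖ ∧ ε ≤ (root x).re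

theorem bounded_run {ε : ℝ} {t : ℂ × ℂ × ℂ} (h1 : Bounded ε t.1) (h2 : Bounded ε t.2.1)
    (h : ∀ s, Bounded ε (run t s).2.2) (s : List Bool) :
    Bounded ε (run t s).1 ∧ Bounded ε (run t s).2.1 := by
  induction s generalizing t with
  | nil => exact ⟨h1, h2⟩
  | cons x s ih =>
    cases x
    · exact ih (t := child false t) (h []) h2 fun s => h (false :: s)
    · exact ih (t := child true t) h1 (h []) fun s => h (true :: s)

theorem Controlled.exists_bounded {μ : ℂ} {t : ℂ × ℂ × ℂ} (hc : Controlled t)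
    (ht : BowditchTree μ t) : ∃ ε, 0 < ε ∧ ∀ s, Bounded ε (run t s).1 ∧ Bounded ε (run t s).2.1 := by
  have hpos : ∀ {x}, Admissible μ x → 0 < min ‖x‖ (root x).re := fun hx =>
    lt_min (norm_pos_iff.2 hx.ne_zero) hx.root_re_pos
  obtain ⟨ε, hε, hle⟩ := exists_pos_le (f := fun s => min ‖(run t s).2.2‖ (root (run t s).2.2).re)
    (fun s => hpos (ht.admissible s).2.2)
    ((hc.finite_norm_le ht (M := 3) (by norm_num)).subset fun s hs => by
      by_contra hlt
      rw [Set.mem_ofPred_eq, not_le] at hlt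
      have := half_le_root_re hlt.le
      rw [Set.mem_ofPred_eq, min_lt_iff] at hs
      rcases hs with hs | hs <;> linarith)
  obtain ⟨ha, hb, -⟩ := ht.admissible []
  simp only [run] at ha hb
  refine ⟨min ε (min (min ‖t.1‖ (root t.1).re) (min ‖t.2.1‖ (root t.2.1).re)),
    lt_min hε (lt_min (hpos ha) (hpos hb)), bounded_run ?_ ?_ fun s => ?_⟩
  · constructor <;> simp
  · constructor <;> simp
  · have := hle s
    rw [le_min_iff] at this
    exact ⟨(min_le_left _ _).trans this.1, (min_le_left _ _).trans this.2⟩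

/-- A tree of traces whose edges all point upwards and whose new traces are large. -/
structure Tame (μ : ℂ) (ε : ℝ) (t : ℂ × ℂ × ℂ) : Prop where
  tree : BowditchTree μ t
  controlled : Controlled t
  ascending : Ascending t
  fst : Bounded ε t.1
  snd : Bounded ε t.2.1
  large : ∀ s, 2 + 2 * ‖μ‖ ≤ ‖(run t s).2.2‖

theorem norm_sub_sub_two_mul_le {p x y H : ℂ} {A B w T : ℝ}
    (h1 : ‖p - x‖ ≤ A * w) (h2 : ‖y‖ ≤ B * w) (h3 : ‖H‖ ≤ B * T) (hA : 0 ≤ A) (hB : 0 ≤ B)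
    (hw : 0 ≤ w) (hT : 0 ≤ T) : ‖p - x - y - 2 * H‖ ≤ (A + 2 * B) * (w + T) := by
  have h4 : ‖p - x - y - 2 * H‖ ≤ ‖p - x‖ + ‖y‖ + 2 * ‖H‖ := by
    refine (norm_sub_le _ _).trans ?_
    rw [norm_mul, Complex.norm_ofNat]
    gcongr
    exact norm_sub_le _ _
  nlinarith [mul_nonneg hA hT, mul_nonneg hB hw, mul_nonneg hB hT]

/-- The edge into a child borders the newest region of `t` and one older region. `Psi` matches the
older one up to `O(weight t)`; the newest one and those below contribute `O` of their weights. The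
constant depends only on `μ` and `ε`, so it serves the whole tree. -/
theorem Tame.exists_norm_defect_le (μ : ℂ) {ε : ℝ} (hε : 0 < ε) :
    ∃ C, 0 ≤ C ∧ ∀ t, Tame μ ε t → ∀ x, ‖defect μ (child x t)‖ ≤ C * totalWeight t := by
  obtain ⟨A, hA, hAe⟩ : ∃ A, 0 ≤ A ∧ A = 2 * (1 + 2 / 3 * (‖μ‖ / ε ^ 2)) / ε +
      1 / 6 * (2 + (5 + 4 / ε ^ 2 + 4 * ‖μ‖ / ε ^ 2)) * (2 * ‖μ‖) := ⟨_, by positivity, rfl⟩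
  refine ⟨A + 2 * (2 + ‖μ‖), by positivity, fun t ht x => ?_⟩
  have hμ := norm_nonneg μ
  have hlarge := ht.large []
  simp only [run] at hlarge
  have hrel := ht.tree.rel
  obtain ⟨ha, hb, hc⟩ := ht.tree.admissible []
  simp only [run] at ha hb hc
  have hh : ‖h μ t.2.2‖ ≤ (2 + ‖μ‖) * weight t :=
    norm_h_le (by linarith) (by nlinarith) hc.sq_ne
  have hsum : ∀ x, ‖∑' s, h μ (run (child x t) s).2.2‖ ≤ (2 + ‖μ‖) * totalWeight (child x t) := by
    intro x
    have hcx := ht.controlled.child x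
    rw [totalWeight, ← tsum_mul_left]
    refine tsum_of_norm_bounded (hcx.summable.mul_left _).hasSum fun s => ?_
    have := ht.large (x :: s)
    simp only [run] at this
    exact norm_h_le (by linarith) (by nlinarith) (ht.tree.admissible (x :: s)).2.2.sq_ne
  have hT : ∀ x, weight t + totalWeight (child x t) ≤ totalWeight t := by
    intro x
    rw [ht.controlled.totalWeight_eq]
    have h1 := totalWeight_nonneg (child true t)
    have h2 := totalWeight_nonneg (child false t)
    cases x <;> linarith
  have hC : 0 ≤ A + 2 * (2 + ‖μ‖) := by positivity
  refine le_trans ?_ (mul_le_mul_of_nonneg_left (hT x) hC)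
  have hx := hsum x
  have hxT := totalWeight_nonneg (child x t)
  cases x
  · have h1 : ‖Psi μ t.2.1 t.2.2 t.1 - h μ t.2.1‖ ≤ A * weight t := by
      rw [hAe]
      refine norm_Psi_sub_h_le hε ht.snd.1 ht.snd.2 hb.sq_ne (by linarith) (by nlinarith)
        (z := t.2.2 * t.2.1 - t.1) (by ring) ?_ ht.ascending.2
      linear_combination -hrel
    have e : defect μ (child false t) = Psi μ t.2.1 t.2.2 t.1 - h μ t.2.1 - h μ t.2.2 -
        2 * ∑' s, h μ (run (child false t) s).2.2 := by
      rw [defect, Psi_comm]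
      simp only [child, sub_sub_cancel]
      ring
    rw [e]
    exact norm_sub_sub_two_mul_le h1 hh hx hA (by positivity) (weight_nonneg t) hxT
  · have h1 : ‖Psi μ t.1 t.2.2 t.2.1 - h μ t.1‖ ≤ A * weight t := by
      rw [hAe]
      refine norm_Psi_sub_h_le hε ht.fst.1 ht.fst.2 ha.sq_ne (by linarith) (by nlinarith)
        (z := t.1 * t.2.2 - t.2.1) (by ring) ?_ ht.ascending.1
      linear_combination -hrel
    have e : defect μ (child true t) = Psi μ t.1 t.2.2 t.2.1 - h μ t.1 - h μ t.2.2 -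
        2 * ∑' s, h μ (run (child true t) s).2.2 := by
      rw [defect]
      simp only [child, sub_sub_cancel]
    rw [e]
    exact norm_sub_sub_two_mul_le h1 hh hx hA (by positivity) (weight_nonneg t) hxT

/-- Additivity splits the defect over the triples at depth `n`; the right side is the weight from
depth `n` on, and the factor 2 counts the two children of each such triple. -/
theorem norm_defect_le {μ : ℂ} {C : ℝ} (n : ℕ) : ∀ {t : ℂ × ℂ × ℂ}, BowditchTree μ t →
    Controlled t → (∀ s : List Bool, n ≤ s.length → ∀ x,
      ‖defect μ (child x (run t s))‖ ≤ C * totalWeight (run t s)) →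
    ‖defect μ t‖ ≤ 2 * C * (totalWeight t - ∑ s ∈ shortLists n, weight (run t s)) := by
  induction n with
  | zero =>
    intro t ht hc hb
    have h1 := hb [] le_rfl true
    have h2 := hb [] le_rfl false
    simp only [run] at h1 h2
    rw [defect_eq_add ht (hc.summable_norm_h ht).of_norm]
    refine (norm_add_le _ _).trans ?_
    simp only [shortLists, Finset.sum_empty, sub_zero]
    linarith
  | succ n ih =>
    intro t ht hc hb
    have h1 := ih (ht.child true) (hc.child true) fun s hs => hb (true :: s) (by simpa using hs)
    have h2 := ih (ht.child false) (hc.child false) fun s hs => hb (false :: s) (by simpa using hs)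
    rw [defect_eq_add ht (hc.summable_norm_h ht).of_norm]
    refine (norm_add_le _ _).trans ?_
    rw [sum_shortLists_succ, hc.totalWeight_eq]
    simp only [run]
    linarith

theorem BowditchTree.defect_eq_zero {μ : ℂ} {t : ℂ × ℂ × ℂ} (ht : BowditchTree μ t)
    (hc : Controlled t) : defect μ t = 0 := by
  obtain ⟨ε, hε, hbd⟩ := hc.exists_bounded ht
  obtain ⟨C, hC, hdef⟩ := Tame.exists_norm_defect_le μ hε
  have hfin := hc.finite.union (hc.finite_norm_le ht (M := 2 + 2 * ‖μ‖) (by positivity))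
  -- Beyond this depth no edge points the wrong way and no trace is small.
  obtain ⟨N, hN⟩ : ∃ N, ∀ s ∈ {s | ¬ Ascending (PuncturedTorus.run t s)} ∪
      {s | ‖(PuncturedTorus.run t s).2.2‖ ≤ 2 + 2 * ‖μ‖}, s.length ≤ N := by
    obtain ⟨N, hN⟩ := (hfin.image List.length).bddAbove
    exact ⟨N, fun s hs => hN ⟨s, hs, rfl⟩⟩
  have htame : ∀ s : List Bool, N + 1 ≤ s.length → Tame μ ε (PuncturedTorus.run t s) := by
    intro s hs
    have hcs : ∀ s : List Bool, Controlled (PuncturedTorus.run t s) := fun s => by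
      induction s using List.reverseRecOn with
      | nil => exact hc
      | append_singleton s x ih => rw [run_append]; exact ih.child x
    refine ⟨ht.run s, hcs s, ?_, (hbd s).1, (hbd s).2, fun u => ?_⟩
    · by_contra hna
      have := hN s (Or.inl hna)
      omega
    · by_contra hlt
      have := hN (s ++ u) (Or.inr (by rw [Set.mem_ofPred_eq, run_append]; exact (not_le.1 hlt).le))
      rw [List.length_append] at this
      omega
  have hle : ∀ n, N + 1 ≤ n → ‖defect μ t‖ ≤
      2 * C * (totalWeight t - ∑ s ∈ shortLists n, weight (PuncturedTorus.run t s)) :=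
    fun n hn => norm_defect_le n ht hc fun s hs => hdef _ (htame s (hn.trans hs))
  have hlim : Tendsto (fun n => 2 * C * (totalWeight t -
      ∑ s ∈ shortLists n, weight (PuncturedTorus.run t s))) atTop (𝓝 0) := by
    have := ((tendsto_sum_shortLists hc.summable).const_sub (totalWeight t)).const_mul (2 * C)
    rwa [← totalWeight, sub_self, mul_zero] at this
  have := ge_of_tendsto hlim (eventually_atTop.2 ⟨N + 1, hle⟩)
  exact norm_eq_zero.1 (le_antisymm this (norm_nonneg _))

/-- The identity on a tree of traces. -/
theorem BowditchTree.summable_and_eq {μ : ℂ} (hμ : μ ≠ 4) {t : ℂ × ℂ × ℂ}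
    (ht : BowditchTree μ t) : (Summable fun s => ‖h μ (PuncturedTorus.run t s).2.2‖) ∧
      h μ t.1 + h μ t.2.1 + 2 * ∑' s, h μ (PuncturedTorus.run t s).2.2 =
        Psi μ t.1 t.2.1 (t.1 * t.2.1 - t.2.2) := by
  have hc := ht.controlled hμ
  refine ⟨hc.summable_norm_h ht, ?_⟩
  have h0 := ht.defect_eq_zero hc
  rw [defect] at h0
  linear_combination -h0

/-! ### The identity for representations -/

theorem IsFreeBasis.curve_mul_pow_injective {a b : Pi1} (h : IsFreeBasis a b) :
    Function.Injective fun n : ℕ => curve (b * a ^ n) := by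
  intro m n hmn
  obtain ⟨p, q, hd⟩ := h.exists_isDual
  have hprim : ∀ n : ℕ, IsPrimitive (b * a ^ n) := fun n => by
    have := (h.mul_zpow_right n).isPrimitive_right
    rwa [zpow_natCast] at this
  have hp : ∀ n : ℕ, p (b * a ^ n) = n := fun n => by
    have := hd.left.zpow a n
    rw [zpow_natCast] at this
    rw [hd.left, this, hd.left_fst, hd.left_snd]; ring
  have hq : ∀ n : ℕ, q (b * a ^ n) = 1 := fun n => by
    have := hd.right.zpow a n
    rw [zpow_natCast] at this
    rw [hd.right, this, hd.right_fst, hd.right_snd]; ring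
  have := hd.left.curveRel hd.right ((curve_eq_iff (hprim m) (hprim n)).1 hmn)
  rw [hp, hp, hq, hq] at this
  omega

/-- The traces of the curves around a region do not decay. -/
theorem BowditchConditions.elemTr_mul_ne (hB : BowditchConditions ρ) {a b : Pi1}
    (h : IsFreeBasis a b) {l : ℂ} (hl : 1 < ‖l‖) (ha : elemTr ρ a = l + l⁻¹) :
    elemTr ρ (b * a) ≠ l⁻¹ * elemTr ρ b := by
  intro hb
  have hl0 : l ≠ 0 := by rintro rfl; simp at hl; linarith
  have hpow : ∀ n : ℕ, elemTr ρ (b * a ^ n) = l⁻¹ ^ n * elemTr ρ b ∧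
      elemTr ρ (b * a ^ (n + 1)) = l⁻¹ ^ (n + 1) * elemTr ρ b := by
    intro n
    induction n with
    | zero => simpa using hb
    | succ n ih =>
      refine ⟨ih.2, ?_⟩
      have e : b * a ^ (n + 1 + 1) = b * a ^ n * a * a := by group
      have e' : b * a ^ n * a = b * a ^ (n + 1) := by group
      rw [e, elemTr_mul_self_mul, e', ih.1, ih.2, ha]
      have hz : l * l⁻¹ = 1 := mul_inv_cancel₀ hl0
      linear_combination (l⁻¹ ^ n * elemTr ρ b) * hz
  have hlim : Tendsto (fun n : ℕ => ‖l⁻¹ ^ n * elemTr ρ b‖) atTop (𝓝 0) := by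
    have h1 : Tendsto (fun n : ℕ => l⁻¹ ^ n) atTop (𝓝 0) := by
      apply tendsto_pow_atTop_nhds_zero_of_norm_lt_one
      rw [norm_inv]
      exact inv_lt_one_of_one_lt₀ hl
    simpa using (h1.mul_const (elemTr ρ b)).norm
  obtain ⟨N, hN⟩ := eventually_atTop.1 (hlim.eventually (ge_mem_nhds (show (0 : ℝ) < 2 by norm_num)))
  refine Set.infinite_of_injective_forall_mem (f := fun n : ℕ => curve (b * a ^ (N + n)))
    (h.curve_mul_pow_injective.comp (add_right_injective N)) (fun n => ?_) hB.finite_small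
  have hprim := (h.mul_zpow_right ((N + n : ℕ) : ℤ)).isPrimitive_right
  rw [zpow_natCast] at hprim
  rw [Set.mem_ofPred_eq, tr_curve_eq ρ hprim, (hpow _).1]
  exact hN _ (Nat.le_add_right _ _)

/-- If `x² = μ`, the trace relation factors as `(z - l⁻¹y)(z - l y) = 0`. Then the traces around the
region decay geometrically in one direction, producing infinitely many short curves. -/
theorem BowditchConditions.admissible (hB : BowditchConditions ρ) (X : Omega) :
    Admissible (peripheralTrace ρ + 2) (tr ρ X) := by
  have hmem : ∀ r ∈ Set.Icc (-2 : ℝ) 2, tr ρ X ≠ r := fun r hr => hB.notMem_interval X r hr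
  refine ⟨hmem, fun hsq => ?_⟩
  obtain ⟨l, hl, hX⟩ := exists_eq_add_inv hmem
  have hl0 : l ≠ 0 := by rintro rfl; simp at hl; linarith
  obtain ⟨a, b, h, rfl⟩ := exists_curve_eq X
  rw [tr_curve_eq ρ h.isPrimitive_left] at hX hsq
  have hrel := h.trace_eq ρ
  rw [elemTr_mul_comm ρ a b, ← hsq, hX] at hrel
  have hprod : (elemTr ρ (b * a) - l⁻¹ * elemTr ρ b) * (elemTr ρ (b * a) - l * elemTr ρ b) = 0 := by
    have hz : l * l⁻¹ = 1 := mul_inv_cancel₀ hl0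
    linear_combination hrel + elemTr ρ b ^ 2 * hz
  rcases mul_eq_zero.1 hprod with h0 | h0
  · exact hB.elemTr_mul_ne h hl hX (sub_eq_zero.1 h0)
  -- The other factor means decay in the opposite direction around `a`, so the basis is reversed.
  · have hba : IsFreeBasis a⁻¹ (b * a) := by
      simpa using (h.mul_zpow_right 1).inv_left
    refine hB.elemTr_mul_ne hba hl (by rw [elemTr_inv, hX]) ?_
    rw [mul_inv_cancel_right, sub_eq_zero.1 h0, inv_mul_cancel_left₀ hl0]

/-- The traces of a basis and of its product. -/
def traceTriple (ρ : Pi1 →* SL(2, ℂ)) (p : Pi1 × Pi1) : ℂ × ℂ × ℂ :=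
  (elemTr ρ p.1, elemTr ρ p.2, elemTr ρ (p.1 * p.2))

theorem run_traceTriple (p : Pi1 × Pi1) (s : List Bool) :
    run (traceTriple ρ p) s = traceTriple ρ (descend p s) := by
  induction s generalizing p with
  | nil => rfl
  | cons x s ih =>
    cases x
    · rw [descend, ← ih, run, traceTriple, child, traceTriple]
      simp only [elemTr_mul_self_mul]
    · rw [descend, ← ih, run, traceTriple, child, traceTriple]
      simp only [elemTr_mul_mul_self]

theorem IsFreeBasis.tr_descendCurve {a b : Pi1} (h : IsFreeBasis a b) (s : List Bool) :
    tr ρ (descendCurve (a, b) s) = (run (traceTriple ρ (a, b)) s).2.2 := by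
  rw [run_traceTriple, descendCurve, tr_curve_eq ρ
    (IsFreeBasis.descend (p := (a, b)) h s).isPrimitive_mul]
  rfl

theorem BowditchConditions.bowditchTree (hB : BowditchConditions ρ) {a b : Pi1}
    (h : IsFreeBasis a b) : BowditchTree (peripheralTrace ρ + 2) (traceTriple ρ (a, b)) := by
  refine ⟨h.trace_eq ρ, fun s => ?_, ?_⟩
  · have hs := IsFreeBasis.descend (p := (a, b)) h s
    rw [run_traceTriple]
    refine ⟨?_, ?_, ?_⟩
    · rw [traceTriple, ← tr_curve_eq ρ hs.isPrimitive_left]; exact hB.admissible _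
    · rw [traceTriple, ← tr_curve_eq ρ hs.isPrimitive_right]; exact hB.admissible _
    · rw [traceTriple, ← tr_curve_eq ρ hs.isPrimitive_mul]; exact hB.admissible _
  · refine (hB.finite_small.preimage h.descendCurve_injective.injOn).subset fun s hs => ?_
    rw [Set.mem_preimage, Set.mem_ofPred_eq, h.tr_descendCurve]
    exact hs

end PuncturedTorus

end

theorem theorem2p1 (ρ : Pi1 →* SL(2, ℂ)) (hirr : (linearRep ρ).IsIrreducible)
    (hB : BowditchConditions ρ) (μ : ℂ) (hμ : μ = peripheralTrace ρ + 2) :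
    -- no denominator in `h` or `Psi` vanishes
    (∀ X : Omega, tr ρ X ≠ 0 ∧ tr ρ X ^ 2 ≠ μ) ∧
    ∀ e : Tree.Dart,
      Summable (fun X : OmegaMinus e => ‖2 * h μ (tr ρ X)‖) ∧
      ∀ X Y Z W : Omega, EdgeLabel e X Y Z W →
        ∑ V ∈ OmegaZero e, h μ (tr ρ V) + ∑' V : OmegaMinus e, 2 * h μ (tr ρ V) =
          Psi μ (tr ρ X) (tr ρ Y) (tr ρ W) := by
  subst hμ
  refine ⟨fun X => ⟨(hB.admissible X).ne_zero, (hB.admissible X).sq_ne⟩, fun e => ?_⟩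
  -- The value `μ = 4` is `τ = 2`, the reducible case.
  have hne : peripheralTrace ρ + 2 ≠ 4 := fun h4 =>
    peripheralTrace_ne_two hirr (by linear_combination h4)
  obtain ⟨a, b, hab, hfst, hsnd⟩ := exists_isFreeBasis_of_dart e
  obtain ⟨hsum, heq⟩ := (hB.bowditchTree hab).summable_and_eq hne
  simp only [← hab.tr_descendCurve] at hsum heq
  rw [hab.omegaMinus_eq_range hfst hsnd]
  refine ⟨?_, fun X Y Z W hl => ?_⟩
  · rw [← (Equiv.ofInjective _ hab.descendCurve_injective).summable_iff]
    simpa [Function.comp_def] using hsum.mul_left 2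
  · rw [← (Equiv.ofInjective _ hab.descendCurve_injective).tsum_eq]
    simp only [Equiv.ofInjective_apply, tsum_mul_left]
    have hzero : ∑ V ∈ OmegaZero e, h (peripheralTrace ρ + 2) (tr ρ V) =
        h (peripheralTrace ρ + 2) (tr ρ (curve a)) +
          h (peripheralTrace ρ + 2) (tr ρ (curve b)) := by
      classical
      have : OmegaZero e = {curve a, curve b} := by
        ext V; rw [hab.omegaZero_eq hfst hsnd]; simp
      rw [this, Finset.sum_pair hab.adj.ne]
    obtain ⟨hXY, rfl⟩ := hab.edgeLabel hfst hsnd hl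
    rw [hzero, tr_curve_eq ρ hab.isPrimitive_left, tr_curve_eq ρ hab.isPrimitive_right]
    refine heq.trans ?_
    -- The head region `a b⁻¹` has trace `xy - z`, the third argument of `Psi` on the tree of
    -- traces.
    rw [tr_curve_eq ρ hab.inv_right.isPrimitive_mul, elemTr_mul_inv]
    rcases hXY with ⟨rfl, rfl⟩ | ⟨rfl, rfl⟩
    · rw [tr_curve_eq ρ hab.isPrimitive_left, tr_curve_eq ρ hab.isPrimitive_right]; rfl
    · rw [tr_curve_eq ρ hab.isPrimitive_left, tr_curve_eq ρ hab.isPrimitive_right, Psi_comm]; rfl
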